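/- Let $\mathfrak g$ be a complex finite dimensional simple Lie algebra, $\mathfrak h$ a Cartan subalgebra, $\mathfrak h_{\mathbb R}^*$ the real span of the roots, $\langle\cdot,\cdot\rangle$ the inner product on $\mathfrak h_{\mathbb R}^*$ that is proportional to the one induced by the Killing form and normalized so that long roots satisfy $\langle\alpha,\alpha\rangle=2$, and $|x|^2=\langle x,x\rangle$. Fix simple roots $\alpha_1,\dots,\alpha_l$; let $\Delta_+$ be the set of positive roots, $\rho$ half their sum, $\theta$ the highest root, $h^\vee=1+\langle\rho,\theta^\vee\rangle$ the dual Coxeter number and $W$ the Weyl group, where $\alpha^\vee=2\alpha/\langle\alpha,\alpha\rangle$. Let $Y^\vee$ be the lattice generated by the simple coroots $\alpha_i^\vee$, let $X$ be the weight lattice, generated by the fundamental weights $\lambda^{(i)}$, $\langle\lambda^{(i)},\alpha_j^\vee\rangle=\delta_{ij}$, and let $\operatorname{vol}$ denote the volume of a lattice. Let $\kappa$ be a positive integer and $$C_\kappa=\{x\in\mathfrak h_{\mathbb R}^* : \langle x,\alpha_i\rangle\ge 0\ (1\le i\le l),\ \langle x,\theta\rangle\le\kappa\}.$$ For $\lambda,\mu\in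 X$ put $$\tilde\Xi_{\lambda\mu}=\frac{\sqrt{-1}^{\,|\Delta_+|}}{\kappa^{l/2}}\left|\frac{\operatorname{vol}(X)}{\operatorname{vol}(Y^\vee)}\right|^{1/2}\sum_{w\in W}\det(w)\exp\Bigl(-\frac{2\pi\sqrt{-1}}{\kappa}\langle w(\lambda),\mu\rangle\Bigr),\qquad \tilde\Theta_{\lambda}=\exp\Bigl(\frac{\pi\sqrt{-1}}{\kappa}|\lambda|^2-\frac{\pi\sqrt{-1}}{h^\vee}|\rho|^2\Bigr).$$ Let $t\ge 1$ and let $\mathcal C=(m_1,\dots,m_t)$ be a sequence of integers. For $0\le k\le t$ let $a_k$ and $c_k$ be the upper left and lower left entries of $$\Theta^{m_k}\,\Xi\,\Theta^{m_{k-1}}\,\Xi\cdots\Theta^{m_1}\,\Xi,\qquad \Xi=\begin{pmatrix}0&-1\\1&0\end{pmatrix},\quad \Theta=\begin{pmatrix}1&1\\0&1\end{pmatrix},$$ so that $a_0=1$, $c_0=0$, and assume that $a_k\ne0$ for $k=1,\dots,t$. For $\lambda_0,\lambda_{t+1}\in X$ let $$\mathcal T^{\mathcal C}_{\lambda_0,\lambda_{t+1}}=\sum_{\lambda_1,\dots,\lambda_t\in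 C_\kappa\cap X}\tilde\Xi_{\lambda_{t+1}\lambda_t}\,\tilde\Theta_{\lambda_t}^{m_t}\,\tilde\Xi_{\lambda_t\lambda_{t-1}}\cdots\tilde\Theta_{\lambda_1}^{m_1}\,\tilde\Xi_{\lambda_1\lambda_0}.$$ Then for all $\lambda_0,\lambda_{t+1}\in X$ $$\mathcal T^{\mathcal C}_{\lambda_0,\lambda_{t+1}}=K^{\mathcal C}_{\lambda_0}\sum_{w\in W}\det(w)\sum_{\mu\in Y^\vee/a_tY^\vee}\exp\Bigl(-\frac{\pi\sqrt{-1}\,c_t}{a_t\kappa}\Bigl|\lambda_{t+1}+\kappa\mu+\frac{w(\lambda_0)}{c_t}\Bigr|^2\Bigr),$$ where the inner sum may be taken over any system of representatives of $Y^\vee/a_tY^\vee$, and $$K^{\mathcal C}_{\lambda_0}=\frac{\sqrt{-1}^{\,(t+1)|\Delta_+|}}{(\kappa|a_t|)^{l/2}\operatorname{vol}(Y^\vee)}\,\zeta^{\,lD_t}\exp\Bigl(-\frac{\pi\sqrt{-1}}{h^\vee}\Bigl(\sum_{i=1}^t m_i\Bigr)|\rho|^2\Bigr)\exp\Bigl(-\frac{\pi\sqrt{-1}}{\kappa}\Bigl(\sum_{i=1}^{t-1}\frac1{a_{i-1}a_i}\Bigr)|\lambda_0|^2\Bigr),$$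 with $\zeta=\exp\frac{\pi\sqrt{-1}}4$ and $D_t=\operatorname{sign}(a_0a_1)+\cdots+\operatorname{sign}(a_{t-1}a_t)$. -/

import Mathlib

/-- The real root system of a complex semisimple Lie algebra `𝔤` relative to a Cartan subalgebra
`𝔥`: it lives in `𝔥_ℝ^*`, the real span of the roots inside the dual of `𝔥`. -/
noncomputable abbrev realRootSystem {𝔤 : Type*} [LieRing 𝔤] [LieAlgebra ℂ 𝔤]
    [FiniteDimensional ℂ 𝔤] [LieAlgebra.IsKilling ℂ 𝔤]
    (𝔥 : LieSubalgebra ℂ 𝔤) [𝔥.IsCartanSubalgebra] :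
    RootPairing 𝔥.root ℝ ((LieAlgebra.IsKilling.rootSystem 𝔥).rootSpan ℝ)
      ((LieAlgebra.IsKilling.rootSystem 𝔥).corootSpan ℝ) :=
  (LieAlgebra.IsKilling.rootSystem 𝔥).restrictScalars ℝ

/- Below, `P` is a finite real root system in `M` (with dual space `N`), `b` is a base of `P`, that
is, a set of simple roots `Π = {α_i : i ∈ b.support}`, and `θ` is the index of the highest root. -/

namespace LieModular

section Defs

variable {ι M N : Type*} [Fintype ι] [AddCommGroup M] [Module ℝ M] [AddCommGroup N] [Module ℝ N]
variable (P : RootPairing ι ℝ M N) [P.IsRootSystem]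

/-- The standard inner product `⟨·,·⟩` on `𝔥_ℝ^*`: the Weyl group invariant inner product (unique
up to a scalar for an irreducible root system, hence proportional to the one induced by the
Killing form), scaled so that the longest roots satisfy `⟨α, α⟩ = 2`. -/
noncomputable def stdForm : LinearMap.BilinForm ℝ M :=
  (2 / ⨆ i, P.RootForm (P.root i) (P.root i)) • P.RootForm

/-- `|x|²` for the standard inner product. -/
noncomputable def normSq (x : M) : ℝ := stdForm P x x

/-- The coroot `α_i^∨ = 2 α_i / ⟨α_i, α_i⟩`, as an element of `𝔥_ℝ^*`. -/
noncomputable def corootVec (i : ι) : M := (2 / normSq P (P.root i)) • P.root i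

/-- `det(w)` for an element `w` of the Weyl group, acting on `𝔥_ℝ^*`. -/
noncomputable def weylDet (w : P.weylGroup) : ℝ := LinearMap.det (P.weylGroupRootRep w)

variable {P}
variable (b : P.Base)

/-- The coroot lattice `Y^∨`, generated by the simple coroots. -/
noncomputable def corootLattice : Submodule ℤ M :=
  Submodule.span ℤ (Set.range fun i : b.support => corootVec P i)

/-- The fundamental weights `λ_i`: the basis of `𝔥_ℝ^*` dual to the simple coroots. -/
noncomputable def fundWeight : Module.Basis b.support ℝ M :=
  open Classical in b.toCoweightBasis.dualBasis.map P.toPerfPair.symm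

/-- The weight lattice `X`, generated by the fundamental weights. -/
noncomputable def weightLattice : Submodule ℤ M :=
  Submodule.span ℤ (Set.range (fundWeight b))

variable (P) in
/-- The volume, for the standard inner product, of the parallelepiped spanned by a finite family
`v` (the square root of its Gram determinant); for a `ℤ`-basis `v` of a lattice of full rank this is
the volume of the lattice. -/
noncomputable def gramVol {I : Type*} [Fintype I] (v : I → M) : ℝ :=
  open Classical in √(Matrix.of fun i j => stdForm P (v i) (v j)).det

/-- `vol(X)`. -/
noncomputable def volX : ℝ := gramVol P (fundWeight b)

/-- `vol(Y^∨)`. -/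
noncomputable def volY : ℝ := gramVol P fun i : b.support => corootVec P i

/-- `l`, the rank. -/
def rank : ℕ := b.support.card

/-- `i` is the index of a positive root: a sum of simple roots. -/
def IsPosRoot (i : ι) : Prop := P.root i ∈ AddSubmonoid.closure (P.root '' b.support)

/-- `|Δ_+|`, the number of positive roots. -/
noncomputable def numPos : ℕ := Nat.card {i // IsPosRoot b i}

/-- `ρ`, half the sum of the positive roots. -/
noncomputable def rho : M :=
  open Classical in (1 / 2 : ℝ) • ∑ i with IsPosRoot b i, P.root i

/-- `θ` is the highest root: `θ - α` is a sum of simple roots for every root `α`. -/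
def IsHighestRoot (θ : ι) : Prop :=
  ∀ i, P.root θ - P.root i ∈ AddSubmonoid.closure (P.root '' b.support)

/-- The dual Coxeter number `h^∨ = 1 + ⟨ρ, θ^∨⟩`. -/
noncomputable def dualCoxeter (θ : ι) : ℝ := 1 + stdForm P (rho b) (corootVec P θ)

/-- `C_κ ∩ X`: the weights in the closed `κ`-alcove
`C_κ = {x | ⟨x, α_i⟩ ≥ 0 for all simple α_i, and ⟨x, θ⟩ ≤ κ}`. -/
def alcoveWeights (θ : ι) (κ : ℕ) : Set M :=
  {x | x ∈ weightLattice b ∧ (∀ i ∈ b.support, 0 ≤ stdForm P x (P.root i)) ∧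
    stdForm P x (P.root θ) ≤ κ}

/-- The entry `𝓡(Ξ)_{λ μ}`. -/
noncomputable def xiEntry (κ : ℕ) (x y : M) : ℂ :=
  Complex.I ^ numPos b / (((κ : ℝ) ^ ((rank b : ℝ) / 2) : ℝ) : ℂ) *
    ((|volX b / volY b| ^ (1 / 2 : ℝ) : ℝ) : ℂ) *
    ∑ᶠ w : P.weylGroup, (weylDet P w : ℂ) *
      Complex.exp (-(2 * Real.pi * Complex.I / κ) * (stdForm P (w • x) y : ℂ))

/-- The entry `𝓡(Θ)_{λ μ}`. -/
noncomputable def thetaEntry (θ : ι) (κ : ℕ) (x y : M) : ℂ :=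
  open Classical in
  if x = y then
    Complex.exp (Real.pi * Complex.I / κ * (normSq P x : ℂ) -
      Real.pi * Complex.I / (dualCoxeter b θ : ℂ) * (normSq P (rho b) : ℂ))
  else 0

/-- The sequence `λ_0, λ_1, …, λ_t, λ_{t+1}` with prescribed end points `x = λ_0`,
`y = λ_{t+1}`. -/
def fullPath {t : ℕ} (x y : M) (p : Fin t → M) : Fin (t + 2) → M :=
  Fin.cons (α := fun _ => M) x (Fin.snoc (α := fun _ => M) p y)

/-- `𝓣^𝓒_{λ_0, λ_{t+1}}` for `𝓒 = (m 1, …, m t)`: the sum over `λ_1, …, λ_t ∈ C_κ ∩ X` of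
`Ξ_{λ_{t+1} λ_t} Θ_{λ_t}^{m_t} Ξ_{λ_t λ_{t-1}} ⋯ Θ_{λ_1}^{m_1} Ξ_{λ_1 λ_0}`. -/
noncomputable def iterProd (θ : ι) (κ : ℕ) (m : ℕ → ℤ) (t : ℕ) (x y : M) : ℂ :=
  ∑ᶠ p : Fin t → alcoveWeights b θ κ,
    (∏ j : Fin (t + 1),
      xiEntry b κ (fullPath x y (fun i => (p i : M)) j.succ)
        (fullPath x y (fun i => (p i : M)) j.castSucc)) *
    ∏ i : Fin t, thetaEntry b θ κ (p i) (p i) ^ m (i + 1)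

end Defs

/-- `B_k = Θ^{m_k} Ξ Θ^{m_{k-1}} Ξ ⋯ Θ^{m_1} Ξ` in `SL(2, ℤ)`, with `B_0 = 1`; here
`Ξ = ModularGroup.S = [0, -1; 1, 0]` and `Θ = ModularGroup.T = [1, 1; 0, 1]`. -/
def matB (m : ℕ → ℤ) : ℕ → Matrix.SpecialLinearGroup (Fin 2) ℤ
  | 0 => 1
  | k + 1 => ModularGroup.T ^ m (k + 1) * ModularGroup.S * matB m k

/-- `a_k`, the upper left entry of `B_k`. -/
def aSeq (m : ℕ → ℤ) (k : ℕ) : ℤ := (matB m k).1 0 0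

/-- `c_k`, the lower left entry of `B_k`. -/
def cSeq (m : ℕ → ℤ) (k : ℕ) : ℤ := (matB m k).1 1 0

/-- `D_t = sign(a_0 a_1) + ⋯ + sign(a_{t-1} a_t)`. -/
def signSum (m : ℕ → ℤ) (t : ℕ) : ℤ :=
  ∑ i ∈ Finset.Icc 1 t, (aSeq m (i - 1) * aSeq m i).sign

section Const

variable {ι M N : Type*} [Fintype ι] [AddCommGroup M] [Module ℝ M] [AddCommGroup N] [Module ℝ N]
variable {P : RootPairing ι ℝ M N} [P.IsRootSystem] (b : P.Base)

/-- The constant `K^𝓒_{λ_0}`, with `ζ = exp(π i / 4)`. -/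
noncomputable def constK (θ : ι) (κ : ℕ) (m : ℕ → ℤ) (t : ℕ) (x : M) : ℂ :=
  Complex.I ^ ((t + 1) * numPos b) /
      ((((κ : ℝ) * |(aSeq m t : ℝ)|) ^ ((rank b : ℝ) / 2) * volY b : ℝ) : ℂ) *
    Complex.exp (Real.pi * Complex.I / 4) ^ ((rank b : ℤ) * signSum m t) *
    Complex.exp (-(Real.pi * Complex.I / (dualCoxeter b θ : ℂ)) *
      (∑ i ∈ Finset.Icc 1 t, (m i : ℂ)) * (normSq P (rho b) : ℂ)) *
    Complex.exp (-(Real.pi * Complex.I / κ) *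
      (∑ i ∈ Finset.Icc 1 (t - 1), 1 / ((aSeq m (i - 1) : ℂ) * (aSeq m i : ℂ))) *
      (normSq P x : ℂ))

/-- The sublattice `a Y^∨` of `Y^∨`. -/
noncomputable def mulCorootLattice (a : ℤ) : Submodule ℤ (corootLattice b) :=
  LinearMap.range (LinearMap.lsmul ℤ (corootLattice b) a)

theorem stdForm_root_pos (i : ι) : 0 < stdForm P (P.root i) (P.root i) := by
  have hpos : ∀ i, 0 < P.RootForm (P.root i) (P.root i) := fun i =>
    P.rootForm_pos_of_ne_zero (Submodule.subset_span ⟨i, rfl⟩) (P.ne_zero i)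
  have hsup : 0 < ⨆ i, P.RootForm (P.root i) (P.root i) :=
    (hpos i).trans_le (le_ciSup (f := fun i => P.RootForm (P.root i) (P.root i))
      (Set.finite_range _).bddAbove i)
  simpa [stdForm] using mul_pos (div_pos two_pos hsup) (hpos i)

/-- Pairing with `α_i^∨ ∈ 𝔥_ℝ^*` through the inner product is pairing with the coroot in `𝔥`. -/
theorem stdForm_corootVec (x : M) (i : ι) :
    stdForm P x (corootVec P i) = P.toLinearMap x (P.coroot i) := by
  have hne := (stdForm_root_pos (P := P) i).ne'
  have h3 : P.RootForm (P.root i) (P.root i) * P.toLinearMap x (P.coroot i) =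
      2 * P.RootForm x (P.root i) := by
    have h := congrArg (P.toLinearMap x) (P.rootForm_self_smul_coroot i)
    rw [map_smul, map_nsmul, P.toLinearMap_apply_apply_Polarization] at h
    have hsymm : P.RootForm (P.root i) x = P.RootForm x (P.root i) := by
      simp [RootPairing.rootForm_apply_apply, mul_comm]
    rw [hsymm] at h
    simpa using h
  have h4 : stdForm P (P.root i) (P.root i) * P.toLinearMap x (P.coroot i) =
      2 * stdForm P x (P.root i) := by
    simp only [stdForm, LinearMap.smul_apply, smul_eq_mul]
    linear_combination (2 / ⨆ i, P.RootForm (P.root i) (P.root i)) * h3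
  rw [corootVec, map_smul, smul_eq_mul, normSq, div_mul_eq_mul_div, div_eq_iff hne]
  linarith

/-- The fundamental weights satisfy `⟨λ_i, α_j^∨⟩ = δ_{ij}`; equivalently, the coordinates of `x`
with respect to them are the numbers `⟨x, α_i^∨⟩`. -/
theorem fundWeight_repr (x : M) (i : b.support) :
    (fundWeight b).repr x i = stdForm P x (corootVec P i) := by
  classical
  rw [stdForm_corootVec]
  simp [fundWeight, Module.Basis.dualBasis_repr]

/- The sums `∑ᶠ` used here run over finite sets, as the next three facts show. -/

theorem finite_weylGroup : Finite P.weylGroup := by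
  refine Finite.of_injective (fun w : P.weylGroup => P.weylGroupToPerm w) fun w w' h => ?_
  have hroot : ∀ i, w • P.root i = w' • P.root i := by
    intro i
    rw [RootPairing.weylGroup_apply_root, RootPairing.weylGroup_apply_root]
    exact congrArg (fun e : Equiv.Perm ι => P.root (e i)) h
  have hlin : P.weylGroupRootRep w = P.weylGroupRootRep w' := by
    refine LinearMap.ext_on (s := Set.range P.root) RootPairing.IsRootSystem.span_root_eq_top ?_
    rintro _ ⟨i, rfl⟩
    exact hroot i
  refine Subtype.ext (RootPairing.Equiv.weightHom_injective P ?_)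
  ext x
  exact LinearMap.congr_fun hlin x

theorem finite_quotient {a : ℤ} (ha : a ≠ 0) :
    Finite (corootLattice b ⧸ mulCorootLattice b a) := by
  have : Module.Finite ℤ (corootLattice b) :=
    Module.Finite.span_of_finite ℤ (Set.finite_range _)
  refine Module.finite_of_fg_torsion _ ?_
  intro q
  refine ⟨⟨a, mem_nonZeroDivisors_of_ne_zero ha⟩, ?_⟩
  obtain ⟨v, rfl⟩ := Submodule.Quotient.mk_surjective _ q
  change a • Submodule.Quotient.mk (p := mulCorootLattice b a) v = 0
  rw [← Submodule.Quotient.mk_smul, Submodule.Quotient.mk_eq_zero]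
  exact ⟨v, rfl⟩

theorem finite_alcoveWeights {θ : ι} (hθ : IsHighestRoot b θ) (κ : ℕ) :
    (alcoveWeights b θ κ).Finite := by
  classical
  have hfin : (Set.univ.pi fun i : b.support =>
      ((Int.cast : ℤ → ℝ) '' Set.Icc 0 ⌊2 / normSq P (P.root i) * κ⌋)).Finite :=
    Set.Finite.pi fun i => (Set.finite_Icc _ _).image _
  refine Set.Finite.of_injOn (f := fun x (i : b.support) => (fundWeight b).repr x i) ?_ ?_ hfin
  · rintro x ⟨hx, hdom, hle⟩ i -
    have hcone : ∀ y ∈ AddSubmonoid.closure (P.root '' b.support), 0 ≤ stdForm P x y := by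
      intro y hy
      induction hy using AddSubmonoid.closure_induction with
      | mem y hy => obtain ⟨j, hj, rfl⟩ := hy; exact hdom j hj
      | zero => simp
      | add y z _ _ h1 h2 => rw [map_add]; exact add_nonneg h1 h2
    obtain ⟨n, hn⟩ := ((fundWeight b).mem_span_iff_repr_mem ℤ x).1 hx i
    have hn' : (n : ℝ) = 2 / normSq P (P.root i) * stdForm P x (P.root i) := by
      have h := hn.trans (fundWeight_repr b x i)
      rw [corootVec, map_smul, smul_eq_mul] at h
      simpa using h
    have hc : 0 < 2 / normSq P (P.root i) := div_pos two_pos (stdForm_root_pos (P := P) i)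
    have hi : stdForm P x (P.root i) ≤ κ := by
      have := hcone _ (hθ i)
      rw [map_sub] at this
      linarith
    refine ⟨n, ⟨?_, ?_⟩, by simpa using hn⟩
    · have : (0 : ℝ) ≤ n := hn' ▸ mul_nonneg hc.le (hdom i i.2)
      exact_mod_cast this
    · exact Int.le_floor.2 (hn' ▸ mul_le_mul_of_nonneg_left hi hc.le)
  · intro x _ y _ h
    exact (fundWeight b).repr.injective (Finsupp.ext fun i => congrFun h i)

end Const

end LieModular

/-! The proof is an induction on t for the uncompleted Gauss sum, whose terms are the exponentials
of -πi/(a_t κ) times c_t|y + κμ|² + 2⟨y + κμ, w(x)⟩. This form also makes sense for t = 0, where c_0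
= 0 and it is the single matrix entry Ξ.

For the step, the sum over z in C_κ ∩ X of Ξ_{yz} Θ_z^m T(z), with T the product obtained so far, is
turned into a mean over the whole weight lattice. As functions of z, Ξ_{yz} and T(z) are both
antisymmetric under W and periodic under κY^∨. The summand is therefore invariant under the affine
Weyl group, and it vanishes on the walls of the alcove. Since the affine Weyl group acts simply
transitively on alcoves, the alcove sum is, up to a factor |W|/(κ^l vol Y^∨), the mean over X,
regularised by a Gaussian exp(-πε|z|²) with ε → 0 (`tendsto_unfold`). In the mean, the W-sum inside
Ξ_{yz} reduces to |W| equal copies of one exponential.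

Inserting the induction hypothesis leaves means over X of exp(πi r|z|² - 2πi⟨z, φ⟩) with r =
a_{t+1}/(κ a_t). Poisson summation on the dual pair Y^∨, X at the parameter ε - ir gives a theta
series on Y^∨ whose phases depend only on classes modulo a_{t+1}Y^∨, because Y^∨ is even. The limit
is a finite Gauss sum (`tendsto_gauss_reciprocity_shift`, `tendsto_gaussTerm`). The argument of
(-ir)^{l/2} produces the power of ζ, and expanding the square produces the phase in |x|²/(a_t
a_{t+1}). `alcove_sum_eq` assembles the step and `iterProd_eq` runs the induction.

Finally c_t = a_{t-1} is nonzero for t ≥ 1, so the square can be completed. This absorbs the last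
summand 1/(a_{t-1}a_t) of the exponent, which is why the sum in `constK` stops at t - 1. -/

namespace LieModular

open MeasureTheory Filter Topology

/-! ### Poisson summation for Gaussians on ℤ^J -/

section Poisson

variable {J : Type*} [Fintype J]

/-- Every finite set of indices lies in a box, over which the sum factors into one-dimensional theta
sums. -/
theorem summable_exp_neg_sum_sq {c : ℝ} (hc : 0 < c) :
    Summable fun n : J → ℤ => Real.exp (-c * ∑ i, (n i : ℝ) ^ 2) := by
  classical
  have h1 : Summable fun k : ℤ => Real.exp (-c * (k : ℝ) ^ 2) := by
    have := (summable_pow_mul_jacobiTheta₂_term_bound 0 (T := c / Real.pi)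
      (div_pos hc Real.pi_pos) 0)
    refine this.congr fun k => ?_
    simp only [pow_zero, one_mul]
    congr 1
    field_simp
    simp
  set C := ∑' k : ℤ, Real.exp (-c * (k : ℝ) ^ 2)
  refine summable_of_sum_le (c := ∏ _i : J, C) (fun _ => (Real.exp_pos _).le) fun u => ?_
  set T : J → Finset ℤ := fun i => u.image fun n => n i
  have hsub : u ⊆ Fintype.piFinset T := fun n hn =>
    Fintype.mem_piFinset.2 fun i => Finset.mem_image_of_mem _ hn
  calc ∑ n ∈ u, Real.exp (-c * ∑ i, (n i : ℝ) ^ 2)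
      ≤ ∑ n ∈ Fintype.piFinset T, Real.exp (-c * ∑ i, (n i : ℝ) ^ 2) :=
        Finset.sum_le_sum_of_subset_of_nonneg hsub fun _ _ _ => (Real.exp_pos _).le
    _ = ∏ i, ∑ k ∈ T i, Real.exp (-c * (k : ℝ) ^ 2) := by
        rw [Finset.prod_univ_sum]
        refine Finset.sum_congr rfl fun n _ => ?_
        rw [Finset.mul_sum, Real.exp_sum]
    _ ≤ ∏ _i : J, C := Finset.prod_le_prod
        (fun i _ => Finset.sum_nonneg fun _ _ => (Real.exp_pos _).le)
        fun i _ => h1.sum_le_tsum _ fun _ _ => (Real.exp_pos _).le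

variable [DecidableEq J]

/-- Cauchy-Schwarz applied to x = S⁻¹(Sx), with K the squared Frobenius norm of S⁻¹. The 1 added to
K covers K = 0, that is, empty J. -/
theorem exists_pos_mul_sum_sq_le {S : Matrix J J ℝ} (hS : S.det ≠ 0) :
    ∃ δ : ℝ, 0 < δ ∧ ∀ x : J → ℝ, δ * ∑ i, x i ^ 2 ≤ ∑ i, (S.mulVec x i) ^ 2 := by
  set K : ℝ := ∑ i, ∑ j, (S⁻¹ i j) ^ 2
  have hK : 0 ≤ K := Finset.sum_nonneg fun _ _ => Finset.sum_nonneg fun _ _ => sq_nonneg _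
  refine ⟨1 / (K + 1), by positivity, fun x => ?_⟩
  set y := S.mulVec x
  have hx : x = S⁻¹.mulVec y := by
    simp [y, Matrix.mulVec_mulVec, Matrix.nonsing_inv_mul _ (isUnit_iff_ne_zero.2 hS)]
  have hY : 0 ≤ ∑ j, y j ^ 2 := Finset.sum_nonneg fun _ _ => sq_nonneg _
  have h : ∑ i, x i ^ 2 ≤ K * ∑ j, y j ^ 2 := by
    rw [Finset.sum_mul]
    refine Finset.sum_le_sum fun i _ => ?_
    conv_lhs => rw [hx]
    exact Finset.sum_mul_sq_le_sq_mul_sq _ _ _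
  rw [div_mul_eq_mul_div, one_mul, div_le_iff₀ (by positivity)]
  nlinarith

/-- Based on (x + n)² ≥ n²/2 - x². The bound is uniform for x in a ball, which gives local uniform
convergence of the periodised Gaussian. -/
theorem exp_neg_mulVec_add_le {S : Matrix J J ℝ} {δ c R : ℝ} (hc : 0 < c) (hδ : 0 < δ)
    (h : ∀ x : J → ℝ, δ * ∑ i, x i ^ 2 ≤ ∑ i, (S.mulVec x i) ^ 2) {x : J → ℝ}
    (hx : ∑ i, x i ^ 2 ≤ R) (n : J → ℤ) :
    Real.exp (-c * ∑ i, (S.mulVec (fun j => x j + n j) i) ^ 2) ≤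
      Real.exp (c * δ * R) * Real.exp (-(c * δ / 2) * ∑ i, (n i : ℝ) ^ 2) := by
  rw [← Real.exp_add]
  refine Real.exp_le_exp.2 ?_
  have h1 := h fun j => x j + n j
  have h2 : (∑ i, (n i : ℝ) ^ 2) / 2 - R ≤ ∑ i, (x i + n i) ^ 2 := by
    have : (∑ i, (n i : ℝ) ^ 2) / 2 - ∑ i, x i ^ 2 ≤ ∑ i, (x i + n i) ^ 2 := by
      rw [Finset.sum_div, ← Finset.sum_sub_distrib]
      refine Finset.sum_le_sum fun i _ => ?_
      nlinarith [sq_nonneg (2 * x i + n i)]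
    linarith
  have h3 := mul_le_mul_of_nonneg_left h2 hδ.le
  have h4 := mul_le_mul_of_nonneg_left (h3.trans h1) hc.le
  linarith [h4]

theorem norm_cexp_mulVec (S : Matrix J J ℝ) (s : ℂ) (x : J → ℝ) :
    ‖Complex.exp (-s * ∑ i, (S.mulVec x i : ℂ) ^ 2)‖ =
      Real.exp (-s.re * ∑ i, (S.mulVec x i) ^ 2) := by
  rw [Complex.norm_exp]
  congr 1
  have : (∑ i, (S.mulVec x i : ℂ) ^ 2) = ((∑ i, (S.mulVec x i) ^ 2 : ℝ) : ℂ) := by push_cast; rfl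
  rw [this, Complex.re_mul_ofReal, Complex.neg_re]

theorem summable_norm_cexp_mulVec {S : Matrix J J ℝ} (hS : S.det ≠ 0) {s : ℂ} (hs : 0 < s.re)
    (x : J → ℝ) :
    Summable fun n : J → ℤ =>
      ‖Complex.exp (-s * ∑ i, (S.mulVec (fun j => x j + n j) i : ℂ) ^ 2)‖ := by
  obtain ⟨δ, hδ, h⟩ := exists_pos_mul_sum_sq_le hS
  refine Summable.of_nonneg_of_le (fun _ => norm_nonneg _) (fun n => ?_)
    ((summable_exp_neg_sum_sq (J := J) (c := s.re * δ / 2) (by positivity)).mul_left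
      (Real.exp (s.re * δ * ∑ i, x i ^ 2)))
  rw [norm_cexp_mulVec]
  exact exp_neg_mulVec_add_le hs hδ h le_rfl n

theorem continuous_tsum_cexp_mulVec {S : Matrix J J ℝ} (hS : S.det ≠ 0) {s : ℂ} (hs : 0 < s.re) :
    Continuous fun x : J → ℝ => ∑' n : J → ℤ,
      Complex.exp (-s * ∑ i, (S.mulVec (fun j => x j + n j) i : ℂ) ^ 2) := by
  obtain ⟨δ, hδ, h⟩ := exists_pos_mul_sum_sq_le hS
  have hterm : ∀ n : J → ℤ, Continuous fun x : J → ℝ =>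
      Complex.exp (-s * ∑ i, (S.mulVec (fun j => x j + n j) i : ℂ) ^ 2) := by
    intro n
    have hm : ∀ i, Continuous fun x : J → ℝ => S.mulVec (fun j => x j + n j) i := fun i =>
      continuous_finsetSum _ fun j _ =>
        continuous_const.mul ((continuous_apply j).add continuous_const)
    exact Complex.continuous_exp.comp (continuous_const.mul (continuous_finsetSum _ fun i _ =>
      (Complex.continuous_ofReal.comp (hm i)).pow 2))
  have hU : ∀ R : ℝ, IsOpen {x : J → ℝ | ∑ i, x i ^ 2 < R} := fun R =>
    isOpen_lt (by fun_prop) continuous_const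
  have hon : ∀ R : ℝ, ContinuousOn (fun x : J → ℝ => ∑' n : J → ℤ,
      Complex.exp (-s * ∑ i, (S.mulVec (fun j => x j + n j) i : ℂ) ^ 2))
      {x : J → ℝ | ∑ i, x i ^ 2 < R} := by
    intro R
    have hsum := (summable_exp_neg_sum_sq (J := J) (c := s.re * δ / 2) (by positivity)).mul_left
      (Real.exp (s.re * δ * R))
    refine continuousOn_tsum (fun n => (hterm n).continuousOn) hsum ?_
    intro n x hx
    rw [norm_cexp_mulVec]
    exact exp_neg_mulVec_add_le hs hδ h (Set.mem_ofPred.1 hx).le n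
  refine continuous_iff_continuousAt.2 fun x₀ => ?_
  have hx₀ : x₀ ∈ {x : J → ℝ | ∑ i, x i ^ 2 < ∑ i, x₀ i ^ 2 + 1} :=
    Set.mem_ofPred.2 (lt_add_one _)
  exact (hon _).continuousAt ((hU _).mem_nhds hx₀)

theorem integral_comp_mulVec {S : Matrix J J ℝ} (hS : S.det ≠ 0) (g : (J → ℝ) → ℂ) :
    ∫ x, g (S.mulVec x) = (|S.det|⁻¹ : ℝ) * ∫ u, g u := by
  have hmap := Real.map_matrix_volume_pi_eq_smul_volume_pi hS
  have hemb : MeasurableEmbedding (Matrix.toLin' S) :=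
    (LinearEquiv.toContinuousLinearEquiv (LinearEquiv.ofIsUnitDet
      (f := Matrix.toLin' S) (v := Pi.basisFun ℝ J) (v' := Pi.basisFun ℝ J)
      (by simpa [LinearMap.toMatrix_eq_toMatrix'] using hS))).toHomeomorph.measurableEmbedding
  have := hemb.integral_map (μ := volume) g
  rw [hmap, integral_smul_measure] at this
  rw [show (∫ x, g (S.mulVec x)) = ∫ x, g (Matrix.toLin' S x) by simp, ← this]
  rw [ENNReal.toReal_ofReal (by positivity), abs_inv]
  simp

theorem integrable_cexp_mulVec {S : Matrix J J ℝ} (hS : S.det ≠ 0) {s : ℂ} (hs : 0 < s.re)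
    (c : J → ℂ) :
    Integrable fun x : J → ℝ => Complex.exp (-s * ∑ i, (S.mulVec x i : ℂ) ^ 2 +
      ∑ i, c i * S.mulVec x i) := by
  have hmap := Real.map_matrix_volume_pi_eq_smul_volume_pi hS
  have hemb : MeasurableEmbedding (Matrix.toLin' S) :=
    (LinearEquiv.toContinuousLinearEquiv (LinearEquiv.ofIsUnitDet
      (f := Matrix.toLin' S) (v := Pi.basisFun ℝ J) (v' := Pi.basisFun ℝ J)
      (by simpa [LinearMap.toMatrix_eq_toMatrix'] using hS))).toHomeomorph.measurableEmbedding
  have h := GaussianFourier.integrable_cexp_neg_mul_sum_add hs c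
  have := hemb.integrable_map_iff (μ := volume)
    (g := fun v : J → ℝ => Complex.exp (-s * ∑ i, (v i : ℂ) ^ 2 + ∑ i, c i * v i))
  rw [hmap] at this
  refine this.1 (h.smul_measure ENNReal.ofReal_ne_top)

theorem integral_cexp_mulVec {S : Matrix J J ℝ} (hS : S.det ≠ 0) {s : ℂ} (hs : 0 < s.re)
    (c : J → ℂ) :
    ∫ x : J → ℝ, Complex.exp (-s * ∑ i, (S.mulVec x i : ℂ) ^ 2 + ∑ i, c i * S.mulVec x i) =
      (|S.det|⁻¹ : ℝ) * ((Real.pi / s) ^ (Fintype.card J / 2 : ℂ) *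
        Complex.exp ((∑ i, c i ^ 2) / (4 * s))) := by
  rw [integral_comp_mulVec hS fun u => Complex.exp (-s * ∑ i, (u i : ℂ) ^ 2 + ∑ i, c i * u i),
    GaussianFourier.integral_cexp_neg_mul_sum_add hs c]

/-- The half-open unit cubes at integer points tile the space, the cube of a point being read off
from the ceilings of its coordinates. The interval from 0 to 0 + 1 has the shape in which Fourier
coefficients on the torus are integrated. -/
theorem hasSum_setIntegral_unit_cubes {E : Type*} [NormedAddCommGroup E] [NormedSpace ℝ E]
    {g : (J → ℝ) → E} (hg : Integrable g) :
    HasSum (fun n : J → ℤ => ∫ x in {x : J → ℝ | ∀ i, x i ∈ Set.Ioc (0 : ℝ) (0 + 1)},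
      g fun j => x j + n j) (∫ x, g x) := by
  set A : (J → ℤ) → Set (J → ℝ) := fun n => {x | ∀ i, x i ∈ Set.Ioc (n i : ℝ) (n i + 1)}
  have hA : ∀ n, MeasurableSet (A n) := fun n => MeasurableSet.univ_pi' fun _ => measurableSet_Ioc
  have hmem : ∀ n (x : J → ℝ), x ∈ A n ↔ ∀ i, ⌈x i⌉ = n i + 1 := by
    intro n x
    refine forall_congr' fun i => ?_
    rw [Int.ceil_eq_iff, Set.mem_Ioc]
    simp
  have hdisj : Pairwise (Function.onFun Disjoint A) := by
    intro m n hmn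
    refine Set.disjoint_left.2 fun x hm hn => hmn (funext fun i => ?_)
    have h1 := (hmem m x).1 hm i
    have h2 := (hmem n x).1 hn i
    omega
  have hunion : ⋃ n, A n = Set.univ := by
    refine Set.eq_univ_of_forall fun x => Set.mem_iUnion.2 ⟨fun i => ⌈x i⌉ - 1, ?_⟩
    exact (hmem _ _).2 fun i => by ring
  have h := hasSum_integral_iUnion hA hdisj (f := g) (μ := volume) hg.integrableOn
  rw [hunion, setIntegral_univ] at h
  refine h.congr_fun ?_
  intro n
  have hpres := measurePreserving_add_right (volume : Measure (J → ℝ)) (fun j => (n j : ℝ))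
  have := hpres.setIntegral_preimage_emb (MeasurableEquiv.addRight _).measurableEmbedding g (A n)
  rw [← this]
  congr 2
  ext x
  simp [A, add_comm (x _)]

theorem mFourier_coe (k : J → ℤ) (x : J → ℝ) :
    UnitAddTorus.mFourier k (fun i => (x i : UnitAddCircle)) =
      Complex.exp (2 * Real.pi * Complex.I * ∑ i, (k i : ℂ) * x i) := by
  simp only [UnitAddTorus.mFourier, ContinuousMap.coe_mk, fourier_coe_apply]
  rw [Finset.mul_sum, Complex.exp_sum]
  refine Finset.prod_congr rfl fun i _ => ?_
  congr 1
  push_cast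
  ring

/-- The periodised Gaussian descends to a continuous function on the torus. By tiling, its Fourier
coefficients are Gaussian integrals over the whole space. They are summable, so the Fourier series
converges pointwise. -/
theorem tsum_cexp_mulVec_eq {S : Matrix J J ℝ} (hS : S.det ≠ 0) {s : ℂ} (hs : 0 < s.re)
    (x : J → ℝ) :
    HasSum (fun k : J → ℤ => ((|S.det|⁻¹ : ℝ) * (Real.pi / s) ^ (Fintype.card J / 2 : ℂ)) *
        Complex.exp (-(Real.pi ^ 2 / s) * ∑ i, (S⁻¹.transpose.mulVec (fun j => (k j : ℝ)) i : ℂ) ^ 2 +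
          2 * Real.pi * Complex.I * ∑ i, (k i : ℂ) * x i))
      (∑' n : J → ℤ, Complex.exp (-s * ∑ i, (S.mulVec (fun j => x j + n j) i : ℂ) ^ 2)) := by
  set f : (J → ℝ) → ℂ := fun x => Complex.exp (-s * ∑ i, (S.mulVec x i : ℂ) ^ 2) with hf
  set G : (J → ℝ) → ℂ := fun x => ∑' n : J → ℤ, f fun j => x j + n j with hG
  have hGc : Continuous G := continuous_tsum_cexp_mulVec hS hs
  have hper : ∀ x (m : J → ℤ), G (fun j => x j + m j) = G x := by
    intro x m
    simp only [hG]
    rw [← (Equiv.addLeft m).tsum_eq (fun n : J → ℤ => f fun j => x j + n j)]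
    refine tsum_congr fun n => ?_
    simp [add_assoc]
  set F : UnitAddTorus J → ℂ := fun t => G fun i => (AddCircle.equivIoc (1 : ℝ) 0 (t i)).1
  have hFG : ∀ x : J → ℝ, F (fun i => (x i : UnitAddCircle)) = G x := by
    intro x
    have h : ∀ i, ∃ m : ℤ, (AddCircle.equivIoc (1 : ℝ) 0 (x i : UnitAddCircle)).1 + m = x i := by
      intro i
      have h1 := (AddCircle.equivIoc (1 : ℝ) 0).symm_apply_apply (x i : UnitAddCircle)
      obtain ⟨m, hm⟩ := AddSubgroup.mem_zmultiples_iff.1 (QuotientAddGroup.eq.1 h1)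
      refine ⟨m, ?_⟩
      simp only [zsmul_eq_mul, mul_one] at hm
      rw [hm]; ring
    choose m hm using h
    change G _ = G x
    rw [← hper _ m]
    exact congrArg G (funext hm)
  have hFc : Continuous F := by
    have hq : IsOpenQuotientMap (Pi.map fun (_ : J) (x : ℝ) => (x : UnitAddCircle)) :=
      IsOpenQuotientMap.piMap fun _ => QuotientAddGroup.isOpenQuotientMap_mk
    rw [hq.isQuotientMap.continuous_iff]
    exact hGc.congr fun x => (hFG x).symm
  have hcoef : ∀ k : J → ℤ, UnitAddTorus.mFourierCoeff F k =
      ((|S.det|⁻¹ : ℝ) * (Real.pi / s) ^ (Fintype.card J / 2 : ℂ)) *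
        Complex.exp (-(Real.pi ^ 2 / s) *
          ∑ i, (S⁻¹.transpose.mulVec (fun j => (k j : ℝ)) i : ℂ) ^ 2) := by
    intro k
    -- The character of k written in the coordinates Sx, so that the coefficient becomes a Gaussian
    -- integral with a linear term.
    set c : J → ℂ := fun i => -(2 * Real.pi * Complex.I) * (S⁻¹.transpose.mulVec (fun j => (k j : ℝ)) i : ℂ) with hc
    have hkx : ∀ x : J → ℝ, ∑ i, c i * (S.mulVec x i : ℂ) =
        -(2 * Real.pi * Complex.I) * ∑ i, (k i : ℂ) * x i := by
      intro x
      have : ∑ i, S⁻¹.transpose.mulVec (fun j => (k j : ℝ)) i * S.mulVec x i = ∑ i, (k i : ℝ) * x i := by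
        change dotProduct _ _ = dotProduct _ _
        rw [Matrix.mulVec_transpose, ← Matrix.dotProduct_mulVec, Matrix.mulVec_mulVec,
          Matrix.nonsing_inv_mul _ (isUnit_iff_ne_zero.2 hS), Matrix.one_mulVec]
      have h2 := congrArg (fun r : ℝ => (r : ℂ)) this
      push_cast at h2
      rw [← h2, Finset.mul_sum]
      refine Finset.sum_congr rfl fun i _ => ?_
      rw [hc]; ring
    set g : (J → ℝ) → ℂ := fun x => Complex.exp (-s * ∑ i, (S.mulVec x i : ℂ) ^ 2 +
      ∑ i, c i * S.mulVec x i) with hg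
    have hgi : Integrable g := integrable_cexp_mulVec hS hs c
    have hgf : ∀ (n : J → ℤ) (x : J → ℝ),
        g (fun j => x j + n j) = UnitAddTorus.mFourier (-k) (fun i => (x i : UnitAddCircle)) *
          f (fun j => x j + n j) := by
      intro n x
      rw [mFourier_coe, hg]
      simp only [hf]
      rw [hkx, ← Complex.exp_add, Complex.exp_eq_exp_iff_exists_int]
      refine ⟨-∑ i, k i * n i, ?_⟩
      have e1 : ∑ i, (k i : ℂ) * ((x i + n i : ℝ) : ℂ) =
          ∑ i, (k i : ℂ) * x i + ∑ i, (k i : ℂ) * n i := by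
        rw [← Finset.sum_add_distrib]
        exact Finset.sum_congr rfl fun i _ => by push_cast; ring
      have e2 : ∑ i, (((-k) i : ℤ) : ℂ) * x i = -∑ i, (k i : ℂ) * x i := by
        rw [← Finset.sum_neg_distrib]
        exact Finset.sum_congr rfl fun i _ => by rw [Pi.neg_apply]; push_cast; ring
      rw [e1, e2]
      push_cast
      ring
    rw [UnitAddTorus.mFourierCoeff_eq_integral _ _ 0]
    have h1 : ∀ x : J → ℝ, UnitAddTorus.mFourier (-k) (fun i => (x i : UnitAddCircle)) •
        F (fun i => (x i : UnitAddCircle)) = ∑' n : J → ℤ, g (fun j => x j + n j) := by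
      intro x
      rw [hFG, smul_eq_mul, hG, ← tsum_mul_left]
      exact tsum_congr fun n => (hgf n x).symm
    simp_rw [h1]
    have h2 := hasSum_setIntegral_unit_cubes hgi
    have h3 := (hasSum_setIntegral_unit_cubes hgi.norm).summable
    have h4 := hasSum_integral_of_summable_integral_norm
      (μ := volume.restrict {x : J → ℝ | ∀ i, x i ∈ Set.Ioc (0 : ℝ) (0 + 1)})
      (F := fun (n : J → ℤ) (x : J → ℝ) => g (fun j => x j + n j))
      (fun n => (hgi.comp_add_right (fun j => (n j : ℝ))).integrableOn) h3
    have h5 := h4.unique h2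
    simp only [Pi.zero_apply] at h5 ⊢
    rw [h5, integral_cexp_mulVec hS hs c, mul_assoc]
    congr 3
    have : s ≠ 0 := fun h => by simp [h] at hs
    have hsq : ∀ z : ℂ, (-(2 * Real.pi * Complex.I) * z) ^ 2 = -(4 * Real.pi ^ 2) * z ^ 2 := by
      intro z
      linear_combination (4 * Real.pi ^ 2 * z ^ 2 : ℂ) * Complex.I_sq
    simp only [hc, hsq, ← Finset.mul_sum]
    field_simp
  have hsum : Summable (UnitAddTorus.mFourierCoeff F) := by
    have hs' : 0 < ((Real.pi : ℂ) ^ 2 / s).re := by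
      have : ((Real.pi : ℂ) ^ 2 / s) = ((Real.pi ^ 2 : ℝ) : ℂ) * s⁻¹ := by push_cast; rfl
      rw [this, Complex.re_ofReal_mul, Complex.inv_re]
      have : s ≠ 0 := fun h => by simp [h] at hs
      have := Complex.normSq_pos.2 this
      positivity
    have hT : S⁻¹.transpose.det ≠ 0 := by
      rw [Matrix.det_transpose, Matrix.det_nonsing_inv]
      simpa using hS
    have := (summable_norm_cexp_mulVec hT hs' 0).of_norm
    rw [funext hcoef]
    refine Summable.mul_left _ (this.congr fun k => ?_)
    simp
  have := UnitAddTorus.hasSum_mFourier_series_apply_of_summable (f := ⟨F, hFc⟩) hsum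
    (fun i => (x i : UnitAddCircle))
  rw [ContinuousMap.coe_mk, hFG] at this
  refine this.congr_fun ?_
  intro k
  rw [hcoef, mFourier_coe, Complex.exp_add]
  simp only [smul_eq_mul]
  ring

end Poisson

/-! ### Theta series of a lattice and its dual, and Gauss sums as their limits -/

section LatticeGauss

variable {J V : Type*} [Fintype J] [AddCommGroup V] [Module ℝ V]

/-- The lattice vector `∑ nᵢ vᵢ`. -/
def latVec (v : J → V) (n : J → ℤ) : V := ∑ i, (n i : ℝ) • v i

theorem latVec_add (v : J → V) (m n : J → ℤ) : latVec v (m + n) = latVec v m + latVec v n := by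
  simp [latVec, add_smul, Finset.sum_add_distrib]

theorem latVec_neg (v : J → V) (n : J → ℤ) : latVec v (-n) = -latVec v n := by
  simp [latVec]

theorem latVec_zero (v : J → V) : latVec v 0 = 0 := by simp [latVec]

variable [DecidableEq J]
variable {B : LinearMap.BilinForm ℝ V} (hsymm : ∀ x y, B x y = B y x)
  (hpos : ∀ x, x ≠ 0 → 0 < B x x) (e : Module.Basis J ℝ V)

open scoped MatrixOrder Matrix.Norms.L2Operator in
include hsymm hpos in
-- The Gram matrix is positive definite, hence of the form SᵀS. This transports the results on ℤ^J
-- to an arbitrary inner product and lattice.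
theorem exists_gram_eq : ∃ S : Matrix J J ℝ,
    S.det ≠ 0 ∧ (Matrix.of fun i j => B (e i) (e j)) = S.transpose * S ∧
    √(Matrix.of fun i j => B (e i) (e j)).det = |S.det| ∧
    ∀ x : J → ℝ, B (∑ i, x i • e i) (∑ i, x i • e i) = ∑ i, (S.mulVec x i) ^ 2 := by
  set A : Matrix J J ℝ := Matrix.of fun i j => B (e i) (e j) with hA
  have hq : ∀ x : J → ℝ, B (∑ i, x i • e i) (∑ i, x i • e i) = dotProduct x (A.mulVec x) := by
    intro x
    simp only [map_sum, LinearMap.sum_apply, map_smul, LinearMap.smul_apply, smul_eq_mul,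
      dotProduct, Matrix.mulVec, hA, Matrix.of_apply, Finset.mul_sum]
    rw [Finset.sum_comm]
    refine Finset.sum_congr rfl fun i _ => Finset.sum_congr rfl fun j _ => ?_
    rw [hsymm]; ring
  have hpd : A.PosDef := by
    refine Matrix.PosDef.of_dotProduct_mulVec_pos ?_ ?_
    · ext i j
      simp [hA, hsymm (e i) (e j)]
    · intro x hx
      rw [star_trivial, ← hq]
      refine hpos _ fun h => hx (funext fun i => ?_)
      exact Fintype.linearIndependent_iff.1 e.linearIndependent x h i
  obtain ⟨S, hS⟩ := CStarAlgebra.nonneg_iff_eq_star_mul_self.mp hpd.posSemidef.nonneg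
  rw [Matrix.star_eq_conjTranspose, Matrix.conjTranspose_eq_transpose_of_trivial] at hS
  have hdet : A.det = S.det ^ 2 := by rw [hS, Matrix.det_mul, Matrix.det_transpose, sq]
  refine ⟨S, fun h => ?_, hS, ?_, fun x => ?_⟩
  · have := hpd.det_pos
    rw [hdet, h] at this
    simp at this
  · rw [hdet, Real.sqrt_sq_eq_abs]
  · rw [hq, hS, ← Matrix.mulVec_mulVec, Matrix.mulVec_transpose, dotProduct_comm,
      ← Matrix.dotProduct_mulVec, dotProduct]
    exact Finset.sum_congr rfl fun i _ => by ring

theorem latVec_add_eq_sum (v : V) (n : J → ℤ) :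
    latVec e n + v = ∑ i, (e.repr v i + n i) • e i := by
  conv_lhs => rw [← e.sum_repr v]
  simp [latVec, add_smul, Finset.sum_add_distrib, add_comm]

include hsymm hpos in
theorem summable_norm_cexp_latVec {s : ℂ} (hs : 0 < s.re) (v : V) :
    Summable fun n : J → ℤ =>
      ‖Complex.exp (-s * (B (latVec e n + v) (latVec e n + v) : ℝ))‖ := by
  obtain ⟨S, hS, -, -, hq⟩ := exists_gram_eq hsymm hpos e
  refine (summable_norm_cexp_mulVec hS hs (e.repr v)).congr fun n => ?_
  rw [latVec_add_eq_sum, hq]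
  push_cast
  rfl

variable (f : Module.Basis J ℝ V) (hef : ∀ i j, B (e i) (f j) = if i = j then 1 else 0)

include hsymm hef in
theorem form_latVec_dual (k : J → ℤ) (v : V) :
    B (latVec f k) v = ∑ i, (k i : ℝ) * e.repr v i := by
  conv_lhs => rw [← e.sum_repr v]
  simp only [latVec, map_sum, LinearMap.sum_apply, map_smul, LinearMap.smul_apply, smul_eq_mul,
    hsymm (f _), hef]
  simp [mul_comm]

include hsymm hpos hef in
/-- Poisson summation for a Gaussian on the lattice spanned by `e`, with dual lattice spanned
by `f`. -/
theorem hasSum_lattice_poisson {z : ℂ} (hz : 0 < z.re) (v : V) :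
    HasSum (fun k : J → ℤ =>
      (z ^ (Fintype.card J / 2 : ℂ) / (√(Matrix.of fun i j => B (e i) (e j)).det : ℝ)) *
        Complex.exp (-(Real.pi * z) * (B (latVec f k) (latVec f k) : ℝ) +
          2 * Real.pi * Complex.I * (B (latVec f k) v : ℝ)))
      (∑' n : J → ℤ,
        Complex.exp (-(Real.pi / z) * (B (latVec e n + v) (latVec e n + v) : ℝ))) := by
  obtain ⟨S, hS, hA, hdet, hq⟩ := exists_gram_eq hsymm hpos e
  have hz0 : z ≠ 0 := fun h => by simp [h] at hz
  have hpi : (Real.pi : ℂ) ≠ 0 := by exact_mod_cast Real.pi_ne_zero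
  have hs : 0 < (Real.pi / z : ℂ).re := by
    rw [div_eq_mul_inv, Complex.re_ofReal_mul, Complex.inv_re]
    have := Complex.normSq_pos.2 hz0
    have := Real.pi_pos
    positivity
  have h := tsum_cexp_mulVec_eq hS hs (e.repr v)
  have h1 : ∀ n : J → ℤ, B (latVec e n + v) (latVec e n + v) =
      ∑ i, (S.mulVec (fun j => e.repr v j + n j) i) ^ 2 := by
    intro n
    rw [latVec_add_eq_sum, hq]
  have h2 : ∀ k : J → ℤ, B (latVec f k) (latVec f k) =
      ∑ i, (S⁻¹.transpose.mulVec (fun j => (k j : ℝ)) i) ^ 2 := by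
    intro k
    -- In the basis `e` the dual vector has coordinates c with SᵀSc = k, so Sc is the inverse
    -- transpose of S applied to k.
    set c : J → ℝ := fun i => e.repr (latVec f k) i
    have hc : ∑ i, c i • e i = latVec f k := e.sum_repr _
    have hk : (S.transpose * S).mulVec c = fun j => (k j : ℝ) := by
      ext i
      have : B (e i) (latVec f k) = k i := by
        simp [latVec, hef]
      rw [← hA, ← this, ← hc]
      simp [Matrix.mulVec, dotProduct, mul_comm]
    rw [← hk, ← hc, hq, ← Matrix.mulVec_mulVec, Matrix.mulVec_mulVec, ← Matrix.transpose_mul,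
      Matrix.mul_nonsing_inv _ (isUnit_iff_ne_zero.2 hS), Matrix.transpose_one, Matrix.one_mulVec]
  convert h using 1
  · funext k
    rw [hdet, h2, form_latVec_dual hsymm e f hef]
    have e1 : (Real.pi : ℂ) / (Real.pi / z) = z := by field_simp
    have e2 : (Real.pi : ℂ) ^ 2 / (Real.pi / z) = Real.pi * z := by field_simp
    rw [e1, e2]
    push_cast
    congr 1
    rw [div_eq_mul_inv, mul_comm]
  · refine tsum_congr fun n => ?_
    rw [h1]
    push_cast
    rfl

include hsymm hpos in
theorem latVec_ne_zero {k : J → ℤ} (hk : k ≠ 0) : 0 < B (latVec e k) (latVec e k) := by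
  refine hpos _ fun h => hk (funext fun i => ?_)
  have := Fintype.linearIndependent_iff.1 e.linearIndependent (fun i => (k i : ℝ)) h i
  exact_mod_cast this

include hsymm hpos hef in
-- After Poisson summation only the term k = 0 survives as the real part of z grows; the terms are
-- dominated by their values at real part 1. The limit is the density of the lattice and does not
-- depend on the shift `v`.
theorem tendsto_lattice_gauss {α : Type*} {l : Filter α} {z : α → ℂ}
    (hz : Tendsto (fun a => (z a).re) l atTop) (v : V) :
    Tendsto (fun a => (∑' n : J → ℤ,
        Complex.exp (-(Real.pi / z a) * (B (latVec e n + v) (latVec e n + v) : ℝ))) /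
          z a ^ (Fintype.card J / 2 : ℂ)) l
      (𝓝 (1 / (√(Matrix.of fun i j => B (e i) (e j)).det : ℝ))) := by
  set D : ℂ := ((√(Matrix.of fun i j => B (e i) (e j)).det : ℝ) : ℂ)
  set T : ℂ → (J → ℤ) → ℂ := fun w k =>
    Complex.exp (-(Real.pi * w) * (B (latVec f k) (latVec f k) : ℝ) +
          2 * Real.pi * Complex.I * (B (latVec f k) v : ℝ)) with hT
  have hnorm : ∀ w k, ‖T w k‖ = Real.exp (-(Real.pi * w.re) * B (latVec f k) (latVec f k)) := by
    intro w k
    rw [hT, Complex.norm_exp]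
    simp
  have hsum := (summable_norm_cexp_latVec hsymm hpos f (s := Real.pi)
    (by simpa using Real.pi_pos) 0)
  have hlim : Tendsto (fun a => ∑' k, T (z a) k) l (𝓝 (∑' k : J → ℤ, if k = 0 then 1 else 0)) := by
    refine tendsto_tsum_of_dominated_convergence hsum ?_ ?_
    · intro k
      split_ifs with hk
      · simp [hT, hk, latVec_zero, tendsto_const_nhds]
      · refine tendsto_zero_iff_norm_tendsto_zero.2 ?_
        simp_rw [hnorm]
        refine Real.tendsto_exp_atBot.comp ?_
        have hB := latVec_ne_zero hsymm hpos f hk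
        have := (hz.const_mul_atTop (mul_pos Real.pi_pos hB))
        refine (tendsto_neg_atTop_atBot.comp this).congr fun a => ?_
        simp only [Function.comp]; ring
    · filter_upwards [hz.eventually_ge_atTop 1] with a ha k
      rw [hnorm, Complex.norm_exp]
      refine Real.exp_le_exp.2 ?_
      have hB : 0 ≤ B (latVec f k) (latVec f k) := by
        by_cases h : latVec f k = 0
        · simp [h]
        · exact (hpos _ h).le
      simp only [add_zero, Complex.neg_re, Complex.re_mul_ofReal, Complex.ofReal_re]
      have := mul_le_mul_of_nonneg_left ha (mul_nonneg Real.pi_pos.le hB)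
      linarith
  rw [tsum_ite_eq] at hlim
  refine (hlim.div_const D).congr' ?_
  filter_upwards [hz.eventually_gt_atTop 0] with a ha
  have h := hasSum_lattice_poisson hsymm hpos e f hef ha v
  rw [← h.tsum_eq, tsum_mul_left]
  have hz0 : z a ≠ 0 := fun h => by simp [h] at ha
  have hne : z a ^ (Fintype.card J / 2 : ℂ) ≠ 0 := by
    rw [Complex.cpow_def_of_ne_zero hz0]
    exact Complex.exp_ne_zero _
  change (∑' k, T (z a) k) / D = z a ^ (Fintype.card J / 2 : ℂ) / D * (∑' k, T (z a) k) /
    z a ^ (Fintype.card J / 2 : ℂ)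
  rw [mul_div_right_comm, div_right_comm, div_self hne, one_div, div_eq_inv_mul]

theorem ofReal_mul_cpow {x : ℝ} (hx : 0 < x) {w : ℂ} (hw : w ≠ 0) (c : ℂ) :
    ((x : ℂ) * w) ^ c = (x : ℂ) ^ c * w ^ c := by
  have hx' : (x : ℂ) ≠ 0 := by exact_mod_cast hx.ne'
  rw [Complex.cpow_def_of_ne_zero (mul_ne_zero hx' hw), Complex.cpow_def_of_ne_zero hx',
    Complex.cpow_def_of_ne_zero hw, ← Complex.exp_add, Complex.log_ofReal_mul hx hw,
    Complex.ofReal_log hx.le, add_mul]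

/-- For the principal branch, the logarithm of -i times the sign of r is -πi/2 times that sign. This
is the source of the powers of ζ. -/
theorem neg_I_mul_cpow {r : ℝ} (hr : r ≠ 0) (l : ℕ) :
    (-(Complex.I * r)) ^ (l / 2 : ℂ) =
      ((|r| ^ ((l : ℝ) / 2) : ℝ) : ℂ) *
        (Complex.exp (Real.pi * Complex.I / 4) ^ ((l : ℤ) * (SignType.sign r : ℤ)))⁻¹ := by
  have habs : 0 < |r| := abs_pos.2 hr
  have key : ∀ (σ : ℤ) (w : ℂ), w ≠ 0 → (-(Complex.I * r)) = (|r| : ℝ) * w →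
      Complex.log w = -(σ * (Real.pi * Complex.I / 2)) →
      (-(Complex.I * r)) ^ (l / 2 : ℂ) = ((|r| ^ ((l : ℝ) / 2) : ℝ) : ℂ) *
        (Complex.exp (Real.pi * Complex.I / 4) ^ ((l : ℤ) * σ))⁻¹ := by
    intro σ w hw h1 h2
    rw [h1, ofReal_mul_cpow habs hw, Complex.ofReal_cpow habs.le,
      Complex.cpow_def_of_ne_zero hw, h2, ← Complex.exp_int_mul, ← Complex.exp_neg]
    congr 2
    · push_cast; rfl
    · push_cast; ring
  rcases lt_or_gt_of_ne hr with h | h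
  · rw [sign_neg h]
    refine key (-1) Complex.I Complex.I_ne_zero ?_ ?_
    · rw [abs_of_neg h]; push_cast; ring
    · rw [Complex.log_I]; push_cast; ring
  · rw [sign_pos h]
    refine key 1 (-Complex.I) (neg_ne_zero.2 Complex.I_ne_zero) ?_ ?_
    · rw [abs_of_pos h]; ring
    · rw [Complex.log_neg_I]; push_cast; ring

include hsymm hpos hef in
/-- Reciprocity for quadratic Gauss sums on dual lattices, as the limit of a theta
transformation. -/
theorem tendsto_gauss_reciprocity {Q : Type*} [Fintype Q] {r : ℝ} (hr : r ≠ 0) {a : ℤ}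
    (ha : a ≠ 0) (s : Q → V) (E : Q × (J → ℤ) ≃ (J → ℤ))
    (hE : ∀ q n, latVec e (E (q, n)) = s q + (a : ℝ) • latVec e n) (φ : V)
    (hφ : ∀ q n, ∃ m : ℤ, B (s q + φ + (a : ℝ) • latVec e n) (s q + φ + (a : ℝ) • latVec e n) / r
      = B (s q + φ) (s q + φ) / r + 2 * m) :
    Tendsto (fun ε : ℝ => (ε : ℂ) ^ (Fintype.card J / 2 : ℂ) *
        ∑' k : J → ℤ, Complex.exp (-(Real.pi * ε) * (B (latVec f k) (latVec f k) : ℝ) +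
          Real.pi * Complex.I * r * (B (latVec f k) (latVec f k) : ℝ) -
          2 * Real.pi * Complex.I * (B (latVec f k) φ : ℝ)))
      (𝓝[>] 0)
      (𝓝 ((((|r| ^ ((Fintype.card J : ℝ) / 2) / |(a : ℝ)| ^ Fintype.card J : ℝ) : ℂ) *
        Complex.exp (Real.pi * Complex.I / 4) ^
          ((Fintype.card J : ℤ) * (SignType.sign r : ℤ))) *
        ∑ q, Complex.exp (-(Real.pi * Complex.I / r) * (B (s q + φ) (s q + φ) : ℝ)))) := by
  set l : ℕ := Fintype.card J with hl
  set D : ℂ := ((√(Matrix.of fun i j => B (e i) (e j)).det : ℝ) : ℂ) with hD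
  have hD0 : D ≠ 0 := by
    obtain ⟨S, hS, -, hdet, -⟩ := exists_gram_eq hsymm hpos e
    rw [hD, hdet]
    exact_mod_cast (abs_pos.2 hS).ne'
  have ha' : (a : ℝ) ≠ 0 := by exact_mod_cast ha
  have haC : (a : ℂ) ≠ 0 := by exact_mod_cast ha
  have hrC : (r : ℂ) ≠ 0 := by exact_mod_cast hr
  have hpiC : (Real.pi : ℂ) ≠ 0 := by exact_mod_cast Real.pi_ne_zero
  -- Poisson summation is applied at z. Since z = -iy/r, one has -π/z = -πε/y - πi/r: a damping of
  -- size ε and a pure phase. Rescaling the lattice by `a` turns the damping parameter into z' =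
  -- y/(εa²), whose real part tends to infinity.
  set z : ℝ → ℂ := fun ε => ε - Complex.I * r with hzdef
  set y : ℝ → ℂ := fun ε => r ^ 2 + Complex.I * r * ε with hydef
  set z' : ℝ → ℂ := fun ε => ((ε * a ^ 2)⁻¹ : ℝ) * y ε with hz'def
  have hzre : ∀ ε, (z ε).re = ε := fun ε => by simp [hzdef]
  have hyre : ∀ ε, (y ε).re = r ^ 2 := fun ε => by simp [hydef, sq]
  have hy0 : ∀ ε, y ε ≠ 0 := fun ε h => by
    have := hyre ε
    rw [h] at this
    exact pow_ne_zero 2 hr this.symm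
  have hz're : Tendsto (fun ε => (z' ε).re) (𝓝[>] 0) atTop := by
    have h1 : ∀ ε, (z' ε).re = (r ^ 2 / a ^ 2) * ε⁻¹ := fun ε => by
      rw [hz'def, Complex.re_ofReal_mul, hyre, mul_inv]
      ring
    simp_rw [h1]
    exact tendsto_inv_nhdsGT_zero.const_mul_atTop (by positivity)
  set T : Q → ℝ → ℂ := fun q ε => (∑' n : J → ℤ, Complex.exp (-(Real.pi / z' ε) *
    (B (latVec e n + (a : ℝ)⁻¹ • (s q + φ)) (latVec e n + (a : ℝ)⁻¹ • (s q + φ)) : ℝ))) /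
      z' ε ^ (l / 2 : ℂ) with hT
  have hTlim : ∀ q, Tendsto (T q) (𝓝[>] 0) (𝓝 (1 / D)) := fun q =>
    tendsto_lattice_gauss hsymm hpos e f hef hz're _
  set G : Q → ℂ := fun q =>
    Complex.exp (-(Real.pi * Complex.I / r) * (B (s q + φ) (s q + φ) : ℝ)) with hG
  have hpow : Tendsto (fun ε : ℝ => (((|(a : ℝ)| ^ l : ℝ) : ℂ))⁻¹ * y ε ^ (l / 2 : ℂ) /
      z ε ^ (l / 2 : ℂ)) (𝓝[>] 0)
      (𝓝 ((((|(a : ℝ)| ^ l : ℝ) : ℂ))⁻¹ * ((r : ℂ) ^ 2) ^ (l / 2 : ℂ) /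
        (-(Complex.I * r)) ^ (l / 2 : ℂ))) := by
    have hy : Tendsto y (𝓝[>] 0) (𝓝 ((r : ℂ) ^ 2)) := by
      have : Continuous y := by fun_prop
      refine (this.tendsto' 0 _ (by simp [hydef])).mono_left nhdsWithin_le_nhds
    have hz : Tendsto z (𝓝[>] 0) (𝓝 (-(Complex.I * r))) := by
      have : Continuous z := by fun_prop
      refine (this.tendsto' 0 _ (by simp [hzdef])).mono_left nhdsWithin_le_nhds
    refine ((hy.cpow tendsto_const_nhds ?_).const_mul _).div (hz.cpow tendsto_const_nhds ?_) ?_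
    · left
      rw [← Complex.ofReal_pow, Complex.ofReal_re]
      positivity
    · right
      simpa using hr
    · rw [Complex.cpow_def_of_ne_zero (neg_ne_zero.2 (mul_ne_zero Complex.I_ne_zero hrC))]
      exact Complex.exp_ne_zero _
  have hmain := hpow.mul ((tendsto_finsetSum Finset.univ fun q _ =>
    (hTlim q).const_mul (G q)).const_mul D)
  have hconst : (((|(a : ℝ)| ^ l : ℝ) : ℂ))⁻¹ * ((r : ℂ) ^ 2) ^ (l / 2 : ℂ) /
        (-(Complex.I * r)) ^ (l / 2 : ℂ) * (D * ∑ q, G q * (1 / D)) =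
      ((((|r| ^ ((l : ℝ) / 2) / |(a : ℝ)| ^ l : ℝ) : ℂ) *
        Complex.exp (Real.pi * Complex.I / 4) ^ ((l : ℤ) * (SignType.sign r : ℤ))) *
        ∑ q, G q) := by
    rw [← Finset.sum_mul, neg_I_mul_cpow hr]
    have h2 : ((r : ℂ) ^ 2) ^ (l / 2 : ℂ) =
        ((|r| ^ ((l : ℝ) / 2) : ℝ) : ℂ) * ((|r| ^ ((l : ℝ) / 2) : ℝ) : ℂ) := by
      have h3 : ((r : ℂ) ^ 2) = ((|r| * |r| : ℝ) : ℂ) := by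
        rw [abs_mul_abs_self]; push_cast; ring
      rw [h3, ← Complex.ofReal_mul, ← Real.mul_rpow (abs_nonneg _) (abs_nonneg _),
        Complex.ofReal_cpow (by positivity)]
      push_cast; rfl
    have h4 : ((|r| ^ ((l : ℝ) / 2) : ℝ) : ℂ) ≠ 0 := by
      have : 0 < |r| := abs_pos.2 hr
      exact_mod_cast (Real.rpow_pos_of_pos this _).ne'
    rw [h2]
    have h5 : Complex.exp (Real.pi * Complex.I / 4) ^ ((l : ℤ) * (SignType.sign r : ℤ)) ≠ 0 :=
      zpow_ne_zero _ (Complex.exp_ne_zero _)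
    have h6 : ((|(a : ℝ)| ^ l : ℝ) : ℂ) ≠ 0 := by
      have : 0 < |(a : ℝ)| := abs_pos.2 ha'
      exact_mod_cast (pow_pos this _).ne'
    rw [Complex.ofReal_div]
    field_simp
  rw [hconst] at hmain
  refine hmain.congr' ?_
  filter_upwards [self_mem_nhdsWithin] with ε hε
  have hε : 0 < ε := hε
  have hz0 : z ε ≠ 0 := fun h => by
    have := hzre ε
    rw [h] at this
    exact hε.ne this
  have hzpow : z ε ^ (l / 2 : ℂ) ≠ 0 := by
    rw [Complex.cpow_def_of_ne_zero hz0]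
    exact Complex.exp_ne_zero _
  have hP := hasSum_lattice_poisson hsymm hpos e f hef (z := z ε) ((hzre ε).symm ▸ hε) φ
  have hleft : ∑' k : J → ℤ, Complex.exp (-(Real.pi * ε) * (B (latVec f k) (latVec f k) : ℝ) +
          Real.pi * Complex.I * r * (B (latVec f k) (latVec f k) : ℝ) -
          2 * Real.pi * Complex.I * (B (latVec f k) φ : ℝ)) =
      D / z ε ^ (l / 2 : ℂ) * ∑' n : J → ℤ, Complex.exp (-(Real.pi / z ε) *
        (B (latVec e n + φ) (latVec e n + φ) : ℝ)) := by
    rw [← hP.tsum_eq, tsum_mul_left, ← mul_assoc]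
    have : D / z ε ^ (l / 2 : ℂ) * (z ε ^ (l / 2 : ℂ) / D) = 1 := by field_simp
    rw [this, one_mul, ← (Equiv.neg (J → ℤ)).tsum_eq]
    refine tsum_congr fun k => ?_
    simp only [Equiv.neg_apply, latVec_neg, map_neg, LinearMap.neg_apply, neg_neg, hzdef]
    congr 1
    push_cast
    ring
  have hzy : z ε = -(Complex.I / r) * y ε := by
    simp only [hzdef, hydef]
    field_simp
    linear_combination (ε : ℂ) * Complex.I_sq
  have hright : ∑' n : J → ℤ, Complex.exp (-(Real.pi / z ε) *
        (B (latVec e n + φ) (latVec e n + φ) : ℝ)) =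
      ∑ q, G q * ∑' n : J → ℤ, Complex.exp (-(Real.pi / z' ε) *
        (B (latVec e n + (a : ℝ)⁻¹ • (s q + φ)) (latVec e n + (a : ℝ)⁻¹ • (s q + φ)) : ℝ)) := by
    have hsz : 0 < (Real.pi / z ε).re := by
      rw [div_eq_mul_inv, Complex.re_ofReal_mul, Complex.inv_re, hzre]
      have := Complex.normSq_pos.2 hz0
      have := Real.pi_pos
      positivity
    have hsum := (summable_norm_cexp_latVec hsymm hpos e hsz φ).of_norm
    have hsum' : Summable fun p : Q × (J → ℤ) => Complex.exp (-(Real.pi / z ε) *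
        (B (latVec e (E p) + φ) (latVec e (E p) + φ) : ℝ)) := (E.summable_iff).2 hsum
    -- The lattice vectors are sorted by class; `hφ` makes the phase constant on each class, so only
    -- the damped sum depends on n.
    rw [← E.tsum_eq, hsum'.tsum_prod, tsum_fintype]
    refine Finset.sum_congr rfl fun q _ => ?_
    rw [← tsum_mul_left]
    refine tsum_congr fun n => ?_
    rw [hG, ← Complex.exp_add, hE, Complex.exp_eq_exp_iff_exists_int]
    obtain ⟨m, hm⟩ := hφ q n
    set b₁ := B (s q + φ + (a : ℝ) • latVec e n) (s q + φ + (a : ℝ) • latVec e n) with hb₁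
    have e1 : s q + (a : ℝ) • latVec e n + φ = s q + φ + (a : ℝ) • latVec e n := by abel
    have e2 : B (latVec e n + (a : ℝ)⁻¹ • (s q + φ)) (latVec e n + (a : ℝ)⁻¹ • (s q + φ)) =
        b₁ / a ^ 2 := by
      have : s q + φ + (a : ℝ) • latVec e n =
          (a : ℝ) • (latVec e n + (a : ℝ)⁻¹ • (s q + φ)) := by
        rw [smul_add, smul_smul, mul_inv_cancel₀ ha', one_smul, add_comm]
      rw [hb₁, this]
      simp only [map_smul, LinearMap.smul_apply, smul_eq_mul]
      field_simp
    have hmC : (b₁ : ℂ) / r = (B (s q + φ) (s q + φ) : ℝ) / r + 2 * m := by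
      exact_mod_cast congrArg (fun t : ℝ => (t : ℂ)) hm
    refine ⟨-m, ?_⟩
    rw [e1, ← hb₁, e2]
    have hy := hy0 ε
    have hεC : (ε : ℂ) ≠ 0 := by exact_mod_cast hε.ne'
    have e3 : -(Real.pi / z' ε) * ((b₁ / a ^ 2 : ℝ) : ℂ) = -(Real.pi * ε / y ε) * b₁ := by
      simp only [hz'def]
      push_cast
      field_simp
    have e4 : -(Real.pi / z ε) * (b₁ : ℂ) =
        -(Real.pi * ε / y ε) * b₁ - Real.pi * Complex.I * (b₁ / r) := by
      rw [hzy]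
      have hy' : (r : ℂ) + Complex.I * ε ≠ 0 := fun h => hy (by
        simp only [hydef]
        linear_combination (r : ℂ) * h)
      simp only [hydef]
      field_simp
      linear_combination ((b₁ : ℂ) * (r + Complex.I * ε)) * Complex.I_sq
    rw [e3, e4, hmC]
    push_cast
    ring
  rw [hleft, hright]
  have hz'pow : z' ε ^ (l / 2 : ℂ) = ((ε : ℂ) ^ (l / 2 : ℂ))⁻¹ * (((|(a : ℝ)| ^ l : ℝ) : ℂ))⁻¹ *
      y ε ^ (l / 2 : ℂ) := by
    simp only [hz'def]
    have hpos2 : 0 < ε * (a : ℝ) ^ 2 := by positivity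
    rw [ofReal_mul_cpow (inv_pos.2 hpos2) (hy0 ε)]
    congr 1
    have hl2 : (l / 2 : ℂ) = (((l : ℝ) / 2 : ℝ) : ℂ) := by push_cast; rfl
    have h1 : ((a : ℝ) ^ 2) ^ ((l : ℝ) / 2) = |(a : ℝ)| ^ l := by
      rw [← sq_abs, ← Real.rpow_natCast_mul (abs_nonneg _), ← Real.rpow_natCast]
      congr 1
      push_cast; ring
    rw [hl2, ← Complex.ofReal_cpow (by positivity), ← Complex.ofReal_cpow hε.le,
      Real.inv_rpow (by positivity), Real.mul_rpow hε.le (by positivity), h1, mul_inv]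
    push_cast
    rfl
  have hεpow : (ε : ℂ) ^ (l / 2 : ℂ) ≠ 0 := by
    rw [Complex.cpow_def_of_ne_zero (by exact_mod_cast hε.ne')]
    exact Complex.exp_ne_zero _
  have hypow : y ε ^ (l / 2 : ℂ) ≠ 0 := by
    rw [Complex.cpow_def_of_ne_zero (hy0 ε)]
    exact Complex.exp_ne_zero _
  have hapow : ((|(a : ℝ)| ^ l : ℝ) : ℂ) ≠ 0 := by
    have : 0 < |(a : ℝ)| := abs_pos.2 ha'
    exact_mod_cast (pow_pos this _).ne'
  simp only [hT]
  simp_rw [← mul_div_assoc, ← Finset.sum_div]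
  rw [hz'pow]
  generalize ∑ q, G q * _ = c₀
  generalize y ε ^ (l / 2 : ℂ) = c₁ at *
  generalize z ε ^ (l / 2 : ℂ) = c₂ at *
  generalize (ε : ℂ) ^ (l / 2 : ℂ) = c₃ at *
  generalize ((|(a : ℝ)| ^ l : ℝ) : ℂ) = c₄ at *
  field_simp

end LatticeGauss

section GaussShift

variable {J V : Type*} [Fintype J] [AddCommGroup V] [Module ℝ V] [DecidableEq J]
variable {B : LinearMap.BilinForm ℝ V} (hsymm : ∀ x y, B x y = B y x)
  (hpos : ∀ x, x ≠ 0 → 0 < B x x) (e f : Module.Basis J ℝ V)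
  (hef : ∀ i j, B (e i) (f j) = if i = j then 1 else 0)

include hef in
theorem form_latVec_latVec (n k : J → ℤ) :
    B (latVec e n) (latVec f k) = ((∑ i, n i * k i : ℤ) : ℝ) := by
  simp only [latVec, map_sum, LinearMap.sum_apply, map_smul, LinearMap.smul_apply, smul_eq_mul,
    hef]
  push_cast
  simp [mul_comm]

include hsymm hpos hef in
-- The mean does not depend on the centre of the damping. Translating by u = `latVec f k₀` replaces
-- φ by φ - ru and multiplies by a constant phase; in the resulting Gauss sum both changes cancel,
-- because ⟨s q, u⟩ is an integer by duality.
theorem tendsto_gauss_reciprocity_shift {Q : Type*} [Fintype Q] {r : ℝ} (hr : r ≠ 0) {a : ℤ}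
    (ha : a ≠ 0) (s : Q → V) (E : Q × (J → ℤ) ≃ (J → ℤ))
    (hE : ∀ q n, latVec e (E (q, n)) = s q + (a : ℝ) • latVec e n) (φ : V)
    (hφ : ∀ q n, ∃ m : ℤ, B (s q + φ + (a : ℝ) • latVec e n) (s q + φ + (a : ℝ) • latVec e n) / r
      = B (s q + φ) (s q + φ) / r + 2 * m) (k₀ : J → ℤ) :
    Tendsto (fun ε : ℝ => (ε : ℂ) ^ (Fintype.card J / 2 : ℂ) *
        ∑' k : J → ℤ, Complex.exp (-(Real.pi * ε) *
            (B (latVec f k - latVec f k₀) (latVec f k - latVec f k₀) : ℝ) +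
          Real.pi * Complex.I * r * (B (latVec f k) (latVec f k) : ℝ) -
          2 * Real.pi * Complex.I * (B (latVec f k) φ : ℝ)))
      (𝓝[>] 0)
      (𝓝 ((((|r| ^ ((Fintype.card J : ℝ) / 2) / |(a : ℝ)| ^ Fintype.card J : ℝ) : ℂ) *
        Complex.exp (Real.pi * Complex.I / 4) ^
          ((Fintype.card J : ℤ) * (SignType.sign r : ℤ))) *
        ∑ q, Complex.exp (-(Real.pi * Complex.I / r) * (B (s q + φ) (s q + φ) : ℝ)))) := by
  set u := latVec f k₀ with hu
  have hrC : (r : ℂ) ≠ 0 := by exact_mod_cast hr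
  have hsq : ∀ q, s q = latVec e (E (q, 0)) := fun q => by simp [hE, latVec_zero]
  have hφ' : ∀ q n, ∃ m : ℤ, B (s q + (φ - r • u) + (a : ℝ) • latVec e n)
      (s q + (φ - r • u) + (a : ℝ) • latVec e n) / r
      = B (s q + (φ - r • u)) (s q + (φ - r • u)) / r + 2 * m := by
    intro q n
    obtain ⟨m, hm⟩ := hφ q n
    refine ⟨m - a * ∑ i, n i * k₀ i, ?_⟩
    have hint := form_latVec_latVec e f hef n k₀
    rw [← hu] at hint
    have e1 := hsymm φ (latVec e n)
    have e2 := hsymm u (latVec e n)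
    have e3 := hsymm (s q) (latVec e n)
    field_simp at hm ⊢
    push_cast
    push_cast at hint
    simp only [map_add, map_sub, map_smul, LinearMap.add_apply, LinearMap.sub_apply,
      LinearMap.smul_apply, smul_eq_mul, e1, e2, e3] at hm ⊢
    linear_combination hm - 2 * r * a * hint
  have h := tendsto_gauss_reciprocity hsymm hpos e f hef hr ha s E hE (φ - r • u) hφ'
  set c : ℂ := Complex.exp (Real.pi * Complex.I * r * (B u u : ℝ) -
    2 * Real.pi * Complex.I * (B u φ : ℝ)) with hc
  have h2 := h.const_mul c
  convert h2 using 2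
  · rename_i ε
    rw [mul_left_comm]
    congr 1
    rw [← tsum_mul_left, ← (Equiv.addRight k₀).tsum_eq fun k : J → ℤ =>
      Complex.exp (-(Real.pi * ε) * (B (latVec f k - u) (latVec f k - u) : ℝ) +
        Real.pi * Complex.I * r * (B (latVec f k) (latVec f k) : ℝ) -
          2 * Real.pi * Complex.I * (B (latVec f k) φ : ℝ))]
    refine tsum_congr fun k => ?_
    rw [hc, ← Complex.exp_add]
    congr 1
    rw [Equiv.coe_addRight, latVec_add, ← hu, add_sub_cancel_right]
    simp only [map_add, map_sub, map_smul, LinearMap.add_apply, smul_eq_mul,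
      hsymm u (latVec f k)]
    push_cast
    ring
  · rw [mul_left_comm c]
    congr 1
    rw [Finset.mul_sum]
    refine Finset.sum_congr rfl fun q _ => ?_
    rw [hc, ← Complex.exp_add, Complex.exp_eq_exp_iff_exists_int]
    have hint := form_latVec_latVec e f hef (E (q, 0)) k₀
    rw [← hu, ← hsq] at hint
    refine ⟨-∑ i, (E (q, 0)) i * k₀ i, ?_⟩
    have hintC : ((B (s q) u : ℝ) : ℂ) = ((∑ i, (E (q, 0)) i * k₀ i : ℤ) : ℂ) := by
      rw [hint]; push_cast; rfl
    rw [Int.cast_neg, ← hintC]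
    simp only [map_add, map_sub, map_smul, LinearMap.add_apply, LinearMap.sub_apply,
      LinearMap.smul_apply, smul_eq_mul, hsymm u (s q), hsymm u φ]
    push_cast
    field_simp
    ring

end GaussShift

/-! ### The real root system is crystallographic, reduced and irreducible -/

section Restrict

variable {𝔤 : Type*} [LieRing 𝔤] [LieAlgebra ℂ 𝔤] [FiniteDimensional ℂ 𝔤]
    [LieAlgebra.IsKilling ℂ 𝔤] (𝔥 : LieSubalgebra ℂ 𝔤) [𝔥.IsCartanSubalgebra]

theorem coe_pairing_realRootSystem (i j : 𝔥.root) :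
    (((realRootSystem 𝔥).pairing i j : ℝ) : ℂ) =
      (LieAlgebra.IsKilling.rootSystem 𝔥).pairing i j :=
  have := RootPairing.IsValuedIn.trans (LieAlgebra.IsKilling.rootSystem 𝔥) ℝ ℤ
  (LieAlgebra.IsKilling.rootSystem 𝔥).restrictScalars_pairing ℝ i j

instance isCrystallographic_realRootSystem : (realRootSystem 𝔥).IsCrystallographic where
  exists_value i j := by
    obtain ⟨n, hn⟩ := RootPairing.IsValuedIn.exists_value
      (P := LieAlgebra.IsKilling.rootSystem 𝔥) (S := ℤ) i j
    refine ⟨n, ?_⟩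
    rw [← coe_pairing_realRootSystem] at hn
    simp only [algebraMap_int_eq, eq_intCast] at hn ⊢
    exact_mod_cast hn

instance isReduced_realRootSystem : (realRootSystem 𝔥).IsReduced where
  eq_or_eq_neg i j h := by
    have h' : ¬ LinearIndependent ℂ ![(LieAlgebra.IsKilling.rootSystem 𝔥).root i,
        (LieAlgebra.IsKilling.rootSystem 𝔥).root j] := by
      intro hC
      refine h ?_
      have h1 := hC.restrict_scalars' ℝ
      refine LinearIndependent.of_comp
        (Submodule.subtype ((LieAlgebra.IsKilling.rootSystem 𝔥).rootSpan ℝ)) ?_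
      have h2 : (Submodule.subtype ((LieAlgebra.IsKilling.rootSystem 𝔥).rootSpan ℝ)) ∘
          ![(realRootSystem 𝔥).root i, (realRootSystem 𝔥).root j] =
          ![(LieAlgebra.IsKilling.rootSystem 𝔥).root i,
            (LieAlgebra.IsKilling.rootSystem 𝔥).root j] := by
        ext k
        fin_cases k <;> rfl
      rw [h2]
      exact h1
    rcases RootPairing.IsReduced.eq_or_eq_neg i j h' with h1 | h1
    · exact Or.inl (Subtype.ext h1)
    · exact Or.inr (Subtype.ext h1)

end Restrict

section Simple

variable {𝔤 : Type*} [LieRing 𝔤] [LieAlgebra ℂ 𝔤] [FiniteDimensional ℂ 𝔤]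
    [LieAlgebra.IsSimple ℂ 𝔤] (𝔥 : LieSubalgebra ℂ 𝔤) [𝔥.IsCartanSubalgebra]

/-- Irreducibility is known over ℂ. The roots inside an invariant real subspace are orthogonal to
all other roots, so over ℂ they span everything; a root outside the subspace would then be
orthogonal to itself. -/
theorem isIrreducible_realRootSystem [Nonempty 𝔥.root] : (realRootSystem 𝔥).IsIrreducible := by
  have hnt : Nontrivial ((LieAlgebra.IsKilling.rootSystem 𝔥).rootSpan ℝ) :=
    ⟨⟨(realRootSystem 𝔥).root (Classical.arbitrary _), 0, (realRootSystem 𝔥).ne_zero _⟩⟩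
  refine RootPairing.IsIrreducible.mk' _ fun q hq hne => ?_
  set q' : (realRootSystem 𝔥).invtRootSubmodule :=
    ⟨q, (realRootSystem 𝔥).mem_invtRootSubmodule_iff.2 hq⟩
  have hex : ∃ i, (realRootSystem 𝔥).root i ∈ q := by
    by_contra! hcon
    have := (RootPairing.invtRootSubmodule.eq_bot_iff q').2 hcon
    exact hne (congrArg Subtype.val this)
  set s : Set 𝔥.root := {i | (realRootSystem 𝔥).root i ∈ q}
  have hker : ∀ k, k ∉ s → ∀ i ∈ s, (realRootSystem 𝔥).pairing i k = 0 := by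
    intro k hk i hi
    exact (RootPairing.invtRootSubmodule.le_ker_coroot' q' (k := k) hk) hi
  have hkerC : ∀ k, k ∉ s → ∀ i ∈ s, (LieAlgebra.IsKilling.rootSystem 𝔥).pairing i k = 0 := by
    intro k hk i hi
    rw [← coe_pairing_realRootSystem, hker k hk i hi, Complex.ofReal_zero]
  have htop : Submodule.span ℂ ((LieAlgebra.IsKilling.rootSystem 𝔥).root '' s) = ⊤ := by
    refine RootPairing.span_root_image_eq_top_of_forall_orthogonal _ s hex fun j hj i hi => ?_
    have hjs : j ∉ s := fun h => hj (Submodule.subset_span ⟨j, h, rfl⟩)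
    have h1 := hkerC j hjs i hi
    exact ⟨RootPairing.pairing_eq_zero_iff'.1 h1, h1⟩
  have hall : ∀ k, k ∈ s := by
    intro k
    by_contra hk
    have hle : Submodule.span ℂ ((LieAlgebra.IsKilling.rootSystem 𝔥).root '' s) ≤
        LinearMap.ker ((LieAlgebra.IsKilling.rootSystem 𝔥).coroot' k) := by
      refine Submodule.span_le.2 ?_
      rintro _ ⟨i, hi, rfl⟩
      exact hkerC k hk i hi
    rw [htop] at hle
    have : (LieAlgebra.IsKilling.rootSystem 𝔥).pairing k k = 0 :=
      hle (Submodule.mem_top (x := (LieAlgebra.IsKilling.rootSystem 𝔥).root k))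
    simp at this
  have := (RootPairing.invtRootSubmodule.eq_top_iff q').2 (by
    rintro _ ⟨i, rfl⟩
    exact hall i)
  exact congrArg Subtype.val this

end Simple

/-! ### Invariance of the inner product and determinants of Weyl group elements -/

section RootFacts

variable {ι M N : Type*} [Fintype ι] [AddCommGroup M] [Module ℝ M] [AddCommGroup N] [Module ℝ N]
variable (P : RootPairing ι ℝ M N) [P.IsRootSystem]

theorem stdForm_symm (x y : M) : stdForm P x y = stdForm P y x := by
  simp only [stdForm, LinearMap.smul_apply, smul_eq_mul]
  congr 1
  exact P.rootForm_symmetric.eq x y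

theorem stdForm_scale_pos [Nonempty ι] : 0 < 2 / ⨆ i, P.RootForm (P.root i) (P.root i) := by
  have i := Classical.arbitrary ι
  have h1 : 0 < P.RootForm (P.root i) (P.root i) :=
    P.rootForm_pos_of_ne_zero (Submodule.subset_span ⟨i, rfl⟩) (P.ne_zero i)
  exact div_pos two_pos (h1.trans_le (le_ciSup (f := fun i => P.RootForm (P.root i) (P.root i))
    (Set.finite_range _).bddAbove i))

theorem stdForm_pos [Nonempty ι] (x : M) (hx : x ≠ 0) : 0 < stdForm P x x := by
  simp only [stdForm, LinearMap.smul_apply, smul_eq_mul]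
  refine mul_pos (stdForm_scale_pos P) (P.rootForm_pos_of_ne_zero ?_ hx)
  rw [RootPairing.rootSpan, RootPairing.IsRootSystem.span_root_eq_top]
  exact Submodule.mem_top

theorem stdForm_nonneg [Nonempty ι] (x : M) : 0 ≤ stdForm P x x := by
  by_cases h : x = 0
  · simp [h]
  · exact (stdForm_pos P x h).le

theorem stdForm_smul_smul (w : P.weylGroup) (x y : M) :
    stdForm P (w • x) (w • y) = stdForm P x y := by
  simp only [stdForm, LinearMap.smul_apply, smul_eq_mul]
  congr 1
  exact RootPairing.InvariantForm.apply_weylGroup_smul P (B := P.toInvariantForm) w x y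

theorem stdForm_smul_left (w : P.weylGroup) (x y : M) :
    stdForm P (w • x) y = stdForm P x (w⁻¹ • y) := by
  rw [← stdForm_smul_smul P w x, smul_inv_smul]

theorem reflection_smul_eq (i : ι) (x : M) :
    RootPairing.weylGroup.ofIdx P i • x = x - stdForm P x (P.root i) • corootVec P i := by
  have h1 : RootPairing.weylGroup.ofIdx P i • x = P.reflection i x := by
    simp
  rw [h1, RootPairing.reflection_apply]
  congr 1
  rw [show P.coroot' i x = P.toLinearMap x (P.coroot i) from rfl, ← stdForm_corootVec, corootVec,
    map_smul, smul_smul, smul_eq_mul, mul_comm]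

theorem stdForm_root_corootVec (i j : ι) :
    stdForm P (P.root i) (corootVec P j) = P.pairing i j := by
  rw [stdForm_corootVec]; rfl

theorem weylGroup_smul_root (w : P.weylGroup) (i : ι) :
    w • P.root i = P.root (P.weylGroupToPerm w i) := P.weylGroup_apply_root w i

theorem weylGroup_smul_corootVec (w : P.weylGroup) (i : ι) :
    w • corootVec P i = corootVec P (P.weylGroupToPerm w i) := by
  have h : normSq P (P.root (P.weylGroupToPerm w i)) = normSq P (P.root i) := by
    rw [normSq, ← weylGroup_smul_root, stdForm_smul_smul, normSq]
  rw [corootVec, corootVec, h, ← weylGroup_smul_root]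
  exact smul_comm _ _ _

theorem weylDet_mul (w₁ w₂ : P.weylGroup) :
    weylDet P (w₁ * w₂) = weylDet P w₁ * weylDet P w₂ := by
  rw [weylDet, map_mul, Module.End.mul_eq_comp, LinearMap.det_comp]; rfl

theorem weylDet_one : weylDet P 1 = 1 := by
  rw [weylDet, map_one, Module.End.one_eq_id, LinearMap.det_id]

theorem finite_module (P : RootPairing ι ℝ M N) [P.IsRootSystem] : Module.Finite ℝ M :=
  ⟨⟨(Set.finite_range P.root).toFinset, by
    rw [Set.Finite.coe_toFinset, RootPairing.IsRootSystem.span_root_eq_top (P := P)]⟩⟩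

/-- A reflection is a transvection with vector `-P.root i`, of determinant 1 - 2. -/
theorem weylDet_ofIdx (i : ι) : weylDet P (RootPairing.weylGroup.ofIdx P i) = -1 := by
  have := finite_module P
  have h : P.weylGroupRootRep (RootPairing.weylGroup.ofIdx P i) =
      LinearMap.transvection (P.coroot' i) (-P.root i) := by
    ext x
    have h1 : P.weylGroupRootRep (RootPairing.weylGroup.ofIdx P i) x =
      RootPairing.weylGroup.ofIdx P i • x := rfl
    rw [h1, RootPairing.weylGroup.ofIdx_smul]
    simp [RootPairing.reflection_apply, LinearMap.transvection.apply, sub_eq_add_neg]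
  rw [weylDet, h, LinearMap.transvection.det]
  simp
  norm_num

theorem weylDet_mul_self (w : P.weylGroup) : weylDet P w * weylDet P w = 1 := by
  obtain ⟨w, hw⟩ := w
  induction hw using RootPairing.weylGroup.induction with
  | mem i =>
    have := weylDet_ofIdx P i
    rw [show (⟨_, P.reflection_mem_weylGroup i⟩ : P.weylGroup) =
      RootPairing.weylGroup.ofIdx P i from rfl, this]
    norm_num
  | one =>
    have := weylDet_one P
    rw [show (⟨1, one_mem _⟩ : P.weylGroup) = 1 from rfl, this, one_mul]
  | mul x y hx hy h1 h2 =>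
    have := weylDet_mul P ⟨x, hx⟩ ⟨y, hy⟩
    rw [show (⟨x * y, mul_mem hx hy⟩ : P.weylGroup) = ⟨x, hx⟩ * ⟨y, hy⟩ from rfl, this,
      mul_mul_mul_comm, h1, h2, one_mul]

theorem weylDet_inv (w : P.weylGroup) : weylDet P w⁻¹ = weylDet P w := by
  have h1 := weylDet_mul_self P w
  have h2 : weylDet P w⁻¹ * weylDet P w = 1 := by
    rw [← weylDet_mul, inv_mul_cancel, weylDet_one]
  have h3 : weylDet P w ≠ 0 := fun h => by simp [h] at h1
  exact mul_right_cancel₀ h3 (h2.trans h1.symm)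

end RootFacts

/-! ### The highest root and long roots -/

section Highest

variable {ι M N : Type*} [Fintype ι] [AddCommGroup M] [Module ℝ M] [AddCommGroup N] [Module ℝ N]
variable {P : RootPairing ι ℝ M N} [P.IsRootSystem] (b : P.Base)

theorem stdForm_nonneg_of_mem_closure {x y : M}
    (hx : ∀ i ∈ b.support, 0 ≤ stdForm P x (P.root i))
    (hy : y ∈ AddSubmonoid.closure (P.root '' b.support)) : 0 ≤ stdForm P x y := by
  induction hy using AddSubmonoid.closure_induction with
  | mem y hy => obtain ⟨j, hj, rfl⟩ := hy; exact hx j hj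
  | zero => simp
  | add y z _ _ h1 h2 => rw [map_add]; exact add_nonneg h1 h2

/-- The sum of the fundamental weights. -/
noncomputable def fundSum : M := ∑ i, fundWeight b i

/-- This makes `fundSum` a strictly dominant vector, used to measure heights and to exhibit a point
of the open alcove. Its relation to `rho` plays no role. -/
theorem stdForm_fundSum_corootVec (i : b.support) :
    stdForm P (fundSum b) (corootVec P i) = 1 := by
  classical
  rw [← fundWeight_repr, fundSum, map_sum, Finset.sum_apply']
  simp [Finsupp.single_apply]

theorem root_eq_smul_corootVec (P : RootPairing ι ℝ M N) [P.IsRootSystem] (i : ι) :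
    P.root i = (normSq P (P.root i) / 2) • corootVec P i := by
  have := (stdForm_root_pos (P := P) i).ne'
  have h2 : normSq P (P.root i) ≠ 0 := this
  rw [corootVec, smul_smul, div_mul_div_comm, mul_comm, div_self (by positivity), one_smul]

theorem normSq_root_pos (P : RootPairing ι ℝ M N) [P.IsRootSystem] (i : ι) :
    0 < normSq P (P.root i) := stdForm_root_pos i

theorem stdForm_fundSum_root_pos (i : ι) (hi : i ∈ b.support) :
    0 < stdForm P (fundSum b) (P.root i) := by
  rw [root_eq_smul_corootVec, map_smul, smul_eq_mul,
    stdForm_fundSum_corootVec b ⟨i, hi⟩, mul_one]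
  exact half_pos (normSq_root_pos P i)

theorem root_reflectionPerm_eq (i j : ι) :
    P.root (P.reflectionPerm i j) =
      P.root j - stdForm P (P.root j) (P.root i) • corootVec P i := by
  rw [← reflection_smul_eq, P.root_reflectionPerm]
  simp

/-- The difference of θ and its reflection in α_i is ⟨θ, α_i⟩ times the simple coroot, and it pairs
non-negatively with `fundSum` because θ is highest. -/
theorem stdForm_highestRoot_nonneg {θ : ι} (hθ : IsHighestRoot b θ) (i : ι) (hi : i ∈ b.support) :
    0 ≤ stdForm P (P.root θ) (P.root i) := by
  have h1 := stdForm_nonneg_of_mem_closure b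
    (fun j hj => (stdForm_fundSum_root_pos b j hj).le) (hθ (P.reflectionPerm i θ))
  rw [root_reflectionPerm_eq, sub_sub_cancel, map_smul, stdForm_fundSum_corootVec b ⟨i, hi⟩] at h1
  simpa using h1

theorem normSq_root_le_two (P : RootPairing ι ℝ M N) [P.IsRootSystem] (i : ι) :
    normSq P (P.root i) ≤ 2 := by
  have : Nonempty ι := ⟨i⟩
  have h0 := stdForm_scale_pos P
  have h1 : P.RootForm (P.root i) (P.root i) ≤ ⨆ i, P.RootForm (P.root i) (P.root i) :=
    le_ciSup (f := fun i => P.RootForm (P.root i) (P.root i)) (Set.finite_range _).bddAbove i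
  have h2 : 0 < ⨆ i, P.RootForm (P.root i) (P.root i) := by
    by_contra hcon
    exact absurd (div_nonpos_of_nonneg_of_nonpos two_pos.le (not_lt.1 hcon)) (not_le.2 h0)
  simp only [normSq, stdForm, LinearMap.smul_apply, smul_eq_mul]
  rw [div_mul_eq_mul_div, div_le_iff₀ h2]
  linarith

theorem exists_normSq_root_eq_two (P : RootPairing ι ℝ M N) [P.IsRootSystem] [Nonempty ι] :
    ∃ i, normSq P (P.root i) = 2 := by
  obtain ⟨i, hi⟩ := exists_eq_ciSup_of_finite (f := fun i => P.RootForm (P.root i) (P.root i))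
  refine ⟨i, ?_⟩
  have h1 : 0 < P.RootForm (P.root i) (P.root i) :=
    P.rootForm_pos_of_ne_zero (Submodule.subset_span ⟨i, rfl⟩) (P.ne_zero i)
  simp only [normSq, stdForm, LinearMap.smul_apply, smul_eq_mul]
  rw [← hi, div_mul_cancel₀ _ h1.ne']

/-- A long root α of greatest height is dominant, since a simple reflection cannot raise it. Pairing
θ - α with the dominant vectors α and θ gives |α|² ≤ ⟨α, θ⟩ ≤ |θ|². -/
theorem normSq_highestRoot {θ : ι} (hθ : IsHighestRoot b θ) : normSq P (P.root θ) = 2 := by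
  classical
  have : Nonempty ι := ⟨θ⟩
  obtain ⟨i₀, hi₀⟩ := exists_normSq_root_eq_two P
  obtain ⟨i, hi, hmax⟩ := Finset.exists_max_image
    (Finset.univ.filter fun i => normSq P (P.root i) = 2)
    (fun i => stdForm P (fundSum b) (P.root i)) ⟨i₀, by simpa using hi₀⟩
  simp only [Finset.mem_filter, Finset.mem_univ, true_and] at hi hmax
  have hdom : ∀ j ∈ b.support, 0 ≤ stdForm P (P.root i) (P.root j) := by
    intro j hj
    have h1 := hmax (P.reflectionPerm j i) (by
      rw [← hi, root_reflectionPerm_eq, ← reflection_smul_eq, normSq, stdForm_smul_smul, normSq])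
    rw [root_reflectionPerm_eq, map_sub, map_smul, stdForm_fundSum_corootVec b ⟨j, hj⟩] at h1
    simp only [smul_eq_mul, mul_one] at h1
    linarith
  have h1 := stdForm_nonneg_of_mem_closure b hdom (hθ i)
  have h2 := stdForm_nonneg_of_mem_closure b (stdForm_highestRoot_nonneg b hθ) (hθ i)
  refine le_antisymm (normSq_root_le_two P θ) ?_
  rw [map_sub] at h1 h2
  rw [stdForm_symm P (P.root i) (P.root θ)] at h1
  rw [← hi]
  simp only [normSq] at *
  linarith

theorem corootVec_eq_root {i : ι} (hi : normSq P (P.root i) = 2) : corootVec P i = P.root i := by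
  rw [corootVec, hi, div_self two_ne_zero, one_smul]

/-- By irreducibility the Weyl orbit of a root spans the space, so no root is orthogonal to all of
it. -/
theorem exists_smul_highest_ne_zero [P.IsIrreducible] (i θ : ι) :
    ∃ w : P.weylGroup, stdForm P (P.root i) (w • P.root θ) ≠ 0 := by
  by_contra! contra
  have h : Submodule.span ℝ (MulAction.orbit P.weylGroup (P.root θ)) ≤
      LinearMap.ker (stdForm P (P.root i)) := by
    refine Submodule.span_le.2 fun v hv => ?_
    obtain ⟨g, rfl⟩ := MulAction.mem_orbit_iff.1 hv
    exact contra g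
  rw [RootPairing.span_orbit_eq_top] at h
  exact (stdForm_root_pos (P := P) i).ne' (h (Submodule.mem_top (x := P.root i)))

theorem exists_int_pairing (P : RootPairing ι ℝ M N) [P.IsCrystallographic] (i j : ι) :
    ∃ n : ℤ, P.pairing i j = n := by
  obtain ⟨n, hn⟩ := RootPairing.IsValuedIn.exists_value (P := P) (S := ℤ) i j
  exact ⟨n, by simpa using hn.symm⟩

/-- A root that is not orthogonal to a long root `γ` is `± γ`, or has inner product `± 1` with
it. -/
theorem stdForm_eq_one_or_of_long [P.IsCrystallographic] {i k : ι} (hk : normSq P (P.root k) = 2) :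
    ∃ n : ℤ, stdForm P (P.root i) (P.root k) = n ∧
      (-1 ≤ n ∧ n ≤ 1 ∨ n = 2 ∧ P.root i = P.root k ∨ n = -2 ∧ P.root i = -P.root k) := by
  have : Nonempty ι := ⟨i⟩
  obtain ⟨n, hn⟩ := exists_int_pairing P i k
  have h1 : stdForm P (P.root i) (P.root k) = n := by
    rw [← hn, ← stdForm_root_corootVec, corootVec_eq_root hk]
  refine ⟨n, h1, ?_⟩
  have hi := normSq_root_le_two P i
  have hp := stdForm_nonneg P (P.root i - P.root k)
  have hm := stdForm_nonneg P (P.root i + P.root k)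
  have hsq : stdForm P (P.root k) (P.root k) = 2 := hk
  have e1 : stdForm P (P.root i - P.root k) (P.root i - P.root k) =
      normSq P (P.root i) - 2 * n + 2 := by
    simp only [map_sub, LinearMap.sub_apply]
    rw [stdForm_symm P (P.root k) (P.root i), h1, hsq, normSq]; ring
  have e2 : stdForm P (P.root i + P.root k) (P.root i + P.root k) =
      normSq P (P.root i) + 2 * n + 2 := by
    simp only [map_add, LinearMap.add_apply]
    rw [stdForm_symm P (P.root k) (P.root i), h1, hsq, normSq]; ring
  have b1 : n ≤ 2 := by
    rw [e1] at hp
    have : (n : ℝ) ≤ 2 := by linarith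
    exact_mod_cast this
  have b2 : -2 ≤ n := by
    rw [e2] at hm
    have : (-2 : ℝ) ≤ n := by linarith
    exact_mod_cast this
  rcases eq_or_ne n 2 with h2 | h2
  · refine Or.inr (Or.inl ⟨h2, ?_⟩)
    by_contra hne
    have := stdForm_pos P _ (sub_ne_zero.2 hne)
    rw [e1, h2] at this
    push_cast at this
    linarith
  rcases eq_or_ne n (-2) with h3 | h3
  · refine Or.inr (Or.inr ⟨h3, ?_⟩)
    by_contra hne
    have := stdForm_pos P _ (fun h => hne (eq_neg_of_add_eq_zero_left h))
    rw [e2, h3] at this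
    push_cast at this
    linarith
  · left; constructor <;> omega

/-- Every coroot is, up to sign, in the Weyl group orbit of the highest root or a difference of two
elements of the orbit. -/
theorem corootVec_mem_of_orbit [P.IsCrystallographic] [P.IsIrreducible] {θ : ι}
    (hθ : normSq P (P.root θ) = 2) (G : AddSubgroup M) (hG : ∀ w : P.weylGroup, w • P.root θ ∈ G)
    (i : ι) : corootVec P i ∈ G := by
  obtain ⟨w, hw⟩ := exists_smul_highest_ne_zero (P := P) i θ
  have hwk : w • P.root θ = P.root (P.weylGroupToPerm w θ) := weylGroup_smul_root P w θ
  set k := P.weylGroupToPerm w θ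
  have hk : normSq P (P.root k) = 2 := by rw [← hwk, normSq, stdForm_smul_smul]; exact hθ
  have hkG : P.root k ∈ G := hwk ▸ hG w
  have hrG : P.root (P.reflectionPerm i k) ∈ G := by
    have : P.root (P.reflectionPerm i k) = (RootPairing.weylGroup.ofIdx P i * w) • P.root θ := by
      rw [mul_smul, hwk, reflection_smul_eq, root_reflectionPerm_eq]
    rw [this]; exact hG _
  -- The difference of k and its reflection is ⟨k, α_i⟩ times the coroot of α_i. The factor is
  -- nonzero by `hw`, hence ±1 unless α_i is ± the root k.
  have hd := G.sub_mem hkG hrG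
  rw [root_reflectionPerm_eq, sub_sub_cancel, stdForm_symm] at hd
  rw [hwk] at hw
  obtain ⟨n, hn, h⟩ := stdForm_eq_one_or_of_long (i := i) hk
  rw [hn] at hd hw
  rcases h with ⟨h1, h2⟩ | ⟨h1, h2⟩ | ⟨h1, h2⟩
  · have : n ≠ 0 := by rintro rfl; simp at hw
    have h4 : n = 1 ∨ n = -1 := by omega
    rcases h4 with rfl | rfl
    · simpa using hd
    · simpa using hd
  · have : normSq P (P.root i) = 2 := by rw [h2, hk]
    rw [corootVec_eq_root this, h2]; exact hkG
  · have : normSq P (P.root i) = 2 := by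
      rw [h2, ← hk]; simp [normSq]
    rw [corootVec_eq_root this, h2]; exact G.neg_mem hkG

/-- Twice the inverse of the squared length of a root is an integer. -/
theorem exists_int_two_div_normSq [P.IsCrystallographic] [P.IsIrreducible] (i : ι) :
    ∃ n : ℤ, 2 / normSq P (P.root i) = n := by
  have : Nonempty ι := ⟨i⟩
  obtain ⟨k₀, hk₀⟩ := exists_normSq_root_eq_two P
  obtain ⟨w, hw⟩ := exists_smul_highest_ne_zero (P := P) i k₀
  rw [weylGroup_smul_root] at hw
  set k := P.weylGroupToPerm w k₀
  have hk : normSq P (P.root k) = 2 := by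
    rw [← weylGroup_smul_root, normSq, stdForm_smul_smul]; exact hk₀
  obtain ⟨n, hn, h⟩ := stdForm_eq_one_or_of_long (i := i) hk
  rw [hn] at hw
  rcases h with ⟨h1, h2⟩ | ⟨h1, h2⟩ | ⟨h1, h2⟩
  -- Here ⟨α_i, k⟩ = ±1, so the Cartan integer of k against i is ±2/|α_i|².
  · obtain ⟨q, hq⟩ := exists_int_pairing P k i
    rw [← stdForm_root_corootVec, corootVec, map_smul, stdForm_symm, hn, smul_eq_mul] at hq
    have : n ≠ 0 := by rintro rfl; simp at hw
    have h4 : n = 1 ∨ n = -1 := by omega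
    rcases h4 with rfl | rfl
    · exact ⟨q, by simpa using hq⟩
    · exact ⟨-q, by push_cast at hq ⊢; linarith⟩
  · exact ⟨1, by rw [h2, hk]; norm_num⟩
  · refine ⟨1, ?_⟩
    have : normSq P (P.root i) = 2 := by
      rw [h2, ← hk]; simp [normSq]
    rw [this]; norm_num

end Highest

/-! ### The weight lattice and the even coroot lattice -/

section LatVec

variable {J V : Type*} [Fintype J] [AddCommGroup V] [Module ℝ V]

theorem mem_span_range_iff_latVec (v : J → V) (x : V) :
    x ∈ Submodule.span ℤ (Set.range v) ↔ ∃ n, latVec v n = x := by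
  rw [Submodule.mem_span_range_iff_exists_fun]
  simp [latVec, Int.cast_smul_eq_zsmul]

theorem latVec_injective (e : Module.Basis J ℝ V) : Function.Injective (latVec e) := by
  intro m n h
  have h1 : ∀ n : J → ℤ, latVec e n = e.equivFun.symm fun i => (n i : ℝ) := fun n => by
    rw [e.equivFun_symm_apply, latVec]
  rw [h1, h1] at h
  ext i
  exact_mod_cast congrFun (e.equivFun.symm.injective h) i

theorem form_eq_repr [DecidableEq J] {B : LinearMap.BilinForm ℝ V} {e f : Module.Basis J ℝ V}
    (hef : ∀ i j, B (e i) (f j) = if i = j then 1 else 0) (v : V) (j : J) :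
    B v (f j) = e.repr v j := by
  conv_lhs => rw [← e.sum_repr v]
  simp only [map_sum, LinearMap.sum_apply, LinearMap.map_smul₂, hef, smul_eq_mul]
  simp

end LatVec

section Lattice

variable {ι M N : Type*} [Fintype ι] [AddCommGroup M] [Module ℝ M] [AddCommGroup N] [Module ℝ N]
variable {P : RootPairing ι ℝ M N} [P.IsRootSystem] (b : P.Base)

theorem mem_weightLattice_iff {x : M} :
    x ∈ weightLattice b ↔ ∀ i : b.support, ∃ n : ℤ, stdForm P x (corootVec P i) = n := by
  rw [weightLattice, (fundWeight b).mem_span_iff_repr_mem ℤ x]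
  simp only [fundWeight_repr]
  exact forall_congr' fun i => ⟨fun ⟨n, hn⟩ => ⟨n, by simpa using hn.symm⟩,
    fun ⟨n, hn⟩ => ⟨n, by simpa using hn.symm⟩⟩

theorem corootVec_reflectionPerm (P : RootPairing ι ℝ M N) [P.IsRootSystem] (i j : ι) :
    corootVec P (P.reflectionPerm i j) = corootVec P j - P.pairing i j • corootVec P i := by
  have h : normSq P (P.root (P.reflectionPerm i j)) = normSq P (P.root j) := by
    rw [root_reflectionPerm_eq, ← reflection_smul_eq, normSq, stdForm_smul_smul, normSq]
  rw [corootVec, h, root_reflectionPerm_eq, smul_sub, ← corootVec, smul_smul,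
    ← stdForm_root_corootVec, corootVec, map_smul, smul_eq_mul, stdForm_symm]

theorem exists_int_stdForm {x y : M} (hx : x ∈ weightLattice b) (hy : y ∈ corootLattice b) :
    ∃ n : ℤ, stdForm P x y = n := by
  induction hy using Submodule.span_induction with
  | mem y hy => obtain ⟨i, rfl⟩ := hy; exact (mem_weightLattice_iff b).1 hx i
  | zero => exact ⟨0, by simp⟩
  | add y z _ _ h1 h2 =>
    obtain ⟨m, hm⟩ := h1
    obtain ⟨n, hn⟩ := h2
    exact ⟨m + n, by rw [map_add, hm, hn]; push_cast; rfl⟩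
  | smul a y _ h =>
    obtain ⟨m, hm⟩ := h
    exact ⟨a * m, by rw [map_zsmul, hm]; push_cast; simp⟩

/-- The basis of simple coroots. -/
noncomputable def corootBasis : Module.Basis b.support ℝ M :=
  b.toWeightBasis.isUnitSMul (w := fun i => 2 / normSq P (P.root i))
    fun i => (div_pos two_pos (normSq_root_pos P i)).ne'.isUnit

theorem corootBasis_apply (i : b.support) : corootBasis b i = corootVec P i := by
  simp [corootBasis, Module.Basis.isUnitSMul_apply, corootVec]

theorem stdForm_fundWeight_corootVec (i j : b.support) :
    stdForm P (fundWeight b i) (corootVec P j) = open Classical in if i = j then 1 else 0 := by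
  classical
  rw [← fundWeight_repr]
  simp [Finsupp.single_apply]

theorem stdForm_corootBasis_fundWeight (i j : b.support) :
    stdForm P (corootBasis b i) (fundWeight b j) = open Classical in if i = j then 1 else 0 := by
  rw [corootBasis_apply, stdForm_symm, stdForm_fundWeight_corootVec]
  by_cases h : i = j
  · simp [h]
  · simp [h, Ne.symm h]

theorem mem_weightLattice_iff_latVec {x : M} :
    x ∈ weightLattice b ↔ ∃ n, latVec (fundWeight b) n = x :=
  mem_span_range_iff_latVec _ _

theorem mem_corootLattice_iff_latVec {x : M} :
    x ∈ corootLattice b ↔ ∃ n, latVec (corootBasis b) n = x := by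
  rw [← mem_span_range_iff_latVec, corootLattice]
  simp only [← corootBasis_apply]

theorem volY_eq : volY b = gramVol P (corootBasis b) := by
  rw [volY]
  congr 1
  ext i
  rw [corootBasis_apply]

theorem volY_pos [Nonempty ι] : 0 < volY b := by
  classical
  obtain ⟨S, hS, -, hdet, -⟩ :=
    exists_gram_eq (stdForm_symm P) (stdForm_pos P) (corootBasis b)
  have h : volY b = |S.det| := by
    rw [volY_eq, gramVol, ← hdet]; congr!
  exact h ▸ abs_pos.2 hS

/-- Simple coroots and fundamental weights are dual bases, so their Gram matrices are inverse to
each other. -/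
theorem volX_mul_volY [Nonempty ι] : volX b * volY b = 1 := by
  classical
  have hef : ∀ i j, stdForm P (corootBasis b i) (fundWeight b j) = if i = j then 1 else 0 :=
    fun i j => by rw [stdForm_corootBasis_fundWeight]
  set F : Matrix b.support b.support ℝ :=
    Matrix.of fun i j => stdForm P (fundWeight b i) (fundWeight b j) with hF
  set E : Matrix b.support b.support ℝ :=
    Matrix.of fun i j => stdForm P (corootBasis b i) (corootBasis b j) with hE
  have hFE : F * E = 1 := by
    ext i k
    have h1 := congrArg (fun v => stdForm P v (corootBasis b k))
      ((corootBasis b).sum_repr (fundWeight b i))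
    simp only [map_sum, LinearMap.sum_apply, LinearMap.map_smul₂, smul_eq_mul,
      ← form_eq_repr hef] at h1
    rw [Matrix.mul_apply, Matrix.one_apply]
    simp only [hF, hE, Matrix.of_apply]
    rw [h1, stdForm_symm, hef]
    by_cases h : i = k
    · simp [h]
    · simp [h, Ne.symm h]
  have h1 : volX b = √F.det := by
    rw [volX, gramVol]; congr!
  have h2 : volY b = √E.det := by
    rw [volY_eq, gramVol]; congr!
  have h3 : 0 ≤ E.det := by
    have := volY_pos b
    rw [h2] at this
    exact (Real.sqrt_pos.1 this).le
  rw [h1, h2, ← Real.sqrt_mul' _ h3, ← Matrix.det_mul, hFE, Matrix.det_one, Real.sqrt_one]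

variable [P.IsCrystallographic]

/-- On generators |α^∨|² is twice the integer 2/|α|²; cross terms contribute twice an integer.
Evenness is what makes Θ periodic under κY^∨ and lets the Gauss terms descend to the quotient. -/
theorem exists_int_normSq {y : M} [P.IsIrreducible] (hy : y ∈ corootLattice b) (hY : ∀ y ∈ corootLattice b, y ∈ weightLattice b) :
    ∃ n : ℤ, normSq P y = 2 * n := by
  induction hy using Submodule.span_induction with
  | mem y hy =>
    obtain ⟨i, rfl⟩ := hy
    obtain ⟨n, hn⟩ := exists_int_two_div_normSq (P := P) i
    refine ⟨n, ?_⟩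
    have := (normSq_root_pos P i).ne'
    change stdForm P (corootVec P i) (corootVec P i) = _
    rw [corootVec, map_smul, LinearMap.map_smul₂, ← normSq, hn, smul_eq_mul, smul_eq_mul,
      ← hn]
    field_simp
  | zero => exact ⟨0, by simp [normSq]⟩
  | add y z h3 h4 h1 h2 =>
    obtain ⟨m, hm⟩ := h1
    obtain ⟨n, hn⟩ := h2
    obtain ⟨k, hk⟩ := exists_int_stdForm b (hY _ h3) h4
    refine ⟨m + n + k, ?_⟩
    rw [normSq] at *
    simp only [map_add, LinearMap.add_apply]
    rw [stdForm_symm P z y, hk, hm, hn]; push_cast; ring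
  | smul a y _ h =>
    obtain ⟨m, hm⟩ := h
    refine ⟨a * a * m, ?_⟩
    rw [normSq] at *
    rw [map_zsmul, LinearMap.map_smul_of_tower, LinearMap.smul_apply, hm]
    push_cast; simp; ring

theorem stdForm_corootVec_int [P.IsIrreducible] (i j : ι) :
    ∃ n : ℤ, stdForm P (corootVec P i) (corootVec P j) = n := by
  obtain ⟨n, hn⟩ := exists_int_two_div_normSq (P := P) i
  obtain ⟨m, hm⟩ := exists_int_pairing P i j
  refine ⟨n * m, ?_⟩
  rw [corootVec, LinearMap.map_smul₂, stdForm_root_corootVec, hn, hm]; simp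

theorem corootLattice_le [P.IsIrreducible] : corootLattice b ≤ weightLattice b := by
  refine Submodule.span_le.2 ?_
  rintro _ ⟨i, rfl⟩
  exact (mem_weightLattice_iff b).2 fun j => stdForm_corootVec_int (P := P) i j

variable [P.IsReduced]

theorem corootVec_mem (i : ι) : corootVec P i ∈ corootLattice b := by
  refine b.induction_reflect i (p := fun i => corootVec P i ∈ corootLattice b) (fun i hi => ?_) (fun i hi => Submodule.subset_span ⟨⟨i, hi⟩, rfl⟩)
    fun i j hi hj => ?_
  · obtain ⟨n, hn⟩ := exists_int_pairing P i i
    rw [corootVec_reflectionPerm, hn, Int.cast_smul_eq_zsmul]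
    exact Submodule.sub_mem _ hi (Submodule.smul_mem _ _ hi)
  · obtain ⟨n, hn⟩ := exists_int_pairing P j i
    rw [corootVec_reflectionPerm, hn, Int.cast_smul_eq_zsmul]
    exact Submodule.sub_mem _ hi (Submodule.smul_mem _ _ (Submodule.subset_span ⟨⟨j, hj⟩, rfl⟩))

theorem smul_mem_corootLattice (w : P.weylGroup) {y : M} (hy : y ∈ corootLattice b) :
    w • y ∈ corootLattice b := by
  induction hy using Submodule.span_induction with
  | mem y hy =>
    obtain ⟨i, rfl⟩ := hy
    rw [weylGroup_smul_corootVec]; exact corootVec_mem b _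
  | zero => rw [smul_zero]; exact Submodule.zero_mem _
  | add y z _ _ h1 h2 => rw [smul_add]; exact Submodule.add_mem _ h1 h2
  | smul a y _ h => rw [smul_comm]; exact Submodule.smul_mem _ _ h

theorem smul_mem_weightLattice (w : P.weylGroup) {x : M} (hx : x ∈ weightLattice b) :
    w • x ∈ weightLattice b := by
  refine (mem_weightLattice_iff b).2 fun i => ?_
  rw [stdForm_smul_left]
  exact exists_int_stdForm b hx (smul_mem_corootLattice b _ (corootVec_mem b i))

end Lattice

/-! ### Affine reflections, alcoves and the exchange property -/

section Affine

variable {ι M N : Type*} [Fintype ι] [AddCommGroup M] [Module ℝ M] [AddCommGroup N] [Module ℝ N]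
variable (P : RootPairing ι ℝ M N) [P.IsRootSystem]

/-- The affine function `x ↦ ⟨x, α_i⟩ - n κ`. -/
noncomputable def affVal (κ : ℝ) (i : ι) (n : ℤ) (x : M) : ℝ :=
  stdForm P x (P.root i) - n * κ

/-- The reflection in the hyperplane `⟨x, α_i⟩ = n κ`. -/
noncomputable def affRefl (κ : ℝ) (i : ι) (n : ℤ) (x : M) : M :=
  x - affVal P κ i n x • corootVec P i

theorem stdForm_corootVec_root_self (i : ι) : stdForm P (corootVec P i) (P.root i) = 2 := by
  rw [stdForm_symm, stdForm_root_corootVec, P.pairing_same]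

theorem affRefl_eq (κ : ℝ) (i : ι) (n : ℤ) (x : M) :
    affRefl P κ i n x = RootPairing.weylGroup.ofIdx P i • x + (n * κ) • corootVec P i := by
  rw [affRefl, affVal, reflection_smul_eq]
  module

theorem stdForm_affRefl (κ : ℝ) (i : ι) (n : ℤ) (x y : M) :
    stdForm P (affRefl P κ i n x) y =
      stdForm P x y - affVal P κ i n x * stdForm P (corootVec P i) y := by
  rw [affRefl, LinearMap.map_sub₂, LinearMap.map_smul₂, smul_eq_mul]

theorem affVal_affRefl_self (κ : ℝ) (i : ι) (n : ℤ) (x : M) :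
    affVal P κ i n (affRefl P κ i n x) = -affVal P κ i n x := by
  rw [affVal, stdForm_affRefl, stdForm_corootVec_root_self]
  simp only [affVal]
  ring

theorem affRefl_affRefl (κ : ℝ) (i : ι) (n : ℤ) (x : M) :
    affRefl P κ i n (affRefl P κ i n x) = x := by
  rw [affRefl, affVal_affRefl_self, affRefl]
  module

/-- Reflections permute the affine hyperplanes, and conjugation permutes the reflections
accordingly. This moves a reflection past a letter of a word. -/
theorem exists_affVal_affRefl [P.IsCrystallographic] (κ : ℝ) (i j : ι) (n m : ℤ) :
    ∃ m' : ℤ, ∀ x, affVal P κ j m (affRefl P κ i n x) =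
        affVal P κ (P.reflectionPerm i j) m' x ∧
      affRefl P κ j m (affRefl P κ i n x) =
        affRefl P κ i n (affRefl P κ (P.reflectionPerm i j) m' x) := by
  obtain ⟨q, hq⟩ := exists_int_pairing P j i
  have hroot : P.root (P.reflectionPerm i j) = P.root j - (q : ℝ) • P.root i := by
    rw [root_reflectionPerm_eq, ← hq, ← stdForm_root_corootVec, corootVec, map_smul, smul_smul,
      smul_eq_mul, mul_comm]
  have hval : ∀ x, affVal P κ j m (affRefl P κ i n x) =
      affVal P κ (P.reflectionPerm i j) (m - n * q) x := by
    intro x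
    rw [affVal, stdForm_affRefl, stdForm_symm P (corootVec P i), stdForm_root_corootVec, hq,
      affVal, affVal, hroot, map_sub, map_smul]
    push_cast
    rw [smul_eq_mul]
    ring
  refine ⟨m - n * q, fun x => ⟨hval x, ?_⟩⟩
  rw [affRefl, hval, affRefl_eq P κ i n (affRefl _ _ _ _ _), affRefl_eq P κ i n x]
  conv_rhs => rw [affRefl, smul_sub]
  have h1 : RootPairing.weylGroup.ofIdx P i • corootVec P (P.reflectionPerm i j) =
      corootVec P j := by
    have h2 : corootVec P (P.reflectionPerm i j) =
        RootPairing.weylGroup.ofIdx P i • corootVec P j := by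
      rw [weylGroup_smul_corootVec]
      congr 1
    rw [h2, reflection_smul_eq, reflection_smul_eq]
    rw [LinearMap.map_sub₂, LinearMap.map_smul₂, stdForm_corootVec_root_self, smul_eq_mul]
    module
  rw [smul_comm _ (affVal P κ (P.reflectionPerm i j) (m - n * q) x), h1]
  abel

variable {P} (b : P.Base)

/-- The walls of the fundamental alcove. -/
def IsAlcoveWall (θ i : ι) (n : ℤ) : Prop := (i ∈ b.support ∧ n = 0) ∨ (i = θ ∧ n = 1)

/-- The products of `k` reflections in the walls of the fundamental alcove. -/
inductive IsWord (θ : ι) (κ : ℝ) : ℕ → (M → M) → Prop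
  | nil : IsWord θ κ 0 id
  | cons {k : ℕ} {g : M → M} {i : ι} {n : ℤ} : IsAlcoveWall b θ i n → IsWord θ κ k g →
      IsWord θ κ (k + 1) (affRefl P κ i n ∘ g)

/-- The open fundamental alcove. -/
def openAlcove (θ : ι) (κ : ℝ) : Set M :=
  {x | (∀ i ∈ b.support, 0 < stdForm P x (P.root i)) ∧ stdForm P x (P.root θ) < κ}

theorem openAlcove_nonempty (θ : ι) {κ : ℝ} (hκ : 0 < κ) : (openAlcove b θ κ).Nonempty := by
  set c := stdForm P (fundSum b) (P.root θ)
  have hc : 0 < |c| + 1 := by positivity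
  refine ⟨(κ / (|c| + 1)) • fundSum b, fun i hi => ?_, ?_⟩
  · rw [LinearMap.map_smul₂, smul_eq_mul]
    exact mul_pos (div_pos hκ hc) (stdForm_fundSum_root_pos b i hi)
  · rw [LinearMap.map_smul₂, smul_eq_mul, div_mul_eq_mul_div, div_lt_iff₀ hc]
    have : c < |c| + 1 := (le_abs_self c).trans_lt (lt_add_one _)
    exact mul_lt_mul_of_pos_left this hκ

theorem stdForm_pos_of_isPosRoot {x : M} (hx : ∀ i ∈ b.support, 0 < stdForm P x (P.root i)) {i : ι}
    (hi : IsPosRoot b i) : 0 < stdForm P x (P.root i) := by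
  have h : ∀ y ∈ AddSubmonoid.closure (P.root '' b.support), y = 0 ∨ 0 < stdForm P x y := by
    intro y hy
    induction hy using AddSubmonoid.closure_induction with
    | mem y hy => obtain ⟨j, hj, rfl⟩ := hy; exact Or.inr (hx j hj)
    | zero => exact Or.inl rfl
    | add y z _ _ h1 h2 =>
      rcases h1 with rfl | h1
      · simpa using h2
      · rcases h2 with rfl | h2
        · right; simpa using h1
        · right; rw [map_add]; exact add_pos h1 h2
  exact (h _ hi).resolve_left (P.ne_zero i)

theorem root_reflectionPerm_same (i : ι) : P.root (P.reflectionPerm i i) = -P.root i := by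
  simp

theorem isPosRoot_or (i : ι) : IsPosRoot b i ∨ IsPosRoot b (P.reflectionPerm i i) := by
  rcases b.root_mem_or_neg_mem i with h | h
  · exact Or.inl h
  · right; rw [IsPosRoot, root_reflectionPerm_same]; exact h

theorem not_isPosRoot_neg {i : ι} (hi : IsPosRoot b i) : ¬ IsPosRoot b (P.reflectionPerm i i) := by
  intro h
  have h1 := stdForm_pos_of_isPosRoot b (stdForm_fundSum_root_pos b) hi
  have h2 := stdForm_pos_of_isPosRoot b (stdForm_fundSum_root_pos b) h
  rw [root_reflectionPerm_same, map_neg] at h2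
  linarith

variable [P.IsCrystallographic]

theorem isPosRoot_of_isPos {i : ι} (hi : b.IsPos i) : IsPosRoot b i := by
  refine hi.induction_on_add (fun i hi => AddSubmonoid.subset_closure ⟨i, hi, rfl⟩)
    fun i j k hk hi hj => ?_
  rw [IsPosRoot, hk]
  exact add_mem hi (AddSubmonoid.subset_closure ⟨j, hj, rfl⟩)

theorem isPos_iff_isPosRoot {i : ι} : b.IsPos i ↔ IsPosRoot b i := by
  refine ⟨isPosRoot_of_isPos b, fun h => ?_⟩
  rcases RootPairing.Base.IsPos.or_neg b i with h1 | h1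
  · exact h1
  · exact absurd (isPosRoot_of_isPos b h1) (not_isPosRoot_neg b h)

variable {b} {θ : ι} (hθ : IsHighestRoot b θ) {κ : ℝ}

include hθ in
theorem stdForm_mem_Ioo {p : M} (hp : p ∈ openAlcove b θ κ) {i : ι} (hi : IsPosRoot b i) :
    0 < stdForm P p (P.root i) ∧ stdForm P p (P.root i) < κ := by
  refine ⟨stdForm_pos_of_isPosRoot b hp.1 hi, ?_⟩
  have := stdForm_nonneg_of_mem_closure b (fun i hi => (hp.1 i hi).le) (hθ i)
  rw [map_sub] at this
  linarith [hp.2]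

/-- Two values strictly between the same consecutive multiples of κ are on the same side of every
multiple of κ. -/
theorem sub_mul_sub_pos {v₁ v₂ κ : ℝ} (hκ : 0 < κ) {a m : ℤ} (h₁ : a * κ < v₁)
    (h₂ : v₁ < (a + 1) * κ) (h₃ : a * κ < v₂) (h₄ : v₂ < (a + 1) * κ) :
    0 < (v₁ - m * κ) * (v₂ - m * κ) := by
  rcases le_or_gt m a with h | h
  · have : (m : ℝ) * κ ≤ a * κ := mul_le_mul_of_nonneg_right (by exact_mod_cast h) hκ.le
    exact mul_pos (by linarith) (by linarith)
  · have : ((a : ℝ) + 1) * κ ≤ m * κ := mul_le_mul_of_nonneg_right (by exact_mod_cast h) hκ.le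
    exact mul_pos_of_neg_of_neg (by linarith) (by linarith)

variable [P.IsReduced]

include hθ in
-- Adjacent alcoves are separated only by their common wall. A simple reflection permutes the
-- positive roots other than α_i, so the values of these stay in (0, κ). For the upper wall, a
-- positive root other than θ has pairing 0 or 1 with θ.
theorem affVal_mul_pos_or_of_isPosRoot (hκ : 0 < κ) {p : M} (hp : p ∈ openAlcove b θ κ) {i j : ι}
    {n : ℤ} (hi : IsAlcoveWall b θ i n) (hj : IsPosRoot b j) (m : ℤ) :
    0 < affVal P κ j m p * affVal P κ j m (affRefl P κ i n p) ∨
      affRefl P κ j m = affRefl P κ i n := by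
  obtain ⟨h1, h2⟩ := stdForm_mem_Ioo hθ hp hj
  rcases hi with ⟨hi, rfl⟩ | ⟨rfl, rfl⟩
  · rcases eq_or_ne j i with rfl | hne
    · have e : stdForm P (affRefl P κ j 0 p) (P.root j) = -stdForm P p (P.root j) := by
        have := affVal_affRefl_self P κ j 0 p
        simpa [affVal] using this
      rcases eq_or_ne m 0 with rfl | hm
      · exact Or.inr rfl
      left
      simp only [affVal]
      rw [e]
      rcases lt_or_gt_of_ne hm with h | h
      · have : (m : ℝ) * κ ≤ (-1 : ℤ) * κ :=
          mul_le_mul_of_nonneg_right (by exact_mod_cast (by omega : m ≤ -1)) hκ.le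
        push_cast at this
        exact mul_pos (by linarith) (by linarith)
      · have : (1 : ℤ) * κ ≤ (m : ℝ) * κ :=
          mul_le_mul_of_nonneg_right (by exact_mod_cast (by omega : 1 ≤ m)) hκ.le
        push_cast at this
        exact mul_pos_of_neg_of_neg (by linarith) (by linarith)
    · left
      have hpos := (isPos_iff_isPosRoot b).1
        (((isPos_iff_isPosRoot b).2 hj).reflectionPerm hi hne)
      obtain ⟨h3, h4⟩ := stdForm_mem_Ioo hθ hp hpos
      have e : stdForm P (affRefl P κ i 0 p) (P.root j) =
          stdForm P p (P.root (P.reflectionPerm i j)) := by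
        rw [affRefl_eq, root_reflectionPerm_eq, ← reflection_smul_eq, Int.cast_zero, zero_mul,
          zero_smul, add_zero, stdForm_smul_left]
        congr 1
        rw [inv_smul_eq_iff, reflection_smul_eq, reflection_smul_eq, LinearMap.map_sub₂,
          LinearMap.map_smul₂, stdForm_corootVec_root_self, smul_eq_mul]
        module
      simp only [affVal]
      rw [e]
      exact sub_mul_sub_pos hκ (a := 0) (by push_cast; linarith) (by push_cast; linarith)
        (by push_cast; linarith) (by push_cast; linarith)
  · have hlong := normSq_highestRoot b hθ
    have hcor := corootVec_eq_root hlong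
    obtain ⟨q, hq, hcase⟩ := stdForm_eq_one_or_of_long (i := j) hlong
    have e : stdForm P (affRefl P κ i 1 p) (P.root j) =
        stdForm P p (P.root j) - (stdForm P p (P.root i) - κ) * q := by
      rw [stdForm_affRefl, hcor, stdForm_symm P (P.root i), hq]
      simp [affVal]
    have hq0 : 0 ≤ q := by
      have := stdForm_nonneg_of_mem_closure b (stdForm_highestRoot_nonneg b hθ) hj
      rw [stdForm_symm, hq] at this
      exact_mod_cast this
    rcases hcase with ⟨h3, h4⟩ | ⟨h3, h4⟩ | ⟨h3, h4⟩
    · left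
      simp only [affVal]
      rw [e]
      have : q = 0 ∨ q = 1 := by omega
      rcases this with rfl | rfl
      · exact sub_mul_sub_pos hκ (a := 0) (by simpa) (by simpa) (by simpa) (by simpa)
      · have hk : P.root (P.reflectionPerm (P.reflectionPerm i j) (P.reflectionPerm i j)) =
            P.root i - P.root j := by
          rw [root_reflectionPerm_same, root_reflectionPerm_eq, hcor, hq]
          simp
        have hpos : IsPosRoot b
            (P.reflectionPerm (P.reflectionPerm i j) (P.reflectionPerm i j)) := by
          rw [IsPosRoot, hk]; exact hθ j
        obtain ⟨h5, h6⟩ := stdForm_mem_Ioo hθ hp hpos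
        rw [hk, map_sub] at h5 h6
        exact sub_mul_sub_pos hκ (a := 0) (by simpa) (by simpa) (by push_cast; linarith)
          (by push_cast; linarith)
    · have hji : j = i := P.root.injective h4
      subst hji
      rcases eq_or_ne m 1 with rfl | hm
      · exact Or.inr rfl
      left
      simp only [affVal]
      rw [e, h3]
      push_cast
      -- For θ itself the values are v and 2κ - v, both in (0, 2κ): only the multiple κ can separate
      -- them.
      rcases lt_or_gt_of_ne hm with h | h
      · have : (m : ℝ) * κ ≤ (0 : ℤ) * κ :=
          mul_le_mul_of_nonneg_right (by exact_mod_cast (by omega : m ≤ 0)) hκ.le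
        push_cast at this
        exact mul_pos (by linarith) (by linarith)
      · have : (2 : ℤ) * κ ≤ (m : ℝ) * κ :=
          mul_le_mul_of_nonneg_right (by exact_mod_cast (by omega : 2 ≤ m)) hκ.le
        push_cast at this
        exact mul_pos_of_neg_of_neg (by linarith) (by linarith)
    · omega

theorem affRefl_reflectionPerm_self (P : RootPairing ι ℝ M N) [P.IsRootSystem] (κ : ℝ) (j : ι)
    (m : ℤ) : affRefl P κ (P.reflectionPerm j j) (-m) = affRefl P κ j m := by
  funext x
  have : normSq P (-P.root j) = normSq P (P.root j) := by simp [normSq]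
  rw [affRefl, affRefl, affVal, affVal, corootVec, root_reflectionPerm_same, this, corootVec]
  simp only [map_neg]
  push_cast
  module

include hθ in
theorem affVal_mul_pos_or (hκ : 0 < κ) {p : M} (hp : p ∈ openAlcove b θ κ) {i j : ι}
    {n : ℤ} (hi : IsAlcoveWall b θ i n) (m : ℤ) :
    0 < affVal P κ j m p * affVal P κ j m (affRefl P κ i n p) ∨
      affRefl P κ j m = affRefl P κ i n := by
  rcases isPosRoot_or b j with h | h
  · exact affVal_mul_pos_or_of_isPosRoot hθ hκ hp hi h m
  · have := affVal_mul_pos_or_of_isPosRoot hθ hκ hp hi h (-m)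
    rw [affRefl_reflectionPerm_self] at this
    refine this.imp_left fun h1 => ?_
    have e : ∀ x, affVal P κ (P.reflectionPerm j j) (-m) x = -affVal P κ j m x := by
      intro x
      rw [affVal, affVal, root_reflectionPerm_same, map_neg]
      push_cast
      ring
    rwa [e, e, neg_mul_neg] at h1

include hθ in
/-- The exchange property of the affine Weyl group. -/
theorem IsWord.exchange (hκ : 0 < κ) {p : M} (hp : p ∈ openAlcove b θ κ) {k : ℕ} {g : M → M}
    (hg : IsWord b θ κ k g) (j : ι) (m : ℤ)
    (h : affVal P κ j m p * affVal P κ j m (g p) < 0) :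
    ∃ k' < k, IsWord b θ κ k' (affRefl P κ j m ∘ g) := by
  induction hg generalizing j m with
  | nil => exact absurd h (not_lt.2 (mul_self_nonneg _))
  | @cons k g i n hi hg ih =>
    rcases affVal_mul_pos_or (j := j) hθ hκ hp hi m with h1 | h1
    · obtain ⟨m', hm'⟩ := exists_affVal_affRefl P κ i j n m
      -- The hyperplane has p and its reflection on one side, so it separates the images of p and g
      -- p under the outermost reflection. Pulled back through that reflection, it separates p from
      -- g p.
      have h2 : affVal P κ j m (affRefl P κ i n p) *
          affVal P κ j m (affRefl P κ i n (g p)) < 0 := by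
        by_contra hcon
        have h3 := mul_nonneg h1.le (not_lt.1 hcon)
        have h4 : affVal P κ j m (affRefl P κ i n p) ≠ 0 := fun h0 => by simp [h0] at h1
        have h5 := mul_neg_of_pos_of_neg (pow_pos (abs_pos.2 h4) 2) h
        rw [sq_abs] at h5
        simp only [Function.comp_apply] at h5
        nlinarith
      rw [(hm' p).1, (hm' (g p)).1] at h2
      obtain ⟨k', hk', hw⟩ := ih _ _ h2
      refine ⟨k' + 1, by omega, ?_⟩
      have : affRefl P κ j m ∘ affRefl P κ i n ∘ g =
          affRefl P κ i n ∘ affRefl P κ (P.reflectionPerm i j) m' ∘ g := by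
        funext x
        exact (hm' (g x)).2
      rw [this]
      exact .cons hi hw
    · refine ⟨k, Nat.lt_succ_self k, ?_⟩
      have : affRefl P κ j m ∘ affRefl P κ i n ∘ g = g := by
        funext x
        rw [h1]
        exact affRefl_affRefl P κ i n (g x)
      rwa [this]

include hθ in
/-- An element of the affine Weyl group that maps a point of the open alcove into the open alcove
is the identity. -/
theorem IsWord.eq_id (hκ : 0 < κ) {p : M} (hp : p ∈ openAlcove b θ κ) {k : ℕ} {g : M → M}
    (hg : IsWord b θ κ k g) (hgp : g p ∈ openAlcove b θ κ) : g = id := by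
  induction k using Nat.strong_induction_on generalizing g with
  | _ k ih =>
    cases hg with
    | nil => rfl
    | @cons k h i n hi hh =>
      -- Both points lie in the open alcove, so the wall of the outermost letter does not separate
      -- them. It must then separate p from h p, and exchange gives a shorter word for the same map.
      have hpos : 0 < affVal P κ i n p * affVal P κ i n (affRefl P κ i n (h p)) := by
        rcases hi with ⟨hi, rfl⟩ | ⟨rfl, rfl⟩
        · refine mul_pos ?_ ?_
          · simpa [affVal] using hp.1 i hi
          · simpa [affVal] using hgp.1 i hi
        · refine mul_pos_of_neg_of_neg ?_ ?_
          · simpa [affVal] using hp.2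
          · simpa [affVal] using hgp.2
      rw [affVal_affRefl_self, mul_neg, neg_pos] at hpos
      obtain ⟨k', hk', hw⟩ := IsWord.exchange hθ hκ hp hh i n hpos
      exact ih k' (by omega) hw hgp

end Affine

/-! ### The affine Weyl group acts simply transitively on alcoves -/

section AffineWeyl

variable {ι M N : Type*} [Fintype ι] [AddCommGroup M] [Module ℝ M] [AddCommGroup N] [Module ℝ N]
variable {P : RootPairing ι ℝ M N} [P.IsRootSystem] (b : P.Base) {θ : ι} {κ : ℝ}

theorem ofIdx_smul_ofIdx_smul (P : RootPairing ι ℝ M N) [P.IsRootSystem] (i : ι) (x : M) :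
    RootPairing.weylGroup.ofIdx P i • RootPairing.weylGroup.ofIdx P i • x = x := by
  rw [reflection_smul_eq, reflection_smul_eq, LinearMap.map_sub₂, LinearMap.map_smul₂,
    stdForm_corootVec_root_self, smul_eq_mul]
  module

theorem ofIdx_smul_corootVec (P : RootPairing ι ℝ M N) [P.IsRootSystem] (i j : ι) :
    RootPairing.weylGroup.ofIdx P i • corootVec P j = corootVec P (P.reflectionPerm i j) := by
  rw [weylGroup_smul_corootVec]
  congr 1

variable {b}

theorem IsWord.comp {k l : ℕ} {g h : M → M} (hg : IsWord b θ κ k g) (hh : IsWord b θ κ l h) :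
    ∃ n, IsWord b θ κ n (g ∘ h) := by
  induction hg with
  | nil => exact ⟨l, hh⟩
  | cons hi _ ih =>
    obtain ⟨n, hn⟩ := ih
    exact ⟨n + 1, .cons hi hn⟩

/-- Every root is reached from simple ones by simple reflections, and the reflection in a reflected
root is a conjugate. -/
theorem exists_isWord_ofIdx [P.IsCrystallographic] [P.IsReduced] (i : ι) :
    ∃ k, IsWord b θ κ k (fun x => RootPairing.weylGroup.ofIdx P i • x) := by
  refine b.induction_reflect i
    (p := fun i => ∃ k, IsWord b θ κ k (fun x => RootPairing.weylGroup.ofIdx P i • x))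
    (fun i hi => ?_) (fun i hi => ⟨1, ?_⟩) fun i j hi hj => ?_
  · have : (fun x => RootPairing.weylGroup.ofIdx P (P.reflectionPerm i i) • x) =
        fun x : M => RootPairing.weylGroup.ofIdx P i • x := by
      funext x
      have h := corootVec_reflectionPerm P i i
      rw [P.pairing_same] at h
      rw [reflection_smul_eq, reflection_smul_eq, root_reflectionPerm_same, h, map_neg]
      module
    rwa [this]
  · have : (fun x : M => RootPairing.weylGroup.ofIdx P i • x) = affRefl P κ i 0 ∘ id := by
      funext x
      simp [affRefl_eq, -RootPairing.weylGroup.ofIdx_smul]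
    rw [this]
    exact .cons (Or.inl ⟨hi, rfl⟩) .nil
  · obtain ⟨k, hk⟩ := hi
    have hs : (fun x : M => RootPairing.weylGroup.ofIdx P j • x) = affRefl P κ j 0 ∘ id := by
      funext x
      simp [affRefl_eq, -RootPairing.weylGroup.ofIdx_smul]
    have hj1 : IsWord b θ κ 1 (fun x : M => RootPairing.weylGroup.ofIdx P j • x) := by
      rw [hs]; exact .cons (Or.inl ⟨hj, rfl⟩) .nil
    have : (fun x => RootPairing.weylGroup.ofIdx P (P.reflectionPerm j i) • x) =
        (fun x : M => RootPairing.weylGroup.ofIdx P j • x) ∘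
        (fun x : M => RootPairing.weylGroup.ofIdx P i • x) ∘
        fun x : M => RootPairing.weylGroup.ofIdx P j • x := by
      funext x
      simp only [Function.comp_apply]
      rw [reflection_smul_eq P i, smul_sub, ofIdx_smul_ofIdx_smul, smul_comm,
        ofIdx_smul_corootVec, reflection_smul_eq P (P.reflectionPerm j i), root_reflectionPerm_eq,
        ← reflection_smul_eq P j, ← stdForm_smul_smul P (RootPairing.weylGroup.ofIdx P j) x,
        ofIdx_smul_ofIdx_smul]
    rw [this]
    obtain ⟨n, hn⟩ := hk.comp hj1
    exact hj1.comp hn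

theorem exists_isWord_smul [P.IsCrystallographic] [P.IsReduced] (w : P.weylGroup) :
    ∃ k, IsWord b θ κ k (fun x => w • x) := by
  obtain ⟨w, hw⟩ := w
  induction hw using RootPairing.weylGroup.induction with
  | mem i => exact exists_isWord_ofIdx i
  | one => exact ⟨0, by convert IsWord.nil (b := b) (θ := θ) (κ := κ) using 2; simp⟩
  | mul x y hx hy h1 h2 =>
    obtain ⟨k, hk⟩ := h1
    obtain ⟨l, hl⟩ := h2
    exact hk.comp hl

/-- Composing the reflections in the two parallel hyperplanes of θ gives the translation by κθ; its
Weyl conjugates are the translations by κw(θ), and the orbit of θ generates the coroot lattice. -/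
theorem exists_isWord_add [P.IsCrystallographic] [P.IsReduced] [P.IsIrreducible]
    (hθ : IsHighestRoot b θ) {v : M} (hv : v ∈ corootLattice b) :
    ∃ k, IsWord b θ κ k (fun x => x + κ • v) := by
  -- Both signs are put into the carrier, so that closure under negation needs no inverse of a word.
  let G : AddSubgroup M :=
    { carrier := {v | (∃ k, IsWord b θ κ k (fun x => x + κ • v)) ∧
        ∃ k, IsWord b θ κ k (fun x => x + κ • -v)}
      zero_mem' := ⟨⟨0, by convert IsWord.nil (b := b) (θ := θ) (κ := κ) using 2; simp⟩,
        ⟨0, by convert IsWord.nil (b := b) (θ := θ) (κ := κ) using 2; simp⟩⟩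
      neg_mem' := fun {v} h => ⟨h.2, by rw [neg_neg]; exact h.1⟩
      add_mem' := fun {u v} hu hv => by
        obtain ⟨⟨k, hk⟩, ⟨k', hk'⟩⟩ := hu
        obtain ⟨⟨l, hl⟩, ⟨l', hl'⟩⟩ := hv
        obtain ⟨n, hn⟩ := hk.comp hl
        obtain ⟨n', hn'⟩ := hk'.comp hl'
        refine ⟨⟨n, ?_⟩, ⟨n', ?_⟩⟩
        · convert hn using 2
          simp only [Function.comp_apply]; module
        · convert hn' using 2
          simp only [Function.comp_apply]; module }
  have hlong := normSq_highestRoot b hθ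
  have hcor := corootVec_eq_root hlong
  have hθw : IsWord b θ κ 1 (affRefl P κ θ 1 ∘ id) := .cons (Or.inr ⟨rfl, rfl⟩) .nil
  have hself : RootPairing.weylGroup.ofIdx P θ • P.root θ = -P.root θ := by
    rw [reflection_smul_eq, hcor, show stdForm P (P.root θ) (P.root θ) = 2 from hlong]
    module
  have hG : ∀ w : P.weylGroup, w • P.root θ ∈ G := by
    intro w
    obtain ⟨k, hk⟩ := exists_isWord_smul (b := b) (θ := θ) (κ := κ) w
    obtain ⟨l, hl⟩ := exists_isWord_smul (b := b) (θ := θ) (κ := κ) w⁻¹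
    obtain ⟨s, hs⟩ := exists_isWord_ofIdx (b := b) (θ := θ) (κ := κ) θ
    obtain ⟨n, hn⟩ := (hθw.comp hs)
    obtain ⟨n', hn'⟩ := (hs.comp hθw)
    obtain ⟨m, hm⟩ := hn.comp hl
    obtain ⟨m', hm'⟩ := hn'.comp hl
    obtain ⟨r, hr⟩ := hk.comp hm
    obtain ⟨r', hr'⟩ := hk.comp hm'
    refine ⟨⟨r, ?_⟩, ⟨r', ?_⟩⟩
    · convert hr using 2 with x
      simp only [Function.comp_apply, id]
      rw [affRefl_eq, ofIdx_smul_ofIdx_smul, smul_add, smul_inv_smul, hcor]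
      simp [smul_comm w]
    · convert hr' using 2 with x
      simp only [Function.comp_apply, id]
      rw [affRefl_eq, smul_add, ofIdx_smul_ofIdx_smul, smul_add, smul_inv_smul, hcor,
        smul_comm _ ((1 : ℤ) * κ : ℝ), hself]
      simp [smul_comm w]
  have hY : v ∈ G := by
    induction hv using Submodule.span_induction with
    | mem y hy => obtain ⟨i, rfl⟩ := hy; exact corootVec_mem_of_orbit hlong G hG i
    | zero => exact zero_mem _
    | add y z _ _ h1 h2 => exact add_mem h1 h2
    | smul a y _ h => exact zsmul_mem h a
  exact hY.1

/-- Simple transitivity of the affine Weyl group on the alcoves. -/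
theorem smul_add_eq_id [P.IsCrystallographic] [P.IsReduced] [P.IsIrreducible]
    (hθ : IsHighestRoot b θ) (hκ : 0 < κ) {p : M} (hp : p ∈ openAlcove b θ κ) (w : P.weylGroup)
    {v : M} (hv : v ∈ corootLattice b) (h : w • p + κ • v ∈ openAlcove b θ κ) :
    (∀ x : M, w • x = x) ∧ v = 0 := by
  obtain ⟨k, hk⟩ := exists_isWord_smul (b := b) (θ := θ) (κ := κ) w
  obtain ⟨l, hl⟩ := exists_isWord_add (κ := κ) hθ hv
  obtain ⟨n, hn⟩ := hl.comp hk
  have h1 := hn.eq_id hθ hκ hp h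
  have h2 : κ • v = 0 := by
    have := congrFun h1 0
    simpa using this
  have h3 : v = 0 := (smul_eq_zero.1 h2).resolve_left hκ.ne'
  refine ⟨fun x => ?_, h3⟩
  have := congrFun h1 x
  simpa [h3] using this

/-- Summability forces the sublevel sets of F to be finite. Combined with Gaussian summability, this
yields a nearest point of an affine Weyl orbit without any compactness argument. -/
theorem exists_isMin_of_summable_exp {A : Type*} [Nonempty A] (F : A → ℝ)
    (hF : Summable fun a => Real.exp (-F a)) : ∃ a, ∀ a', F a ≤ F a' := by
  have a₀ := Classical.arbitrary A
  have hfin : {a | F a ≤ F a₀}.Finite := by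
    have h1 := hF.tendsto_cofinite_zero.eventually (gt_mem_nhds (Real.exp_pos (-F a₀)))
    refine (Filter.eventually_cofinite.1 h1).subset fun a ha => ?_
    simp only [not_lt]
    exact Real.exp_le_exp.2 (neg_le_neg ha)
  obtain ⟨a, ha, hmin⟩ := hfin.toFinset.exists_min_image F ⟨a₀, by simp⟩
  refine ⟨a, fun a' => ?_⟩
  rcases le_or_gt (F a') (F a₀) with h | h
  · exact hmin a' (by simpa using h)
  · exact (by simpa using ha : F a ≤ F a₀).trans h.le

theorem exists_isMin_normSq [Nonempty ι] (hκ : 0 < κ) (x p : M) :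
    ∃ (w : P.weylGroup) (n : b.support → ℤ), ∀ w' : P.weylGroup, ∀ n' : b.support → ℤ,
      normSq P (w • x + κ • latVec (corootBasis b) n - p) ≤
        normSq P (w' • x + κ • latVec (corootBasis b) n' - p) := by
  classical
  have : Finite P.weylGroup := finite_weylGroup
  have h1 : ∀ w : P.weylGroup, ∃ n : b.support → ℤ, ∀ n' : b.support → ℤ,
      normSq P (w • x + κ • latVec (corootBasis b) n - p) ≤
        normSq P (w • x + κ • latVec (corootBasis b) n' - p) := by
    intro w
    refine exists_isMin_of_summable_exp _ ?_
    have h := summable_norm_cexp_latVec (stdForm_symm P) (stdForm_pos P) (corootBasis b)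
      (s := ((κ ^ 2 : ℝ) : ℂ)) (by rw [Complex.ofReal_re]; positivity) (κ⁻¹ • (w • x - p))
    refine h.congr fun n => ?_
    rw [Complex.norm_exp, ← Complex.ofReal_neg, ← Complex.ofReal_mul, Complex.ofReal_re]
    congr 1
    have : w • x + κ • latVec (corootBasis b) n - p =
        κ • (latVec (corootBasis b) n + κ⁻¹ • (w • x - p)) := by
      rw [smul_add, smul_inv_smul₀ hκ.ne']; abel
    rw [this, normSq, map_smul, LinearMap.map_smul₂, smul_eq_mul, smul_eq_mul]
    ring
  choose n hn using h1
  obtain ⟨w, hw⟩ := Finite.exists_min fun w : P.weylGroup =>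
    normSq P (w • x + κ • latVec (corootBasis b) (n w) - p)
  exact ⟨w, n w, fun w' n' => (hw w').trans (hn w' n')⟩

/-- Reflecting x brings it strictly closer to p exactly when the hyperplane separates x from p. -/
theorem normSq_affRefl_sub (P : RootPairing ι ℝ M N) [P.IsRootSystem] (κ : ℝ) (i : ι) (n : ℤ)
    (x p : M) : normSq P (affRefl P κ i n x - p) = normSq P (x - p) +
      affVal P κ i n x * affVal P κ i n p * (4 / normSq P (P.root i)) := by
  have h0 := (normSq_root_pos P i).ne'
  have hc : ∀ y, stdForm P (corootVec P i) y = 2 / normSq P (P.root i) * stdForm P y (P.root i) :=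
    fun y => by rw [corootVec, LinearMap.map_smul₂, smul_eq_mul, stdForm_symm]
  have hc' : ∀ y, stdForm P y (corootVec P i) = 2 / normSq P (P.root i) * stdForm P y (P.root i) :=
    fun y => by rw [stdForm_symm, hc]
  have h2 := stdForm_corootVec_root_self P i
  simp only [normSq, affRefl, map_sub, LinearMap.map_sub₂, map_smul, LinearMap.map_smul₂,
    smul_eq_mul, LinearMap.sub_apply, LinearMap.smul_apply]
  rw [hc' (corootVec P i), h2, hc x, hc p, hc' x, hc' p]
  simp only [normSq, affVal] at *
  field_simp
  ring

/-- Every point can be moved into the closed fundamental alcove by the affine Weyl group. -/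
theorem exists_smul_add_mem_closedAlcove [P.IsCrystallographic] [P.IsReduced] [P.IsIrreducible]
    (hκ : 0 < κ) (θ : ι) (x : M) :
    ∃ (w : P.weylGroup) (n : b.support → ℤ),
      (∀ i ∈ b.support, 0 ≤ stdForm P (w • x + κ • latVec (corootBasis b) n) (P.root i)) ∧
      stdForm P (w • x + κ • latVec (corootBasis b) n) (P.root θ) ≤ κ := by
  have : Nonempty ι := ⟨θ⟩
  obtain ⟨p, hp⟩ := openAlcove_nonempty b θ hκ
  obtain ⟨w, n, hmin⟩ := exists_isMin_normSq (b := b) hκ x p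
  set q := w • x + κ • latVec (corootBasis b) n with hq
  -- The orbit point q nearest to p cannot be improved by a reflection, so no hyperplane strictly
  -- separates it from p.
  have key : ∀ i m, 0 ≤ affVal P κ i m q * affVal P κ i m p := by
    intro i m
    obtain ⟨r, hr⟩ := (mem_corootLattice_iff_latVec b).1 (add_mem
      (smul_mem_corootLattice b (RootPairing.weylGroup.ofIdx P i)
        ((mem_corootLattice_iff_latVec b).2 ⟨n, rfl⟩))
      (Submodule.smul_mem _ m (corootVec_mem b i)))
    have h1 := hmin (RootPairing.weylGroup.ofIdx P i * w) r
    have h2 : (RootPairing.weylGroup.ofIdx P i * w) • x + κ • latVec (corootBasis b) r =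
        affRefl P κ i m q := by
      rw [hr, affRefl_eq, hq, smul_add κ, smul_add (RootPairing.weylGroup.ofIdx P i), mul_smul,
        smul_comm (RootPairing.weylGroup.ofIdx P i) κ (latVec _ n), add_assoc,
        ← Int.cast_smul_eq_zsmul ℝ m, smul_smul κ, mul_comm κ (m : ℝ)]
    rw [h2, normSq_affRefl_sub] at h1
    have h3 : 0 ≤ affVal P κ i m q * affVal P κ i m p * (4 / normSq P (P.root i)) := by linarith
    exact nonneg_of_mul_nonneg_left h3 (div_pos four_pos (normSq_root_pos P i))
  refine ⟨w, n, fun i hi => ?_, ?_⟩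
  · have h := key i 0
    have h1 : 0 < affVal P κ i 0 p := by simpa [affVal] using hp.1 i hi
    have h2 := nonneg_of_mul_nonneg_left h h1
    rwa [affVal, Int.cast_zero, zero_mul, sub_zero] at h2
  · have h := key θ 1
    have h1 : affVal P κ θ 1 p < 0 := by simpa [affVal] using hp.2
    have h2 := nonpos_of_mul_nonneg_left h h1
    rw [affVal, Int.cast_one, one_mul] at h2
    linarith

end AffineWeyl

/-! ### Alcove sums as means over the weight lattice -/

section Unfold

variable {ι M N : Type*} [Fintype ι] [AddCommGroup M] [Module ℝ M] [AddCommGroup N] [Module ℝ N]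
variable {P : RootPairing ι ℝ M N} [P.IsRootSystem] (b : P.Base) {θ : ι} {κ : ℕ}

theorem eq_one_of_smul_eq_self (w : P.weylGroup) (h : ∀ x : M, w • x = x) : w = 1 := by
  refine Subtype.ext (RootPairing.Equiv.weightHom_injective P ?_)
  ext x
  exact h x

variable [P.IsCrystallographic] [P.IsReduced] [P.IsIrreducible]

theorem summable_norm_of_finite_prod {A C : Type*} [Finite A] {f : A × C → ℂ}
    (h : ∀ a, Summable fun c => ‖f (a, c)‖) : Summable fun p => ‖f p‖ :=
  (summable_prod_of_nonneg fun _ => norm_nonneg _).2 ⟨h, Summable.of_finite⟩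

theorem cpow_half_mul_cpow_half {ε κ : ℝ} (hε : 0 < ε) (hκ : 0 < κ) (l : ℕ) :
    (ε : ℂ) ^ (l / 2 : ℂ) * ((1 / (ε * κ ^ 2) : ℝ) : ℂ) ^ (l / 2 : ℂ) = 1 / (κ : ℂ) ^ l := by
  rw [← Complex.mul_cpow_ofReal_nonneg hε.le (by positivity), ← Complex.ofReal_mul,
    show ε * (1 / (ε * κ ^ 2)) = (κ ^ 2)⁻¹ by field_simp,
    show (l / 2 : ℂ) = ((l / 2 : ℝ) : ℂ) by push_cast; rfl,
    ← Complex.ofReal_cpow (by positivity), Real.inv_rpow (by positivity), ← Real.rpow_natCast κ 2,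
    ← Real.rpow_mul hκ.le, show ((2 : ℕ) : ℝ) * (l / 2) = l by push_cast; ring, Real.rpow_natCast]
  push_cast
  rw [one_div]

variable (θ κ) in
/-- The weights in the open alcove. -/
abbrev OpenWeights : Type _ := {c : M // c ∈ weightLattice b ∧ c ∈ openAlcove b θ (κ : ℝ)}

omit [P.IsReduced] [P.IsIrreducible] [P.IsCrystallographic] in
theorem finite_openWeights (hθ : IsHighestRoot b θ) : Finite (OpenWeights b θ κ) := by
  have := (finite_alcoveWeights b hθ κ).to_subtype
  exact Finite.of_injective
    (fun c : OpenWeights b θ κ => (⟨c.1, c.2.1, fun i hi => (c.2.2.1 i hi).le, c.2.2.2.le⟩ :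
      alcoveWeights b θ κ)) fun c d h => Subtype.ext (Subtype.mk.inj h)

theorem exists_unfold : ∃ Φ : OpenWeights b θ κ × P.weylGroup × (b.support → ℤ) → b.support → ℤ,
    ∀ c w n, latVec (fundWeight b) (Φ (c, w, n)) =
      w • c.1 + (κ : ℝ) • latVec (corootBasis b) n := by
  have h : ∀ q : OpenWeights b θ κ × P.weylGroup × (b.support → ℤ), ∃ k,
      latVec (fundWeight b) k = q.2.1 • q.1.1 + (κ : ℝ) • latVec (corootBasis b) q.2.2 := by
    rintro ⟨c, w, n⟩
    refine (mem_weightLattice_iff_latVec b).1 (add_mem (smul_mem_weightLattice b w c.2.1) ?_)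
    rw [Nat.cast_smul_eq_nsmul]
    exact nsmul_mem (corootLattice_le b ((mem_corootLattice_iff_latVec b).2 ⟨n, rfl⟩)) κ
  choose Φ hΦ using h
  exact ⟨Φ, fun c w n => hΦ (c, w, n)⟩

/-- Two representations of one weight differ by an affine Weyl element taking one open alcove point
to another, hence by the identity. -/
theorem unfold_injective (hθ : IsHighestRoot b θ) (hκ : 0 < κ)
    {Φ : OpenWeights b θ κ × P.weylGroup × (b.support → ℤ) → b.support → ℤ}
    (hΦ : ∀ c w n, latVec (fundWeight b) (Φ (c, w, n)) =
      w • c.1 + (κ : ℝ) • latVec (corootBasis b) n) : Function.Injective Φ := by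
  rintro ⟨c, w, n⟩ ⟨c', w', n'⟩ h
  have hκ' : (0 : ℝ) < κ := by exact_mod_cast hκ
  have h1 := (hΦ c w n).symm.trans ((congrArg _ h).trans (hΦ c' w' n'))
  have hv : ∀ n, latVec (corootBasis b) n ∈ corootLattice b := fun n =>
    (mem_corootLattice_iff_latVec b).2 ⟨n, rfl⟩
  have h2 : (w'⁻¹ * w) • c.1 + (κ : ℝ) • (w'⁻¹ • (latVec (corootBasis b) n -
      latVec (corootBasis b) n')) = c'.1 := by
    rw [mul_smul, ← smul_comm w'⁻¹ (κ : ℝ), ← smul_add, inv_smul_eq_iff, smul_sub, ← add_sub_assoc, h1,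
      add_sub_cancel_right]
  obtain ⟨h3, h4⟩ := smul_add_eq_id hθ hκ' c.2.2 (w'⁻¹ * w)
    (smul_mem_corootLattice b w'⁻¹ (sub_mem (hv n) (hv n'))) (by rw [h2]; exact c'.2.2)
  have h5 : w = w' := (inv_mul_eq_one.1 (eq_one_of_smul_eq_self _ h3)).symm
  rw [smul_eq_zero_iff_eq, sub_eq_zero] at h4
  have h6 : c = c' := by
    refine Subtype.ext ?_
    rw [← h2, h3, h4, sub_self, smul_zero, smul_zero, add_zero]
  rw [h6, h5, latVec_injective _ h4]

/-- Move the weight into the closed alcove. Invariance keeps f nonzero there, which rules out the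
walls, and the move is then inverted. -/
theorem exists_unfold_eq (hκ : 0 < κ)
    {Φ : OpenWeights b θ κ × P.weylGroup × (b.support → ℤ) → b.support → ℤ}
    (hΦ : ∀ c w n, latVec (fundWeight b) (Φ (c, w, n)) =
      w • c.1 + (κ : ℝ) • latVec (corootBasis b) n)
    {f : M → ℂ} (hfW : ∀ x ∈ weightLattice b, ∀ w : P.weylGroup, f (w • x) = f x)
    (hfY : ∀ x ∈ weightLattice b, ∀ v ∈ corootLattice b, f (x + (κ : ℝ) • v) = f x)
    (hf0 : ∀ x ∈ weightLattice b, f x ≠ 0 →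
      (∀ i ∈ b.support, stdForm P x (P.root i) ≠ 0) ∧ stdForm P x (P.root θ) ≠ κ)
    (k : b.support → ℤ) (hk : f (latVec (fundWeight b) k) ≠ 0) : k ∈ Set.range Φ := by
  have hκ' : (0 : ℝ) < κ := by exact_mod_cast hκ
  have hx : latVec (fundWeight b) k ∈ weightLattice b :=
    (mem_weightLattice_iff_latVec b).2 ⟨k, rfl⟩
  set x := latVec (fundWeight b) k with hxdef
  have hv : ∀ n, latVec (corootBasis b) n ∈ corootLattice b := fun n =>
    (mem_corootLattice_iff_latVec b).2 ⟨n, rfl⟩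
  obtain ⟨w, n, h1, h2⟩ := exists_smul_add_mem_closedAlcove (b := b) hκ' θ x
  have hcX : w • x + (κ : ℝ) • latVec (corootBasis b) n ∈ weightLattice b := by
    refine add_mem (smul_mem_weightLattice b w hx) ?_
    rw [Nat.cast_smul_eq_nsmul]
    exact nsmul_mem (corootLattice_le b (hv n)) κ
  have hfc : f (w • x + (κ : ℝ) • latVec (corootBasis b) n) ≠ 0 := by
    rwa [hfY _ (smul_mem_weightLattice b w hx) _ (hv n), hfW _ hx]
  obtain ⟨h3, h4⟩ := hf0 _ hcX hfc
  obtain ⟨n', hn'⟩ := (mem_corootLattice_iff_latVec b).1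
    (smul_mem_corootLattice b w⁻¹ (neg_mem (hv n)))
  have hcA : w • x + (κ : ℝ) • latVec (corootBasis b) n ∈ openAlcove b θ (κ : ℝ) :=
    ⟨fun i hi => lt_of_le_of_ne (h1 i hi) (h3 i hi).symm, lt_of_le_of_ne h2 h4⟩
  refine ⟨(⟨_, hcX, hcA⟩, w⁻¹, n'), latVec_injective (fundWeight b) ((hΦ _ _ _).trans ?_)⟩
  rw [hn', smul_add, inv_smul_smul, smul_neg, smul_neg, smul_comm]
  abel

/-- The mean value of an invariant function on the weight lattice, computed on the alcove. -/
theorem tendsto_unfold (hθ : IsHighestRoot b θ) (hκ : 0 < κ)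
    {f : M → ℂ} (hfW : ∀ x ∈ weightLattice b, ∀ w : P.weylGroup, f (w • x) = f x)
    (hfY : ∀ x ∈ weightLattice b, ∀ v ∈ corootLattice b, f (x + (κ : ℝ) • v) = f x)
    (hf0 : ∀ x ∈ weightLattice b, f x ≠ 0 →
      (∀ i ∈ b.support, stdForm P x (P.root i) ≠ 0) ∧ stdForm P x (P.root θ) ≠ κ) :
    Tendsto (fun ε : ℝ => (ε : ℂ) ^ (Fintype.card b.support / 2 : ℂ) *
        ∑' k : b.support → ℤ, f (latVec (fundWeight b) k) * Complex.exp (-(Real.pi * ε) *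
          (stdForm P (latVec (fundWeight b) k) (latVec (fundWeight b) k) : ℝ)))
      (𝓝[>] 0)
      (𝓝 ((Nat.card P.weylGroup : ℂ) / (((κ : ℝ) ^ Fintype.card b.support * volY b : ℝ) : ℂ) *
        ∑ᶠ c : alcoveWeights b θ κ, f c)) := by
  classical
  have hκ' : (0 : ℝ) < κ := by exact_mod_cast hκ
  have : Nonempty ι := ⟨θ⟩
  have : Finite P.weylGroup := finite_weylGroup
  have : Fintype P.weylGroup := Fintype.ofFinite _
  have : Finite (OpenWeights b θ κ) := finite_openWeights b hθ
  have : Fintype (OpenWeights b θ κ) := Fintype.ofFinite _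
  obtain ⟨Φ, hΦ⟩ := exists_unfold b (θ := θ) (κ := κ)
  have hinj := unfold_injective b hθ hκ hΦ
  have hef : ∀ i j, stdForm P (corootBasis b i) (fundWeight b j) = if i = j then 1 else 0 :=
    fun i j => by rw [stdForm_corootBasis_fundWeight]
  set l := Fintype.card b.support
  have hv : ∀ n, latVec (corootBasis b) n ∈ corootLattice b := fun n =>
    (mem_corootLattice_iff_latVec b).2 ⟨n, rfl⟩
  -- The damping exp(-πε|w(c) + κn|²) is a Gaussian on the coroot lattice with parameter 1/(εκ²) and
  -- shift w(c)/κ. By `tendsto_lattice_gauss` every pair (c, w) then has the same limiting density.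
  set G : ℝ → M → (b.support → ℤ) → ℂ := fun ε v n =>
    Complex.exp (-(Real.pi / ((1 / (ε * κ ^ 2) : ℝ) : ℂ)) *
      (stdForm P (latVec (corootBasis b) n + v) (latVec (corootBasis b) n + v) : ℝ)) with hG
  have hterm : ∀ ε : ℝ, ∀ c w n, f (latVec (fundWeight b) (Φ (c, w, n))) *
      Complex.exp (-(Real.pi * ε) * (stdForm P (latVec (fundWeight b) (Φ (c, w, n)))
        (latVec (fundWeight b) (Φ (c, w, n))) : ℝ)) =
      f c.1 * G ε ((κ : ℝ)⁻¹ • (w • c.1)) n := by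
    intro ε c w n
    rw [hΦ, hfY _ (smul_mem_weightLattice b w c.2.1) _ (hv n), hfW _ c.2.1, hG]
    congr 2
    have : w • c.1 + (κ : ℝ) • latVec (corootBasis b) n =
        (κ : ℝ) • (latVec (corootBasis b) n + (κ : ℝ)⁻¹ • (w • c.1)) := by
      rw [smul_add, smul_inv_smul₀ hκ'.ne', add_comm]
    rw [this, map_smul, LinearMap.map_smul₂, smul_eq_mul, smul_eq_mul]
    push_cast
    rw [one_div, div_inv_eq_mul]
    ring
  have hsummable : ∀ ε : ℝ, 0 < ε → ∀ v, Summable (G ε v) := by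
    intro ε hε v
    refine Summable.of_norm (summable_norm_cexp_latVec (stdForm_symm P) (stdForm_pos P)
      (corootBasis b) ?_ v)
    rw [← Complex.ofReal_div, Complex.ofReal_re]
    have := Real.pi_pos
    positivity
  have hsum : ∀ ε : ℝ, 0 < ε → ∑' k : b.support → ℤ, f (latVec (fundWeight b) k) *
        Complex.exp (-(Real.pi * ε) *
          (stdForm P (latVec (fundWeight b) k) (latVec (fundWeight b) k) : ℝ)) =
      ∑ c : OpenWeights b θ κ, ∑ w : P.weylGroup,
        f c.1 * ∑' n, G ε ((κ : ℝ)⁻¹ • (w • c.1)) n := by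
    intro ε hε
    have h1 : Function.support (fun k : b.support → ℤ => f (latVec (fundWeight b) k) *
        Complex.exp (-(Real.pi * ε) *
          (stdForm P (latVec (fundWeight b) k) (latVec (fundWeight b) k) : ℝ))) ⊆ Set.range Φ :=
      fun k hk => exists_unfold_eq b hκ hΦ hfW hfY hf0 k (left_ne_zero_of_mul hk)
    rw [← hinj.tsum_eq h1]
    have hcw : ∀ c w, HasSum (fun n => f (latVec (fundWeight b) (Φ (c, w, n))) *
        Complex.exp (-(Real.pi * ε) * (stdForm P (latVec (fundWeight b) (Φ (c, w, n)))
        (latVec (fundWeight b) (Φ (c, w, n))) : ℝ)))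
        (f c.1 * ∑' n, G ε ((κ : ℝ)⁻¹ • (w • c.1)) n) := by
      intro c w
      simp only [hterm]
      exact (hsummable ε hε _).hasSum.mul_left _
    have hs : Summable fun q : OpenWeights b θ κ × P.weylGroup × (b.support → ℤ) =>
        f (latVec (fundWeight b) (Φ q)) * Complex.exp (-(Real.pi * ε) *
          (stdForm P (latVec (fundWeight b) (Φ q)) (latVec (fundWeight b) (Φ q)) : ℝ)) :=
      Summable.of_norm (summable_norm_of_finite_prod fun c => summable_norm_of_finite_prod fun w =>
        (hcw c w).summable.norm)
    rw [hs.tsum_prod, tsum_fintype]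
    refine Finset.sum_congr rfl fun c _ => ?_
    rw [(hs.prod_factor c).tsum_prod, tsum_fintype]
    exact Finset.sum_congr rfl fun w _ => (hcw c w).tsum_eq
  have hlim : ∀ v : M, Tendsto (fun ε : ℝ => (ε : ℂ) ^ (l / 2 : ℂ) * ∑' n, G ε v n) (𝓝[>] 0)
      (𝓝 (1 / (((κ : ℝ) ^ l * volY b : ℝ) : ℂ))) := by
    intro v
    have hz : Tendsto (fun ε : ℝ => (((1 / (ε * κ ^ 2) : ℝ) : ℂ)).re) (𝓝[>] 0) atTop := by
      simp only [Complex.ofReal_re, one_div, mul_inv]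
      exact tendsto_inv_nhdsGT_zero.atTop_mul_const (by positivity)
    have h := (tendsto_lattice_gauss (stdForm_symm P) (stdForm_pos P) (corootBasis b)
      (fundWeight b) hef hz v).const_mul (1 / ((κ : ℂ) ^ l))
    refine (h.congr' ?_).trans_eq ?_
    · filter_upwards [self_mem_nhdsWithin] with ε hε
      have hε : 0 < ε := hε
      have hz0 : (((1 / (ε * κ ^ 2) : ℝ) : ℂ)) ^ (l / 2 : ℂ) ≠ 0 := by
        rw [Complex.cpow_ne_zero_iff]
        exact Or.inl (by exact_mod_cast (by positivity : (1 / (ε * (κ : ℝ) ^ 2) : ℝ) ≠ 0))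
      have h2 := cpow_half_mul_cpow_half hε hκ' l
      rw [Complex.ofReal_natCast] at h2
      rw [← h2, mul_assoc, mul_div_cancel₀ _ hz0]
    · congr 1
      rw [volY_eq, gramVol]
      push_cast
      rw [one_div, one_div, one_div, mul_inv]
      congr!
  have htot := tendsto_finsetSum (Finset.univ : Finset (OpenWeights b θ κ)) fun c _ =>
    tendsto_finsetSum (Finset.univ : Finset P.weylGroup) fun w _ =>
      (hlim ((κ : ℝ)⁻¹ • (w • c.1))).const_mul (f c.1)
  refine (htot.congr' ?_).trans_eq ?_
  · filter_upwards [self_mem_nhdsWithin] with ε hε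
    rw [hsum ε hε, Finset.mul_sum]
    refine Finset.sum_congr rfl fun c _ => ?_
    rw [Finset.mul_sum]
    exact Finset.sum_congr rfl fun w _ => by ring
  · congr 1
    simp only [Finset.sum_const, Finset.card_univ, nsmul_eq_mul, ← Finset.mul_sum,
      ← Finset.sum_mul]
    -- The closed alcove may replace the open one because f vanishes at weights on the walls.
    have hfs : ∑ᶠ c : alcoveWeights b θ κ, f c = ∑ c : OpenWeights b θ κ, f c.1 := by
      rw [← finsum_eq_sum_of_fintype]
      rw [finsum_set_coe_eq_finsum_mem (alcoveWeights b θ κ) (f := f)]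
      rw [show (∑ᶠ c : OpenWeights b θ κ, f c.1) = ∑ᶠ c ∈ {c : M | c ∈ weightLattice b ∧
        c ∈ openAlcove b θ (κ : ℝ)}, f c from finsum_set_coe_eq_finsum_mem _]
      refine finsum_mem_inter_support_eq f _ _ ?_
      ext c
      constructor
      · rintro ⟨⟨h1, h2, h3⟩, h4⟩
        obtain ⟨h5, h6⟩ := hf0 c h1 h4
        exact ⟨⟨h1, fun i hi => lt_of_le_of_ne (h2 i hi) (h5 i hi).symm, lt_of_le_of_ne h3 h6⟩, h4⟩
      · rintro ⟨⟨h1, h2, h3⟩, h4⟩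
        exact ⟨⟨h1, fun i hi => (h2 i hi).le, h3.le⟩, h4⟩
    rw [hfs, Nat.card_eq_fintype_card]
    ring

end Unfold

/-! ### Classes of the coroot lattice modulo a -/

section Quotient

variable {ι M N : Type*} [Fintype ι] [AddCommGroup M] [Module ℝ M] [AddCommGroup N] [Module ℝ N]
variable {P : RootPairing ι ℝ M N} [P.IsRootSystem] (b : P.Base)

theorem linearIndependent_int_corootVec :
    LinearIndependent ℤ fun i : b.support => corootVec P i := by
  have := (corootBasis b).linearIndependent.restrict_scalars' ℤ
  simpa only [← corootBasis_apply] using this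

theorem finrank_corootLattice : Module.finrank ℤ (corootLattice b) = Fintype.card b.support :=
  finrank_span_eq_card (linearIndependent_int_corootVec b)

theorem natCard_quotient (a : ℤ) :
    Nat.card (corootLattice b ⧸ mulCorootLattice b a) = a.natAbs ^ Fintype.card b.support := by
  have : Module.Finite ℤ (corootLattice b) :=
    Module.Finite.span_of_finite ℤ (Set.finite_range _)
  have : Module.Free ℤ (corootLattice b) :=
    Module.Free.of_basis (Module.Basis.span (linearIndependent_int_corootVec b))
  rw [← finrank_corootLattice b, ← AddSubgroup.index_range_nsmul (corootLattice b) a.natAbs,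
    AddSubgroup.index_eq_card]
  have h : (mulCorootLattice b a).toAddSubgroup =
      (nsmulAddMonoidHom (α := corootLattice b) a.natAbs).range := by
    ext v
    simp only [mulCorootLattice, Submodule.mem_toAddSubgroup, LinearMap.mem_range,
      LinearMap.lsmul_apply, AddMonoidHom.mem_range, nsmulAddMonoidHom_apply]
    rcases Int.natAbs_eq a with h | h
    · rw [h, Int.natAbs_natCast]
      simp only [natCast_zsmul]
    · constructor
      · rintro ⟨u, rfl⟩
        exact ⟨-u, by rw [h, Int.natAbs_neg, Int.natAbs_natCast, neg_smul, natCast_zsmul, smul_neg]⟩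
      · rintro ⟨u, rfl⟩
        refine ⟨-u, ?_⟩
        conv_lhs => rw [h]
        rw [neg_smul, natCast_zsmul, smul_neg, neg_neg]
  rw [← h]
  rfl

/-- Supplies the equivalence `E` needed for Gauss reciprocity, for an arbitrary system of
representatives. -/
theorem exists_section_equiv {a : ℤ} (ha : a ≠ 0)
    (s : (corootLattice b ⧸ mulCorootLattice b a) → corootLattice b)
    (hs : ∀ q, Submodule.Quotient.mk (s q) = q) :
    ∃ E : (corootLattice b ⧸ mulCorootLattice b a) × (b.support → ℤ) ≃ (b.support → ℤ),
      ∀ q n, latVec (corootBasis b) (E (q, n)) =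
        (s q : M) + (a : ℝ) • latVec (corootBasis b) n := by
  have hmem : ∀ q : (corootLattice b ⧸ mulCorootLattice b a) × (b.support → ℤ),
      ∃ k, latVec (corootBasis b) k = (s q.1 : M) + (a : ℝ) • latVec (corootBasis b) q.2 := by
    intro q
    refine (mem_corootLattice_iff_latVec b).1 (add_mem (s q.1).2 ?_)
    rw [Int.cast_smul_eq_zsmul]
    exact Submodule.smul_mem _ a ((mem_corootLattice_iff_latVec b).2 ⟨q.2, rfl⟩)
  choose F hF using hmem
  have haR : (a : ℝ) ≠ 0 := by exact_mod_cast ha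
  refine ⟨Equiv.ofBijective F ⟨?_, ?_⟩, fun q n => hF (q, n)⟩
  · rintro ⟨q, n⟩ ⟨q', n'⟩ h
    have h1 := (hF (q, n)).symm.trans ((congrArg _ h).trans (hF (q', n')))
    simp only at h1
    have h2 : q = q' := by
      rw [← hs q, ← hs q', Submodule.Quotient.eq]
      refine ⟨⟨latVec (corootBasis b) (n' - n), (mem_corootLattice_iff_latVec b).2 ⟨_, rfl⟩⟩, ?_⟩
      refine Subtype.ext ?_
      change a • latVec (corootBasis b) (n' - n) = (s q : M) - s q'
      rw [sub_eq_add_neg n', latVec_add, latVec_neg, ← Int.cast_smul_eq_zsmul ℝ a, smul_add,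
        smul_neg, ← sub_eq_add_neg, sub_eq_sub_iff_add_eq_add, add_comm, ← h1, add_comm]
    subst h2
    have h3 := latVec_injective _ (smul_right_injective M haR (add_left_cancel h1))
    rw [h3]
  · intro k
    set v : corootLattice b :=
      ⟨latVec (corootBasis b) k, (mem_corootLattice_iff_latVec b).2 ⟨k, rfl⟩⟩
    have h1 : v - s (Submodule.Quotient.mk v) ∈ mulCorootLattice b a := by
      rw [← Submodule.Quotient.eq, hs]
    obtain ⟨u, hu⟩ := h1
    obtain ⟨n, hn⟩ := (mem_corootLattice_iff_latVec b).1 u.2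
    refine ⟨(Submodule.Quotient.mk v, n), latVec_injective (corootBasis b) ?_⟩
    rw [hF, hn, Int.cast_smul_eq_zsmul]
    have h2 : a • (u : M) = (v : M) - s (Submodule.Quotient.mk v) := congrArg Subtype.val hu
    rw [h2, add_sub_cancel]

end Quotient

/-! ### Symmetries of the entries of Ξ and Θ -/

section Entries

variable {ι M N : Type*} [Fintype ι] [AddCommGroup M] [Module ℝ M] [AddCommGroup N] [Module ℝ N]
variable {P : RootPairing ι ℝ M N} [P.IsRootSystem]

variable (P) in
/-- The alternating sum over the Weyl group in the entries of `𝓡(Ξ)`. -/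
noncomputable def weylSum (κ : ℕ) (x y : M) : ℂ :=
  ∑ᶠ w : P.weylGroup, (weylDet P w : ℂ) *
    Complex.exp (-(2 * Real.pi * Complex.I / κ) * (stdForm P (w • x) y : ℂ))

theorem weylSum_comm (κ : ℕ) (x y : M) : weylSum P κ x y = weylSum P κ y x := by
  rw [weylSum, ← finsum_comp_equiv (Equiv.inv P.weylGroup)]
  refine finsum_congr fun w => ?_
  rw [Equiv.inv_apply, weylDet_inv, stdForm_smul_left, inv_inv, stdForm_symm]

theorem weylSum_smul (κ : ℕ) (v : P.weylGroup) (x y : M) :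
    weylSum P κ (v • x) y = weylDet P v * weylSum P κ x y := by
  have : Finite P.weylGroup := finite_weylGroup
  have := Fintype.ofFinite P.weylGroup
  rw [weylSum, weylSum, finsum_eq_sum_of_fintype, finsum_eq_sum_of_fintype, Finset.mul_sum,
    ← Equiv.sum_comp (Equiv.mulRight v⁻¹)]
  refine Finset.sum_congr rfl fun w _ => ?_
  rw [Equiv.coe_mulRight, weylDet_mul, weylDet_inv, smul_smul, inv_mul_cancel_right]
  push_cast
  ring

theorem exp_two_pi_mul_div_eq_one {κ : ℕ} (hκ : 0 < κ) (n : ℤ) :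
    Complex.exp (-(2 * Real.pi * Complex.I / κ) * (κ * n)) = 1 := by
  have : (κ : ℂ) ≠ 0 := by exact_mod_cast hκ.ne'
  rw [Complex.exp_eq_one_iff]
  exact ⟨-n, by push_cast; field_simp⟩

variable (b : P.Base) {θ : ι} {κ : ℕ}

variable [P.IsCrystallographic] [P.IsReduced]

theorem weylSum_add (hκ : 0 < κ) {x y v : M} (hy : y ∈ weightLattice b)
    (hv : v ∈ corootLattice b) : weylSum P κ (x + (κ : ℝ) • v) y = weylSum P κ x y := by
  refine finsum_congr fun w => ?_
  obtain ⟨n, hn⟩ := exists_int_stdForm b hy (smul_mem_corootLattice b w hv)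
  rw [smul_add, smul_comm, LinearMap.map_add₂, LinearMap.map_smul₂, stdForm_symm P (w • v), hn]
  push_cast
  rw [smul_eq_mul, mul_add, Complex.exp_add]
  push_cast
  rw [exp_two_pi_mul_div_eq_one hκ, mul_one]

omit [P.IsCrystallographic] [P.IsReduced] in
theorem weylSum_eq_zero_of_wall {x y : M} {i : ι} (hx : stdForm P x (P.root i) = 0) :
    weylSum P κ x y = 0 := by
  have h := weylSum_smul κ (RootPairing.weylGroup.ofIdx P i) x y
  rw [reflection_smul_eq, hx, zero_smul, sub_zero, weylDet_ofIdx] at h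
  push_cast at h
  linear_combination h / 2

/-- On this wall the linear reflection in θ is translation by -κ times the coroot of θ, so
antisymmetry and periodicity conflict unless the value is 0. -/
theorem weylSum_eq_zero_of_upper_wall (hκ : 0 < κ) {x y : M}
    (hy : y ∈ weightLattice b) (hx : stdForm P x (P.root θ) = κ) : weylSum P κ x y = 0 := by
  have h := weylSum_smul κ (RootPairing.weylGroup.ofIdx P θ) x y
  rw [reflection_smul_eq, hx, sub_eq_add_neg, ← smul_neg,
    weylSum_add b hκ hy (neg_mem (corootVec_mem b θ)), weylDet_ofIdx] at h
  push_cast at h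
  linear_combination h / 2

theorem normSq_add_smul [P.IsIrreducible] {x v : M} (hx : x ∈ weightLattice b)
    (hv : v ∈ corootLattice b) (κ : ℕ) :
    ∃ n : ℤ, normSq P (x + (κ : ℝ) • v) = normSq P x + 2 * κ * n := by
  obtain ⟨n, hn⟩ := exists_int_stdForm b hx hv
  obtain ⟨m, hm⟩ := exists_int_normSq b hv fun y hy => corootLattice_le b hy
  refine ⟨n + κ * m, ?_⟩
  simp only [normSq] at *
  simp only [map_add, LinearMap.map_add₂, map_smul, LinearMap.map_smul₂, LinearMap.smul_apply,
    LinearMap.add_apply, smul_eq_mul]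
  rw [stdForm_symm P v x, hn, hm]
  push_cast
  ring

variable (θ) in
theorem thetaEntry_add [P.IsIrreducible] (hκ : 0 < κ) {x v : M} (hx : x ∈ weightLattice b)
    (hv : v ∈ corootLattice b) :
    thetaEntry b θ κ (x + (κ : ℝ) • v) (x + (κ : ℝ) • v) = thetaEntry b θ κ x x := by
  obtain ⟨n, hn⟩ := normSq_add_smul b hx hv κ
  have hκC : (κ : ℂ) ≠ 0 := by exact_mod_cast hκ.ne'
  rw [thetaEntry, thetaEntry, if_pos rfl, if_pos rfl, hn, Complex.exp_eq_exp_iff_exists_int]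
  refine ⟨n, ?_⟩
  push_cast
  field_simp
  ring

omit [P.IsCrystallographic] [P.IsReduced] in
theorem thetaEntry_smul (w : P.weylGroup) (x : M) :
    thetaEntry b θ κ (w • x) (w • x) = thetaEntry b θ κ x x := by
  have h : normSq P (w • x) = normSq P x := stdForm_smul_smul P w x x
  rw [thetaEntry, thetaEntry, if_pos rfl, if_pos rfl, h]

omit [P.IsCrystallographic] [P.IsReduced] in
-- Since vol(X) vol(Y^∨) = 1, the square root in the normalisation is 1/vol(Y^∨).
theorem xiEntry_eq [Nonempty ι] (κ : ℕ) (x y : M) :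
    xiEntry b κ x y = Complex.I ^ numPos b /
      (((κ : ℝ) ^ ((Fintype.card b.support : ℝ) / 2) * volY b : ℝ) : ℂ) * weylSum P κ x y := by
  have h := volX_mul_volY b
  have hY := volY_pos b
  have hX : volX b = (volY b)⁻¹ := eq_inv_of_mul_eq_one_left h
  have h1 : |volX b / volY b| ^ (1 / 2 : ℝ) = (volY b)⁻¹ := by
    rw [hX, abs_of_pos (by positivity), ← Real.sqrt_eq_rpow, div_eq_mul_inv,
      Real.sqrt_mul_self (by positivity)]
  rw [xiEntry, h1, rank, Fintype.card_coe, weylSum]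
  push_cast
  rw [div_mul_eq_div_div, div_eq_mul_inv _ (volY b : ℂ)]

end Entries

/-! ### The iterated product as a function of its last end point -/

section Iter

variable {ι M N : Type*} [Fintype ι] [AddCommGroup M] [Module ℝ M] [AddCommGroup N] [Module ℝ N]
variable {P : RootPairing ι ℝ M N} [P.IsRootSystem] (b : P.Base) {θ : ι} {κ : ℕ}

theorem fullPath_last {t : ℕ} (x y : M) (p : Fin t → M) :
    fullPath x y p (Fin.last (t + 1)) = y := by
  rw [fullPath, ← Fin.succ_last, Fin.cons_succ, Fin.snoc_last]

theorem fullPath_snoc_castSucc {t : ℕ} (x y c : M) (p : Fin t → M) (k : Fin (t + 2)) :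
    fullPath x y (Fin.snoc (α := fun _ => M) p c) k.castSucc = fullPath x c p k := by
  rw [fullPath, fullPath, Fin.cons_snoc_eq_snoc_cons, Fin.snoc_castSucc]

theorem iterProd_zero (m : ℕ → ℤ) (x y : M) :
    iterProd b θ κ m 0 x y = xiEntry b κ y x := by
  rw [iterProd, finsum_eq_sum_of_fintype]
  simp [fullPath]
  rfl

theorem iterProd_succ (hθ : IsHighestRoot b θ) (m : ℕ → ℤ) (t : ℕ) (x y : M) :
    iterProd b θ κ m (t + 1) x y = ∑ᶠ c : alcoveWeights b θ κ,
      xiEntry b κ y c * thetaEntry b θ κ (c : M) c ^ m (t + 1) * iterProd b θ κ m t x c := by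
  have := (finite_alcoveWeights b hθ κ).to_subtype
  have := Fintype.ofFinite (alcoveWeights b θ κ)
  simp only [iterProd, finsum_eq_sum_of_fintype]
  rw [← (Fin.snocEquiv fun _ : Fin (t + 1) => alcoveWeights b θ κ).sum_comp, Fintype.sum_prod_type]
  refine Finset.sum_congr rfl fun c _ => ?_
  rw [Finset.mul_sum]
  refine Finset.sum_congr rfl fun p _ => ?_
  set p' := Fin.snocEquiv (fun _ : Fin (t + 1) => alcoveWeights b θ κ) (c, p) with hp'
  have h1 : ∀ j : Fin t, p' j.castSucc = p j := fun j => by simp [hp', Fin.snocEquiv]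
  have h2 : p' (Fin.last t) = c := by simp [hp', Fin.snocEquiv]
  have hp : (fun i => (p' i : M)) = Fin.snoc (α := fun _ => M) (fun i => (p i : M)) c := by
    funext i
    refine Fin.lastCases ?_ (fun j => ?_) i
    · rw [h2, Fin.snoc_last]
    · rw [h1, Fin.snoc_castSucc]
  have h3 : ∏ i : Fin (t + 1), thetaEntry b θ κ (p' i : M) (p' i) ^ m (i + 1) =
      (∏ i : Fin t, thetaEntry b θ κ (p i : M) (p i) ^ m (i + 1)) *
        thetaEntry b θ κ (c : M) c ^ m (t + 1) := by
    rw [Fin.prod_univ_castSucc]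
    simp only [h1, h2, Fin.val_castSucc, Fin.val_last]
  rw [hp, h3, Fin.prod_univ_castSucc]
  simp only [Fin.succ_castSucc, fullPath_snoc_castSucc, Fin.succ_last, fullPath_last]
  ring

variable [P.IsCrystallographic] [P.IsReduced]

/-- The end point `y` enters only through the leftmost Ξ entry, so the product inherits its
antisymmetry; periodicity under κY^∨ follows in the same way. -/
theorem iterProd_smul (hθ : IsHighestRoot b θ) (m : ℕ → ℤ) (t : ℕ) (x y : M) (w : P.weylGroup) :
    iterProd b θ κ m t x (w • y) = weylDet P w * iterProd b θ κ m t x y := by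
  have : Nonempty ι := ⟨θ⟩
  have := (finite_alcoveWeights b hθ κ).to_subtype
  have := Fintype.ofFinite (alcoveWeights b θ κ)
  have h : ∀ c, xiEntry b κ (w • y) c = weylDet P w * xiEntry b κ y c := fun c => by
    rw [xiEntry_eq, xiEntry_eq, weylSum_smul]; ring
  cases t with
  | zero => rw [iterProd_zero, iterProd_zero, h]
  | succ t =>
    rw [iterProd_succ b hθ, iterProd_succ b hθ, finsum_eq_sum_of_fintype, finsum_eq_sum_of_fintype,
      Finset.mul_sum]
    exact Finset.sum_congr rfl fun c _ => by rw [h]; ring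

theorem iterProd_add (hθ : IsHighestRoot b θ) (hκ : 0 < κ) (m : ℕ → ℤ) (t : ℕ) {x y v : M}
    (hx : x ∈ weightLattice b) (hv : v ∈ corootLattice b) :
    iterProd b θ κ m t x (y + (κ : ℝ) • v) = iterProd b θ κ m t x y := by
  have : Nonempty ι := ⟨θ⟩
  have h : ∀ c ∈ weightLattice b, xiEntry b κ (y + (κ : ℝ) • v) c = xiEntry b κ y c :=
    fun c hc => by rw [xiEntry_eq, xiEntry_eq, weylSum_add b hκ hc hv]
  cases t with
  | zero => rw [iterProd_zero, iterProd_zero, h x hx]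
  | succ t =>
    rw [iterProd_succ b hθ, iterProd_succ b hθ]
    exact finsum_congr fun c => by rw [h c c.2.1]

end Iter

/-! ### The inductive step -/

section TermLimit

theorem sign_div_eq {κ : ℝ} (hκ : 0 < κ) {a a' : ℤ} (ha : a ≠ 0) (ha' : a' ≠ 0) :
    ((SignType.sign ((a' : ℝ) / (κ * a)) : SignType) : ℤ) = (a * a').sign := by
  rcases lt_or_gt_of_ne ha with h | h <;> rcases lt_or_gt_of_ne ha' with h' | h'
  all_goals
    have hR := h
    have hR' := h'
    rify at hR hR'
  · rw [sign_pos (div_pos_of_neg_of_neg hR' (mul_neg_of_pos_of_neg hκ hR)),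
      Int.sign_eq_one_of_pos (mul_pos_of_neg_of_neg h h')]; rfl
  · rw [sign_neg (div_neg_of_pos_of_neg hR' (mul_neg_of_pos_of_neg hκ hR)),
      Int.sign_eq_neg_one_of_neg (mul_neg_of_neg_of_pos h h')]; rfl
  · rw [sign_neg (div_neg_of_neg_of_pos hR' (mul_pos hκ hR)),
      Int.sign_eq_neg_one_of_neg (mul_neg_of_pos_of_neg h h')]; rfl
  · rw [sign_pos (div_pos hR' (mul_pos hκ hR)),
      Int.sign_eq_one_of_pos (mul_pos h h')]; rfl

variable {ι M N : Type*} [Fintype ι] [AddCommGroup M] [Module ℝ M] [AddCommGroup N] [Module ℝ N]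
variable {P : RootPairing ι ℝ M N} [P.IsRootSystem] (b : P.Base) {κ : ℕ}
variable [P.IsCrystallographic] [P.IsReduced] [P.IsIrreducible]

variable (P) in
/-- A term of the Gauss sum attached to the matrix with first column `(a, c)`. -/
noncomputable def gaussTerm (κ : ℕ) (a c : ℤ) (v x y : M) : ℂ :=
  Complex.exp (-(Real.pi * Complex.I / (a * κ)) *
    ((c * normSq P (y + (κ : ℝ) • v) + 2 * stdForm P (y + (κ : ℝ) • v) x : ℝ) : ℂ))

omit [P.IsCrystallographic] [P.IsReduced] [P.IsIrreducible] in
theorem norm_gaussTerm (a c : ℤ) (v x y : M) : ‖gaussTerm P κ a c v x y‖ = 1 := by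
  rw [gaussTerm, ← Complex.norm_exp_ofReal_mul_I (-(Real.pi / (a * κ)) *
    (c * normSq P (y + (κ : ℝ) • v) + 2 * stdForm P (y + (κ : ℝ) • v) x))]
  congr 2
  push_cast
  ring

/-- The limit of the theta series attached to one term of a Gauss sum. -/
theorem tendsto_gaussTerm [Nonempty ι] (hκ : 0 < κ) {a c m a' : ℤ} (ha : a ≠ 0)
    (haa' : a' = m * a - c) (ha' : a' ≠ 0)
    (s : (corootLattice b ⧸ mulCorootLattice b a') → corootLattice b)
    (hs : ∀ q, Submodule.Quotient.mk (s q) = q) {x y v : M} (hx : x ∈ weightLattice b)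
    (hy : y ∈ weightLattice b) (hv : v ∈ corootLattice b) :
    Tendsto (fun ε : ℝ => (ε : ℂ) ^ (Fintype.card b.support / 2 : ℂ) *
        ∑' k : b.support → ℤ,
          Complex.exp (-(2 * Real.pi * Complex.I / κ) *
              (stdForm P y (latVec (fundWeight b) k) : ℂ)) *
            Complex.exp (Real.pi * Complex.I / κ * m * (normSq P (latVec (fundWeight b) k) : ℂ)) *
            gaussTerm P κ a c v x (latVec (fundWeight b) k) *
            Complex.exp (-(Real.pi * ε) *
              (stdForm P (latVec (fundWeight b) k) (latVec (fundWeight b) k) : ℝ)))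
      (𝓝[>] 0)
      (𝓝 (((|(a' : ℝ) / (κ * a)| ^ ((Fintype.card b.support : ℝ) / 2) /
          |(a' : ℝ)| ^ Fintype.card b.support : ℝ) : ℂ) *
        Complex.exp (Real.pi * Complex.I / 4) ^
          ((Fintype.card b.support : ℤ) * (a * a').sign) *
        (Complex.exp (-(Real.pi * Complex.I / κ) * (1 / ((a : ℂ) * a')) * (normSq P x : ℂ)) *
          ∑ᶠ q, gaussTerm P κ a' a (s q) x y))) := by
  classical
  have hκ' : (0 : ℝ) < κ := by exact_mod_cast hκ
  have hκC : (κ : ℂ) ≠ 0 := by exact_mod_cast hκ.ne'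
  have haR : (a : ℝ) ≠ 0 := by exact_mod_cast ha
  have haR' : (a' : ℝ) ≠ 0 := by exact_mod_cast ha'
  have haC : (a : ℂ) ≠ 0 := by exact_mod_cast ha
  have haC' : (a' : ℂ) ≠ 0 := by exact_mod_cast ha'
  have : Finite (corootLattice b ⧸ mulCorootLattice b a') := finite_quotient b ha'
  have := Fintype.ofFinite (corootLattice b ⧸ mulCorootLattice b a')
  have hef : ∀ i j, stdForm P (corootBasis b i) (fundWeight b j) = if i = j then 1 else 0 :=
    fun i j => by rw [stdForm_corootBasis_fundWeight]
  obtain ⟨E, hE⟩ := exists_section_equiv b ha' s hs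
  -- Modulo 2πi and apart from the damping, the exponents at z - κv add up to πi r|z|² - 2πi⟨z, φ⟩,
  -- because m/κ - c/(aκ) = a'/(aκ). The shift by κv only moves the centre of the damping.
  set φ : M := (κ : ℝ)⁻¹ • (y + (a : ℝ)⁻¹ • x) with hφdef
  set r : ℝ := (a' : ℝ) / (κ * a) with hr
  have hr0 : r ≠ 0 := div_ne_zero haR' (mul_ne_zero hκ'.ne' haR)
  have hYX := corootLattice_le b
  obtain ⟨k₀, hk₀⟩ : ∃ k₀, latVec (fundWeight b) k₀ = (κ : ℝ) • v := by
    refine (mem_weightLattice_iff_latVec b).1 ?_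
    rw [Nat.cast_smul_eq_nsmul]
    exact nsmul_mem (hYX hv) κ
  -- As a'/r = κa, the change is 2κa⟨s q + φ, u⟩ + κaa'|u|², an even integer because u pairs
  -- integrally with weights and |u|² is even.
  have hφ : ∀ q n, ∃ j : ℤ,
      stdForm P ((s q : M) + φ + (a' : ℝ) • latVec (corootBasis b) n)
        ((s q : M) + φ + (a' : ℝ) • latVec (corootBasis b) n) / r =
      stdForm P ((s q : M) + φ) ((s q : M) + φ) / r + 2 * j := by
    intro q n
    have hu : latVec (corootBasis b) n ∈ corootLattice b :=
      (mem_corootLattice_iff_latVec b).2 ⟨n, rfl⟩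
    set u := latVec (corootBasis b) n
    obtain ⟨n₁, h1⟩ := exists_int_stdForm b (hYX (s q).2) hu
    obtain ⟨n₂, h2⟩ := exists_int_stdForm b hy hu
    obtain ⟨n₃, h3⟩ := exists_int_stdForm b hx hu
    obtain ⟨n₄, h4⟩ := exists_int_normSq b hu fun y hy => hYX hy
    refine ⟨κ * a * n₁ + a * n₂ + n₃ + κ * a * a' * n₄, ?_⟩
    rw [normSq] at h4
    simp only [map_add, LinearMap.map_add₂, map_smul, LinearMap.map_smul₂, LinearMap.smul_apply,
      LinearMap.add_apply, smul_eq_mul, hφdef, stdForm_symm P u, h1, h2, h3, h4, hr]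
    push_cast
    field_simp
    ring
  have h := tendsto_gauss_reciprocity_shift (stdForm_symm P) (stdForm_pos P) (corootBasis b)
    (fundWeight b) hef hr0 ha' (fun q => (s q : M)) E hE φ hφ k₀
  rw [hr, sign_div_eq hκ' ha ha', ← hr] at h
  refine (h.congr fun ε => ?_).trans_eq ?_
  · congr 1
    rw [← (Equiv.addRight k₀).tsum_eq]
    refine tsum_congr fun k => ?_
    obtain ⟨n₁, h1⟩ := exists_int_stdForm b ((mem_weightLattice_iff_latVec b).2 ⟨k, rfl⟩) hv
    obtain ⟨n₂, h2⟩ := exists_int_stdForm b hy hv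
    obtain ⟨n₃, h3⟩ := exists_int_normSq b hv fun y hy => hYX hy
    rw [Equiv.coe_addRight, latVec_add, hk₀, add_sub_cancel_right, gaussTerm, ← Complex.exp_add,
      ← Complex.exp_add, ← Complex.exp_add, Complex.exp_eq_exp_iff_exists_int]
    refine ⟨m * n₁ + κ * m * n₃ - n₂, ?_⟩
    set z := latVec (fundWeight b) k
    rw [normSq] at h3
    simp only [normSq, map_add, LinearMap.map_add₂, map_smul, LinearMap.map_smul₂,
      LinearMap.smul_apply, LinearMap.add_apply, smul_eq_mul, hφdef, stdForm_symm P v z,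
      stdForm_symm P z y, stdForm_symm P v y, h1, h2, h3, hr, haa']
    push_cast
    field_simp
    ring
  · congr 1
    rw [finsum_eq_sum_of_fintype]
    congr 1
    rw [Finset.mul_sum]
    -- Here |s q + φ|²/r = (a/(a'κ))|y + κ s q + x/a|². Expanding in x/a gives the next Gauss term,
    -- for the column (a', a), and a phase in |x|².
    refine Finset.sum_congr rfl fun q _ => ?_
    rw [gaussTerm, ← Complex.exp_add]
    congr 1
    simp only [normSq, map_add, LinearMap.map_add₂, map_smul, LinearMap.map_smul₂,
      LinearMap.smul_apply, LinearMap.add_apply, smul_eq_mul, hφdef, hr,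
      stdForm_symm P x y, stdForm_symm P y (s q), stdForm_symm P x (s q)]
    push_cast
    field_simp
    ring

end TermLimit

section Step

variable {ι M N : Type*} [Fintype ι] [AddCommGroup M] [Module ℝ M] [AddCommGroup N] [Module ℝ N]
variable {P : RootPairing ι ℝ M N} [P.IsRootSystem] (b : P.Base) {θ : ι} {κ : ℕ}

theorem thetaEntry_zpow (θ : ι) (κ : ℕ) (x : M) (m : ℤ) : thetaEntry b θ κ x x ^ m =
    Complex.exp (Real.pi * Complex.I / κ * m * (normSq P x : ℂ)) *
      Complex.exp (-(Real.pi * Complex.I / (dualCoxeter b θ : ℂ)) * m *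
        (normSq P (rho b) : ℂ)) := by
  rw [thetaEntry, if_pos rfl, ← Complex.exp_int_mul, ← Complex.exp_add]
  congr 1
  ring

variable [P.IsCrystallographic] [P.IsReduced]

/-- The Weyl group permutes the weights; in coordinates this is the reindexing of sums over the
weight lattice. -/
theorem exists_smul_equiv (w : P.weylGroup) : ∃ F : (b.support → ℤ) ≃ (b.support → ℤ),
    ∀ k, latVec (fundWeight b) (F k) = w • latVec (fundWeight b) k := by
  have h : ∀ w : P.weylGroup, ∀ k, ∃ k', latVec (fundWeight b) k' = w • latVec (fundWeight b) k :=
    fun w k => (mem_weightLattice_iff_latVec b).1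
      (smul_mem_weightLattice b w ((mem_weightLattice_iff_latVec b).2 ⟨k, rfl⟩))
  choose F hF using h
  refine ⟨⟨F w, F w⁻¹, fun k => ?_, fun k => ?_⟩, hF w⟩
  · apply latVec_injective (fundWeight b)
    rw [hF, hF, inv_smul_smul]
  · apply latVec_injective (fundWeight b)
    rw [hF, hF, smul_inv_smul]

variable [P.IsIrreducible]

theorem summable_norm_gauss [Nonempty ι] {ε : ℝ} (hε : 0 < ε) :
    Summable fun k : b.support → ℤ => ‖Complex.exp (-(Real.pi * ε) *
      (stdForm P (latVec (fundWeight b) k) (latVec (fundWeight b) k) : ℝ))‖ := by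
  classical
  have h := summable_norm_cexp_latVec (stdForm_symm P) (stdForm_pos P) (fundWeight b)
    (s := (Real.pi * ε : ℝ)) (by rw [Complex.ofReal_re]; have := Real.pi_pos; positivity) 0
  simpa using h

/-- The sum over the alcove of an entry of `𝓡(Ξ)`, a power of an entry of `𝓡(Θ)` and a Gauss sum
is a Gauss sum. -/
theorem alcove_sum_eq (hθ : IsHighestRoot b θ) (hκ : 0 < κ) {a c m a' : ℤ} (ha : a ≠ 0)
    (haa' : a' = m * a - c) (ha' : a' ≠ 0)
    (s : (corootLattice b ⧸ mulCorootLattice b a) → corootLattice b)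
    (s' : (corootLattice b ⧸ mulCorootLattice b a') → corootLattice b)
    (hs' : ∀ q, Submodule.Quotient.mk (s' q) = q) {x y : M} (hx : x ∈ weightLattice b)
    (hy : y ∈ weightLattice b) {T : M → ℂ} {K : ℂ}
    (hTW : ∀ z, ∀ w : P.weylGroup, T (w • z) = weylDet P w * T z)
    (hTY : ∀ z, ∀ v ∈ corootLattice b, T (z + (κ : ℝ) • v) = T z)
    (hT : ∀ z ∈ weightLattice b, T z = K * ∑ᶠ w : P.weylGroup, (weylDet P w : ℂ) *
      ∑ᶠ q, gaussTerm P κ a c (s q) (w • x) z) :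
    ∑ᶠ z : alcoveWeights b θ κ, weylSum P κ y z * thetaEntry b θ κ (z : M) z ^ m * T z =
      (((κ : ℝ) ^ Fintype.card b.support * volY b : ℝ) : ℂ) * (K *
        Complex.exp (-(Real.pi * Complex.I / (dualCoxeter b θ : ℂ)) * m *
          (normSq P (rho b) : ℂ)) * ((|(a : ℝ)| ^ Fintype.card b.support : ℝ) : ℂ) *
        (((|(a' : ℝ) / (κ * a)| ^ ((Fintype.card b.support : ℝ) / 2) /
          |(a' : ℝ)| ^ Fintype.card b.support : ℝ) : ℂ) *
          Complex.exp (Real.pi * Complex.I / 4) ^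
            ((Fintype.card b.support : ℤ) * (a * a').sign)) *
        Complex.exp (-(Real.pi * Complex.I / κ) * (1 / ((a : ℂ) * a')) * (normSq P x : ℂ)) *
        ∑ᶠ w : P.weylGroup, (weylDet P w : ℂ) * ∑ᶠ q, gaussTerm P κ a' a (s' q) (w • x) y) := by
  classical
  have : Nonempty ι := ⟨θ⟩
  have hκ' : (0 : ℝ) < κ := by exact_mod_cast hκ
  have : Finite P.weylGroup := finite_weylGroup
  have := Fintype.ofFinite P.weylGroup
  have : Finite (corootLattice b ⧸ mulCorootLattice b a) := finite_quotient b ha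
  have := Fintype.ofFinite (corootLattice b ⧸ mulCorootLattice b a)
  set l := Fintype.card b.support with hl
  set ρf : ℂ := Complex.exp (-(Real.pi * Complex.I / (dualCoxeter b θ : ℂ)) * m *
          (normSq P (rho b) : ℂ)) with hρf
  set coef : ℂ := ((|(a' : ℝ) / (κ * a)| ^ ((l : ℝ) / 2) / |(a' : ℝ)| ^ l : ℝ) : ℂ) *
          Complex.exp (Real.pi * Complex.I / 4) ^ ((l : ℤ) * (a * a').sign) with hcoef
  set Ex : ℂ := Complex.exp (-(Real.pi * Complex.I / κ) * (1 / ((a : ℂ) * a')) *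
    (normSq P x : ℂ)) with hEx
  set R : P.weylGroup → ℂ := fun w => ∑ᶠ q, gaussTerm P κ a' a (s' q) (w • x) y with hR
  set lam : (b.support → ℤ) → M := latVec (fundWeight b) with hlam
  have hlamX : ∀ k, lam k ∈ weightLattice b := fun k =>
    (mem_weightLattice_iff_latVec b).2 ⟨k, rfl⟩
  set G : ℝ → (b.support → ℤ) → ℂ := fun ε k =>
    Complex.exp (-(Real.pi * ε) * (stdForm P (lam k) (lam k) : ℝ)) with hG
  set g : M → ℂ := fun z => weylSum P κ y z * thetaEntry b θ κ z z ^ m * T z with hg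
  set h : M → ℂ := fun z => Complex.exp (-(2 * Real.pi * Complex.I / κ) *
    (stdForm P y z : ℂ)) * thetaEntry b θ κ z z ^ m * T z with hh
  set term : P.weylGroup → (corootLattice b ⧸ mulCorootLattice b a) → ℝ →
      (b.support → ℤ) → ℂ := fun w q ε k =>
    Complex.exp (-(2 * Real.pi * Complex.I / κ) * (stdForm P y (lam k) : ℂ)) *
      Complex.exp (Real.pi * Complex.I / κ * m * (normSq P (lam k) : ℂ)) *
      gaussTerm P κ a c (s q) (w • x) (lam k) * G ε k with hterm
  -- The limit is the same for all classes q, so the sum over q contributes only its number of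
  -- terms, |a|^l.
  have hlim : ∀ w q, Tendsto (fun ε : ℝ => (ε : ℂ) ^ (l / 2 : ℂ) * ∑' k, term w q ε k)
      (𝓝[>] 0) (𝓝 (coef * (Ex * R w))) := by
    intro w q
    have h1 := tendsto_gaussTerm b hκ ha haa' ha' s' hs' (smul_mem_weightLattice b w hx) hy (s q).2
    have h2 : normSq P (w • x) = normSq P x := stdForm_smul_smul P w x x
    rw [h2] at h1
    exact h1
  have hsumm : ∀ w q, ∀ ε : ℝ, 0 < ε → Summable (term w q ε) := by
    intro w q ε hε
    refine Summable.of_norm ((summable_norm_gauss b hε).congr fun k => ?_)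
    have e1 : ‖Complex.exp (-(2 * Real.pi * Complex.I / κ) * (stdForm P y (lam k) : ℂ))‖ = 1 := by
      rw [← Complex.norm_exp_ofReal_mul_I (-(2 * Real.pi / κ) * stdForm P y (lam k))]
      congr 2; push_cast; ring
    have e2 : ‖Complex.exp (Real.pi * Complex.I / κ * m * (normSq P (lam k) : ℂ))‖ = 1 := by
      rw [← Complex.norm_exp_ofReal_mul_I (Real.pi / κ * m * normSq P (lam k))]
      congr 2; push_cast; ring
    rw [hterm, norm_mul, norm_mul, norm_mul, e1, e2, norm_gaussTerm, one_mul, one_mul, one_mul]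
  have hhG : ∀ ε k, h (lam k) * G ε k =
      ∑ w, ∑ q, K * ρf * weylDet P w * term w q ε k := by
    intro ε k
    rw [hh]
    simp only
    rw [hT _ (hlamX k), thetaEntry_zpow, finsum_eq_sum_of_fintype]
    simp only [finsum_eq_sum_of_fintype, Finset.mul_sum, Finset.sum_mul]
    refine Finset.sum_congr rfl fun w _ => Finset.sum_congr rfl fun q _ => ?_
    rw [hterm, hρf]
    ring
  have hhasSum : ∀ ε : ℝ, 0 < ε → HasSum (fun k => h (lam k) * G ε k)
      (∑ w, ∑ q, K * ρf * weylDet P w * ∑' k, term w q ε k) := by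
    intro ε hε
    simp only [hhG]
    exact hasSum_sum fun w _ => hasSum_sum fun q _ => (hsumm w q ε hε).hasSum.mul_left _
  -- Substituting u(z) for z turns the u-th term of the Weyl sum into the term u = 1: the
  -- determinant produced by T cancels that of u. This gives |W| equal copies.
  have hgsum : ∀ ε : ℝ, 0 < ε → HasSum (fun k => g (lam k) * G ε k)
      (∑ _u : P.weylGroup, ∑ w, ∑ q, K * ρf * weylDet P w * ∑' k, term w q ε k) := by
    intro ε hε
    have h1 : ∀ k, g (lam k) * G ε k = ∑ u : P.weylGroup, (weylDet P u : ℂ) *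
        Complex.exp (-(2 * Real.pi * Complex.I / κ) * (stdForm P (u • y) (lam k) : ℂ)) *
        thetaEntry b θ κ (lam k) (lam k) ^ m * T (lam k) * G ε k := by
      intro k
      rw [hg]
      simp only
      rw [weylSum, finsum_eq_sum_of_fintype]
      simp only [Finset.sum_mul]
    simp only [h1]
    refine hasSum_sum fun u _ => ?_
    obtain ⟨F, hF⟩ := exists_smul_equiv b u
    rw [← F.hasSum_iff]
    convert hhasSum ε hε using 1
    funext k
    have hdet : (weylDet P u : ℂ) * weylDet P u = 1 := by exact_mod_cast weylDet_mul_self P u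
    simp only [Function.comp_apply, hG, hh]
    rw [show lam (F k) = u • lam k from hF k, stdForm_smul_smul, stdForm_smul_smul,
      thetaEntry_smul, hTW]
    linear_combination (Complex.exp (-(2 * Real.pi * Complex.I / κ) *
      (stdForm P y (lam k) : ℂ)) * thetaEntry b θ κ (lam k) (lam k) ^ m * T (lam k) *
        Complex.exp (-(Real.pi * ε) * (stdForm P (lam k) (lam k) : ℝ))) * hdet
  have hT1 := tendsto_unfold b hθ hκ (f := g) (fun z _ w => ?_) (fun z hz v hv => ?_)
    (fun z hz hne => ?_)
  · have hT2 : Tendsto (fun ε : ℝ => (ε : ℂ) ^ (l / 2 : ℂ) * ∑' k, g (lam k) * G ε k) (𝓝[>] 0)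
        (𝓝 (∑ _u : P.weylGroup, ∑ w, ∑ _q : corootLattice b ⧸ mulCorootLattice b a,
          K * ρf * weylDet P w * (coef * (Ex * R w)))) := by
      have h1 := tendsto_finsetSum (Finset.univ : Finset P.weylGroup) fun _ _ =>
        tendsto_finsetSum (Finset.univ : Finset P.weylGroup) fun w _ =>
        tendsto_finsetSum (Finset.univ : Finset (corootLattice b ⧸ mulCorootLattice b a))
          fun q _ => (hlim w q).const_mul (K * ρf * weylDet P w)
      refine h1.congr' ?_
      filter_upwards [self_mem_nhdsWithin] with ε hε
      rw [(hgsum ε hε).tsum_eq]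
      simp only [Finset.mul_sum]
      refine Finset.sum_congr rfl fun _ _ => Finset.sum_congr rfl fun w _ =>
        Finset.sum_congr rfl fun q _ => by ring
    -- The same mean is evaluated by unfolding and by reciprocity; the order of W occurs on both
    -- sides and cancels.
    have huniq := tendsto_nhds_unique hT1 hT2
    have hcardQ : (Fintype.card (corootLattice b ⧸ mulCorootLattice b a) : ℂ) =
        ((|(a : ℝ)| ^ l : ℝ) : ℂ) := by
      have h1 : ((a.natAbs : ℝ) : ℂ) = (|(a : ℝ)| : ℝ) := by rw [Nat.cast_natAbs, Int.cast_abs]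
      rw [← Nat.card_eq_fintype_card, natCard_quotient, Complex.ofReal_pow, ← h1]
      push_cast
      rfl
    have hW : (Fintype.card P.weylGroup : ℂ) ≠ 0 := by
      exact_mod_cast Fintype.card_ne_zero
    have hD : (((κ : ℝ) ^ l * volY b : ℝ) : ℂ) ≠ 0 := by
      have := volY_pos b
      exact_mod_cast (by positivity : (κ : ℝ) ^ l * volY b ≠ 0)
    simp only [Finset.sum_const, Finset.card_univ, nsmul_eq_mul, hcardQ] at huniq
    rw [Nat.card_eq_fintype_card, div_mul_eq_mul_div, div_eq_iff hD, mul_assoc] at huniq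
    have h3 := mul_left_cancel₀ hW huniq
    rw [finsum_eq_sum_of_fintype (f := fun w : P.weylGroup => (weylDet P w : ℂ) * R w)]
    rw [h3, mul_comm]
    congr 1
    rw [Finset.mul_sum]
    exact Finset.sum_congr rfl fun w _ => by ring
  · rw [hg]
    simp only
    rw [weylSum_comm, weylSum_smul, weylSum_comm, thetaEntry_smul, hTW]
    have : (weylDet P w : ℂ) * weylDet P w = 1 := by exact_mod_cast weylDet_mul_self P w
    linear_combination (weylSum P κ y z * thetaEntry b θ κ z z ^ m * T z) * this
  · rw [hg]
    simp only
    rw [weylSum_comm, weylSum_add b hκ hy hv, weylSum_comm, thetaEntry_add b θ hκ hz hv, hTY z v hv]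
  · have hne' : weylSum P κ y z ≠ 0 := left_ne_zero_of_mul (left_ne_zero_of_mul hne)
    rw [weylSum_comm] at hne'
    exact ⟨fun i _ h0 => hne' (weylSum_eq_zero_of_wall h0),
      fun h0 => hne' (weylSum_eq_zero_of_upper_wall b hκ hy h0)⟩

end Step

/-! ### Recurrence for the first columns of the matrices -/

section Recurrence

theorem coe_T_zpow_mul_S (n : ℤ) :
    ((ModularGroup.T ^ n * ModularGroup.S : Matrix.SpecialLinearGroup (Fin 2) ℤ) :
      Matrix (Fin 2) (Fin 2) ℤ) = !![n, -1; 1, 0] := by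
  rw [Matrix.SpecialLinearGroup.coe_mul, ModularGroup.coe_T_zpow, ModularGroup.coe_S]
  simp [Matrix.mul_fin_two]

theorem aSeq_zero (m : ℕ → ℤ) : aSeq m 0 = 1 := by simp [aSeq, matB]

theorem cSeq_zero (m : ℕ → ℤ) : cSeq m 0 = 0 := by simp [cSeq, matB]

theorem aSeq_succ (m : ℕ → ℤ) (k : ℕ) : aSeq m (k + 1) = m (k + 1) * aSeq m k - cSeq m k := by
  rw [aSeq, matB, Matrix.SpecialLinearGroup.coe_mul, coe_T_zpow_mul_S]
  simp [Matrix.mul_apply, Fin.sum_univ_two, aSeq, cSeq, sub_eq_add_neg]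

/-- Hence c_t is nonzero for t ≥ 1 once the preceding upper left entry is, which permits completing
the square. -/
theorem cSeq_succ (m : ℕ → ℤ) (k : ℕ) : cSeq m (k + 1) = aSeq m k := by
  rw [cSeq, matB, Matrix.SpecialLinearGroup.coe_mul, coe_T_zpow_mul_S]
  simp [Matrix.mul_apply, Fin.sum_univ_two, aSeq]

end Recurrence

/-! ### The induction and its constants -/

section Main

variable {ι M N : Type*} [Fintype ι] [AddCommGroup M] [Module ℝ M] [AddCommGroup N] [Module ℝ N]
variable {P : RootPairing ι ℝ M N} [P.IsRootSystem] (b : P.Base) {θ : ι} {κ : ℕ}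

/-- The constant in front of the Gauss sum. -/
noncomputable def gaussConst (θ : ι) (κ : ℕ) (m : ℕ → ℤ) (t : ℕ) (x : M) : ℂ :=
  Complex.I ^ ((t + 1) * numPos b) /
      ((((κ : ℝ) * |(aSeq m t : ℝ)|) ^ ((rank b : ℝ) / 2) * volY b : ℝ) : ℂ) *
    Complex.exp (Real.pi * Complex.I / 4) ^ ((rank b : ℤ) * signSum m t) *
    Complex.exp (-(Real.pi * Complex.I / (dualCoxeter b θ : ℂ)) *
      (∑ i ∈ Finset.Icc 1 t, (m i : ℂ)) * (normSq P (rho b) : ℂ)) *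
    Complex.exp (-(Real.pi * Complex.I / κ) *
      (∑ i ∈ Finset.Icc 1 t, 1 / ((aSeq m (i - 1) : ℂ) * (aSeq m i : ℂ))) *
      (normSq P x : ℂ))

theorem cexp_mul_add_mul (u v w z : ℂ) :
    Complex.exp (u * (v + w) * z) = Complex.exp (u * v * z) * Complex.exp (u * w * z) := by
  rw [← Complex.exp_add]
  ring_nf

/-- The factors are, in order: the normalisation of Ξ, the volume from unfolding, the previous
constant, the number of classes modulo a, and the modulus from reciprocity. -/
theorem gauss_modulus {κ a a' V : ℝ} (hκ : 0 < κ) (ha : a ≠ 0) (ha' : a' ≠ 0) (hV : V ≠ 0)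
    (l : ℕ) : 1 / (κ ^ ((l : ℝ) / 2) * V) * (κ ^ l * V) * (1 / ((κ * |a|) ^ ((l : ℝ) / 2) * V)) *
      |a| ^ l * (|a' / (κ * a)| ^ ((l : ℝ) / 2) / |a'| ^ l) =
    1 / ((κ * |a'|) ^ ((l : ℝ) / 2) * V) := by
  have hp : ∀ z : ℝ, 0 < z → z ^ l = z ^ ((l : ℝ) / 2) * z ^ ((l : ℝ) / 2) := fun z hz => by
    rw [← Real.rpow_add hz, add_halves, Real.rpow_natCast]
  have h1 := abs_pos.2 ha
  have h2 := abs_pos.2 ha'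
  rw [hp κ hκ, hp _ h1, hp _ h2, abs_div, abs_mul, abs_of_pos hκ, Real.div_rpow h2.le (by positivity),
    Real.mul_rpow hκ.le h1.le, Real.mul_rpow hκ.le h2.le]
  have e1 := (Real.rpow_pos_of_pos hκ ((l : ℝ) / 2)).ne'
  have e2 := (Real.rpow_pos_of_pos h1 ((l : ℝ) / 2)).ne'
  have e3 := (Real.rpow_pos_of_pos h2 ((l : ℝ) / 2)).ne'
  field_simp

theorem gaussConst_succ [Nonempty ι] (θ : ι) (hκ : 0 < κ) (m : ℕ → ℤ) (t : ℕ) (x : M)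
    (ha : aSeq m t ≠ 0) (ha' : aSeq m (t + 1) ≠ 0) :
    Complex.I ^ numPos b /
      (((κ : ℝ) ^ ((Fintype.card b.support : ℝ) / 2) * volY b : ℝ) : ℂ) *
    ((((κ : ℝ) ^ Fintype.card b.support * volY b : ℝ) : ℂ) * (gaussConst b θ κ m t x *
        Complex.exp (-(Real.pi * Complex.I / (dualCoxeter b θ : ℂ)) * m (t + 1) *
          (normSq P (rho b) : ℂ)) * ((|(aSeq m t : ℝ)| ^ Fintype.card b.support : ℝ) : ℂ) *
        (((|(aSeq m (t + 1) : ℝ) / (κ * aSeq m t)| ^ ((Fintype.card b.support : ℝ) / 2) /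
          |(aSeq m (t + 1) : ℝ)| ^ Fintype.card b.support : ℝ) : ℂ) *
          Complex.exp (Real.pi * Complex.I / 4) ^
            ((Fintype.card b.support : ℤ) * (aSeq m t * aSeq m (t + 1)).sign)) *
        Complex.exp (-(Real.pi * Complex.I / κ) *
          (1 / ((aSeq m t : ℂ) * aSeq m (t + 1))) * (normSq P x : ℂ)))) =
    gaussConst b θ κ m (t + 1) x := by
  have hV := (volY_pos b).ne'
  have hmod := congrArg (fun r : ℝ => (r : ℂ)) (gauss_modulus (κ := κ) (by exact_mod_cast hκ)
    (a := aSeq m t) (by exact_mod_cast ha) (a' := aSeq m (t + 1)) (by exact_mod_cast ha') hV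
    (Fintype.card b.support))
  have hζ : Complex.exp (Real.pi * Complex.I / 4) ≠ 0 := Complex.exp_ne_zero _
  simp only [gaussConst, signSum, rank, Fintype.card_coe] at hmod ⊢
  rw [Finset.sum_Icc_succ_top (by omega), Finset.sum_Icc_succ_top (by omega),
    Finset.sum_Icc_succ_top (by omega), Nat.add_sub_cancel, mul_add ((b.support.card : ℕ) : ℤ),
    zpow_add₀ hζ, cexp_mul_add_mul, cexp_mul_add_mul, show (t + 1 + 1) * numPos b = numPos b + (t + 1) * numPos b by ring,
    pow_add]
  simp only [Complex.ofReal_mul, Complex.ofReal_div, Complex.ofReal_one] at hmod ⊢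
  linear_combination (Complex.I ^ numPos b * Complex.I ^ ((t + 1) * numPos b) *
    Complex.exp (Real.pi * Complex.I / 4) ^
      ((b.support.card : ℤ) * ∑ i ∈ Finset.Icc 1 t, (aSeq m (i - 1) * aSeq m i).sign) *
    Complex.exp (Real.pi * Complex.I / 4) ^
      ((b.support.card : ℤ) * (aSeq m t * aSeq m (t + 1)).sign) *
    Complex.exp (-(Real.pi * Complex.I / (dualCoxeter b θ : ℂ)) *
      (∑ i ∈ Finset.Icc 1 t, (m i : ℂ)) * (normSq P (rho b) : ℂ)) *
    Complex.exp (-(Real.pi * Complex.I / (dualCoxeter b θ : ℂ)) * (m (t + 1) : ℂ) *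
      (normSq P (rho b) : ℂ)) *
    Complex.exp (-(Real.pi * Complex.I / κ) *
      (∑ i ∈ Finset.Icc 1 t, 1 / ((aSeq m (i - 1) : ℂ) * (aSeq m i : ℂ))) *
      (normSq P x : ℂ)) *
    Complex.exp (-(Real.pi * Complex.I / κ) * (1 / ((aSeq m t : ℂ) * aSeq m (t + 1))) *
      (normSq P x : ℂ))) * hmod

variable [P.IsCrystallographic] [P.IsReduced] [P.IsIrreducible]

/-- With a_0 = 1 and c_0 = 0 the quotient is a single class, whose representative only contributes
an integer multiple of 2πi. -/
theorem iterProd_zero_eq (hθ : IsHighestRoot b θ) (hκ : 0 < κ) (m : ℕ → ℤ) {x y : M}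
    (hx : x ∈ weightLattice b)
    (s : (corootLattice b ⧸ mulCorootLattice b (aSeq m 0)) → corootLattice b) :
    iterProd b θ κ m 0 x y = gaussConst b θ κ m 0 x * ∑ᶠ w : P.weylGroup, (weylDet P w : ℂ) *
      ∑ᶠ q, gaussTerm P κ (aSeq m 0) (cSeq m 0) (s q) (w • x) y := by
  have : Nonempty ι := ⟨θ⟩
  have hκC : (κ : ℂ) ≠ 0 := by exact_mod_cast hκ.ne'
  have hcard := natCard_quotient b (aSeq m 0)
  rw [show (aSeq m 0).natAbs = 1 by rw [aSeq_zero]; rfl, one_pow] at hcard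
  obtain ⟨hsub, hne⟩ := Nat.card_eq_one_iff_unique.1 hcard
  have := Fintype.ofFinite (corootLattice b ⧸ mulCorootLattice b (aSeq m 0))
  have hconst : gaussConst b θ κ m 0 x = Complex.I ^ numPos b /
      (((κ : ℝ) ^ ((Fintype.card b.support : ℝ) / 2) * volY b : ℝ) : ℂ) := by
    simp [gaussConst, signSum, rank, aSeq_zero]
  rw [iterProd_zero, xiEntry_eq, weylSum_comm, hconst]
  congr 1
  refine finsum_congr fun w => ?_
  congr 1
  obtain ⟨q₀⟩ := hne
  have huniq : ∀ q, q = q₀ := fun q => Subsingleton.elim _ _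
  obtain ⟨n, hn⟩ := exists_int_stdForm b (smul_mem_weightLattice b w hx) (s q₀).2
  rw [finsum_eq_single _ q₀ fun q hq => absurd (huniq q) hq, gaussTerm, aSeq_zero, cSeq_zero,
    Complex.exp_eq_exp_iff_exists_int]
  refine ⟨n, ?_⟩
  rw [LinearMap.map_add₂, LinearMap.map_smul₂, stdForm_symm P (s q₀), hn, stdForm_symm P y]
  push_cast
  rw [smul_eq_mul]
  push_cast
  field_simp
  ring

/-- The iterated product as a Gauss sum, without completing the square. -/
theorem iterProd_eq (hθ : IsHighestRoot b θ) (hκ : 0 < κ) (m : ℕ → ℤ) {x : M}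
    (hx : x ∈ weightLattice b) (t : ℕ) (ha : ∀ k, 1 ≤ k → k ≤ t → aSeq m k ≠ 0) {y : M}
    (hy : y ∈ weightLattice b)
    (s : (corootLattice b ⧸ mulCorootLattice b (aSeq m t)) → corootLattice b)
    (hs : ∀ q, Submodule.Quotient.mk (s q) = q) :
    iterProd b θ κ m t x y = gaussConst b θ κ m t x * ∑ᶠ w : P.weylGroup, (weylDet P w : ℂ) *
      ∑ᶠ q, gaussTerm P κ (aSeq m t) (cSeq m t) (s q) (w • x) y := by
  have : Nonempty ι := ⟨θ⟩
  induction t generalizing y with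
  | zero => exact iterProd_zero_eq b hθ hκ m hx s
  | succ t ih =>
    have hat : aSeq m t ≠ 0 := by
      rcases Nat.eq_zero_or_pos t with rfl | h
      · rw [aSeq_zero]; exact one_ne_zero
      · exact ha t h (Nat.le_succ t)
    have hat' := ha (t + 1) (by omega) le_rfl
    -- The induction hypothesis holds for any representatives modulo a_t, so an arbitrary section is
    -- chosen.
    have hmk := Submodule.Quotient.mk_surjective (mulCorootLattice b (aSeq m t))
    have hstep := alcove_sum_eq b hθ hκ hat (aSeq_succ m t) hat' (Function.surjInv hmk) s hs hx hy
      (T := iterProd b θ κ m t x) (K := gaussConst b θ κ m t x)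
      (fun z w => iterProd_smul b hθ m t x z w)
      (fun z v hv => iterProd_add b hθ hκ m t hx hv)
      (fun z hz => ih (fun k h1 h2 => ha k h1 (by omega)) hz _ (Function.surjInv_eq hmk))
    have := (finite_alcoveWeights b hθ κ).to_subtype
    have := Fintype.ofFinite (alcoveWeights b θ κ)
    rw [iterProd_succ b hθ, cSeq_succ, ← gaussConst_succ b θ hκ m t x hat hat']
    rw [finsum_eq_sum_of_fintype] at hstep ⊢
    have h1 : ∑ c : alcoveWeights b θ κ, xiEntry b κ y c * thetaEntry b θ κ (c : M) c ^ m (t + 1) *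
        iterProd b θ κ m t x c = Complex.I ^ numPos b /
      (((κ : ℝ) ^ ((Fintype.card b.support : ℝ) / 2) * volY b : ℝ) : ℂ) *
        ∑ c : alcoveWeights b θ κ, weylSum P κ y c * thetaEntry b θ κ (c : M) c ^ m (t + 1) *
          iterProd b θ κ m t x c := by
      rw [Finset.mul_sum]
      exact Finset.sum_congr rfl fun c _ => by rw [xiEntry_eq]; ring
    rw [h1, hstep]
    ring

/-- Completing the square in `iterProd_eq` costs a phase in |x|²/(a_t c_t). As c_t = a_{t-1}, it
cancels the last summand of the exponent in `gaussConst`, leaving `constK`. -/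
theorem iterProd_eq_constK_mul (hθ : IsHighestRoot b θ) (hκ : 0 < κ) (m : ℕ → ℤ) {x : M}
    (hx : x ∈ weightLattice b) (t : ℕ) (ht : 1 ≤ t)
    (ha : ∀ k, 1 ≤ k → k ≤ t → aSeq m k ≠ 0) {y : M}
    (hy : y ∈ weightLattice b)
    (s : (corootLattice b ⧸ mulCorootLattice b (aSeq m t)) → corootLattice b)
    (hs : ∀ q, Submodule.Quotient.mk (s q) = q) :
    iterProd b θ κ m t x y = constK b θ κ m t x * ∑ᶠ w : P.weylGroup, (weylDet P w : ℂ) *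
      ∑ᶠ q : corootLattice b ⧸ mulCorootLattice b (aSeq m t),
        Complex.exp (-(Real.pi * Complex.I * (cSeq m t : ℂ) / ((aSeq m t : ℂ) * κ)) *
          (normSq P (y + (κ : ℝ) • (s q : M) + (1 / (cSeq m t : ℝ)) • (w • x)) : ℂ)) := by
  obtain ⟨t, rfl⟩ : ∃ u, t = u + 1 := ⟨t - 1, by omega⟩
  have hat : aSeq m t ≠ 0 := by
    rcases Nat.eq_zero_or_pos t with rfl | h
    · rw [aSeq_zero]; exact one_ne_zero
    · exact ha t h (Nat.le_succ t)
  have hat' := ha (t + 1) (by omega) le_rfl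
  have hκC : (κ : ℂ) ≠ 0 := by exact_mod_cast hκ.ne'
  have haR : (aSeq m t : ℝ) ≠ 0 := by exact_mod_cast hat
  have haC : (aSeq m t : ℂ) ≠ 0 := by exact_mod_cast hat
  have haC' : (aSeq m (t + 1) : ℂ) ≠ 0 := by exact_mod_cast hat'
  have : Finite P.weylGroup := finite_weylGroup
  have := Fintype.ofFinite P.weylGroup
  have : Finite (corootLattice b ⧸ mulCorootLattice b (aSeq m (t + 1))) := finite_quotient b hat'
  have := Fintype.ofFinite (corootLattice b ⧸ mulCorootLattice b (aSeq m (t + 1)))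
  have hconst : gaussConst b θ κ m (t + 1) x = constK b θ κ m (t + 1) x *
      Complex.exp (-(Real.pi * Complex.I / κ) *
        (1 / ((aSeq m t : ℂ) * aSeq m (t + 1))) * (normSq P x : ℂ)) := by
    rw [gaussConst, constK, Nat.add_sub_cancel,
      Finset.sum_Icc_succ_top (f := fun i => 1 / ((aSeq m (i - 1) : ℂ) * (aSeq m i : ℂ)))
        (by omega), Nat.add_sub_cancel, cexp_mul_add_mul]
    ring
  rw [iterProd_eq b hθ hκ m hx (t + 1) ha hy s hs, hconst, cSeq_succ, mul_assoc]
  congr 1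
  simp only [finsum_eq_sum_of_fintype, Finset.mul_sum]
  refine Finset.sum_congr rfl fun w _ => Finset.sum_congr rfl fun q _ => ?_
  rw [mul_left_comm, gaussTerm, ← Complex.exp_add]
  congr 2
  have hw : stdForm P (w • x) (w • x) = stdForm P x x := stdForm_smul_smul P w x x
  generalize y + (κ : ℝ) • (s q : M) = z
  simp only [normSq, map_add, LinearMap.map_add₂, map_smul, LinearMap.map_smul₂,
    LinearMap.smul_apply, LinearMap.add_apply, smul_eq_mul, hw, stdForm_symm P (w • x) z]
  push_cast
  field_simp
  ring

end Main

end LieModular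

theorem lemma2p3 {𝔤 : Type*} [LieRing 𝔤] [LieAlgebra ℂ 𝔤] [FiniteDimensional ℂ 𝔤]
    [LieAlgebra.IsSimple ℂ 𝔤] (𝔥 : LieSubalgebra ℂ 𝔤) [𝔥.IsCartanSubalgebra]
    (b : (realRootSystem 𝔥).Base) (θ : 𝔥.root) (hθ : LieModular.IsHighestRoot b θ)
    (κ : ℕ) (hκ : 0 < κ) (t : ℕ) (ht : 1 ≤ t) (m : ℕ → ℤ)
    (ha : ∀ k, 1 ≤ k → k ≤ t → LieModular.aSeq m k ≠ 0)
    (x y : (LieAlgebra.IsKilling.rootSystem 𝔥).rootSpan ℝ)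
    (hx : x ∈ LieModular.weightLattice b) (hy : y ∈ LieModular.weightLattice b)
    (s : (LieModular.corootLattice b ⧸
      LieModular.mulCorootLattice b (LieModular.aSeq m t)) → LieModular.corootLattice b)
    (hs : ∀ q, Submodule.Quotient.mk (s q) = q) :
    LieModular.iterProd b θ κ m t x y =
      LieModular.constK b θ κ m t x *
        ∑ᶠ w : (realRootSystem 𝔥).weylGroup, (LieModular.weylDet (realRootSystem 𝔥) w : ℂ) *
          ∑ᶠ q : LieModular.corootLattice b ⧸
              LieModular.mulCorootLattice b (LieModular.aSeq m t),
            Complex.exp (-(Real.pi * Complex.I * (LieModular.cSeq m t : ℂ) /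
                ((LieModular.aSeq m t : ℂ) * κ)) *
              (LieModular.normSq (realRootSystem 𝔥)
                (y + (κ : ℝ) • (s q : (LieAlgebra.IsKilling.rootSystem 𝔥).rootSpan ℝ) +
                  (1 / (LieModular.cSeq m t : ℝ)) • (w • x)) : ℂ)) := by
  have : Nonempty 𝔥.root := ⟨θ⟩
  have := LieModular.isIrreducible_realRootSystem 𝔥
  exact LieModular.iterProd_eq_constK_mul b hθ hκ m hx t ht ha hy s hs
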